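/- **Theorem 6 (Additivity principle).** Let $N,K,m,n\in\mathbb N$ and consider the system $y_{i,k}=H_{i,k}\theta+w_{i,k}$, $1\le i\le N$, $1\le k\le K$, with $H_{i,k}\in\mathbb R^{m\times n}$, $\theta\in\mathbb R^n$, and independent Gaussian noises $w_{i,k}\sim\mathcal N(\mu_{i,k},\Sigma_{i,k})$ with $\Sigma_{i,k}$ positive definite. Let $S_{i,k}\in\mathbb R^{m\times m}$ be positive semidefinite and suppose that $\sum_{i,k}H_{i,k}^\top S_{i,k}H_{i,k}$ is invertible. *Conventions.* For a family of laws of $z$ with densities $p(z|x)$ with respect to a common $\sigma$-finite measure, the Fisher information matrix is $\mathcal I_z(x)=\mathbb E\big[\tfrac{\partial\ln p(z|x)}{\partial x}\big(\tfrac{\partial\ln p(z|x)}{\partial x}\big)^\top\big|x\big]$. It is said to exist at $x$ if $p(z|\cdot)$ is differentiable at $x$ for almost every $z$, the score is square integrable, and $\frac{\partial}{\partial x}\mathbb E[h(z)|x]=\mathbb E[h(z)\frac{\partial \ln p(z|x)}{\partial x}|x]$ for all bounded measurable $h$. An inequality $\mathcal I_z(x)\le S$ (in the order of symmetric matrices)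 includes that $\mathcal I_z(x)$ exists. The supremum of a family $(A_t)$ of symmetric matrices is the (necessarily unique) symmetric $\bar A$ with $v^\top\bar Av=\sup_t v^\top A_tv$ for all $v$, if it exists. A function is piecewise $C^1$ if its domain is covered by a locally finite sequence of Borel pieces with Lebesgue-null boundary such that on each piece the function agrees with a function that is $C^1$ on an open set containing the piece. *Single measurement.* For $y=H\theta+w$, a mechanism $z=M(y,d)$, where $d\in\mathbb R^q$ has probability density $f$ and is independent of $w$, and $z\in\mathbb R^r$ ($q,r$ arbitrary), is admissible if $M$ and $f$ are piecewise $C^1$ and $\mathbb E\big[\tfrac{\partial\ln p(z|d,\theta)}{\partial\theta}\big(\tfrac{\partial\ln p(z|w,\theta)}{\partial\theta}\big)^\top\big|\theta\big]=0$ for all $\theta$. Set $\mathcal{PI}_{y|S}(\theta)=\sup\mathcal I_z(\theta)$, the supremum over all admissible mechanisms with $\mathcal I_z(y)\le S$ for all $y\in\mathbb R^m$. *Whole system.* A mechanism is a family $z_{i,k}=M_{i,k}\big((y_{i,t})_{t\le k},(d_{i,t})_{t\le k},(z_{j,t})_{1\le j\le N,\,t<k}\big)$, where the $d_{i,k}$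 have probability densities $f_{i,k}$ and are independent of each other and of all $w_{i,k}$. Write $\mathcal Z_K,\mathcal D_K,\mathcal W_K$ for the collections of all $z_{i,k},d_{i,k},w_{i,k}$. The mechanism is admissible if all $M_{i,k}$ and $f_{i,k}$ are piecewise $C^1$ and $\mathbb E\big[\tfrac{\partial\ln p(\mathcal Z_K|\mathcal D_K,\theta)}{\partial\theta}\big(\tfrac{\partial\ln p(\mathcal Z_K|\mathcal W_K,\theta)}{\partial\theta}\big)^\top\big|\theta\big]=0$ for all $\theta$. Set $\mathcal{PI}_{\mathcal Y_K|\mathcal S_K}(\theta)=\sup\mathcal I_{\mathcal Z_K}(\theta)$, the supremum over all admissible mechanisms that satisfy the user-level privacy constraints $\mathcal I_{\mathcal Z_K}(\bar Y_{i,K})\le\operatorname{diag}(S_{i,K},\dots,S_{i,1})$ for all $i$, where $\bar Y_{i,K}$ collects the measurements of sensor $i$ and the Fisher information with respect to $\bar Y_{i,K}$ is that of the law of $\mathcal Z_K$ given all measurements, those of the other sensors being held fixed, and the constraint is required at all values of all measurements. *Claim.* For every $\theta\in\mathbb R^n$ all these privacy-preserving Fisher information matrices exist, and $$\mathcal{PI}_{\mathcal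 Y_K|\mathcal S_K}(\theta)=\sum_{i=1}^N\sum_{k=1}^K\mathcal{PI}_{y_{i,k}|S_{i,k}}(\theta).$$ -/

import Mathlib

open MeasureTheory ProbabilityTheory
open scoped Matrix

noncomputable section

namespace PrivacyFisher

/-! ### Scores and Fisher information -/

/-- The partial derivative `∂f/∂x_a` at `x`. -/
def pderiv {ι : Type*} [Fintype ι] [DecidableEq ι] (a : ι) (f : (ι → ℝ) → ℝ) (x : ι → ℝ) : ℝ :=
  fderiv ℝ f x (Pi.single a 1)

/-- `ℓ` is the score `z ↦ ∂ ln p(z | x) / ∂x` at the point `x` of the parametric family `P` of laws: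
the family has densities `p(· | x')` with respect to a common σ-finite measure, and for
almost every outcome `z` the density is differentiable in the parameter at `x`, with
logarithmic derivative `ℓ z`. (Almost surely `p(z | x) > 0`, so `Real.log` is harmless.) -/
def IsScore {ι Z : Type*} [Fintype ι] [DecidableEq ι] [MeasurableSpace Z]
    (P : (ι → ℝ) → Measure Z) (x : ι → ℝ) (ℓ : Z → ι → ℝ) : Prop :=
  ∃ (ν : Measure Z) (p : (ι → ℝ) → Z → ℝ), SigmaFinite ν ∧
    (∀ x', Measurable (p x')) ∧ (∀ x' z, 0 ≤ p x' z) ∧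
    (∀ x', P x' = ν.withDensity (fun z => ENNReal.ofReal (p x' z))) ∧
    ∀ᵐ z ∂(P x), DifferentiableAt ℝ (fun x' => p x' z) x ∧
      ∀ a, ℓ z a = pderiv a (fun x' => Real.log (p x' z)) x

/-- The usual regularity condition: for bounded statistics `h`, the expectation
`E[h(z) | x]` may be differentiated under the integral sign,
`∂/∂x ∫ h(z) p(z | x) dz = ∫ h(z) (∂ ln p(z | x) / ∂x) p(z | x) dz`. -/
def DiffUnderIntegral {ι Z : Type*} [Fintype ι] [DecidableEq ι] [MeasurableSpace Z]
    (P : (ι → ℝ) → Measure Z) (x : ι → ℝ) (ℓ : Z → ι → ℝ) : Prop :=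
  ∀ h : Z → ℝ, Measurable h → (∃ C : ℝ, ∀ z, |h z| ≤ C) →
    DifferentiableAt ℝ (fun x' => ∫ z, h z ∂(P x')) x ∧
      ∀ a, pderiv a (fun x' => ∫ z, h z ∂(P x')) x = ∫ z, h z * ℓ z a ∂(P x)

/-- The family `P` has the (finite) Fisher information matrix
`J = E[(∂ ln p(z | x)/∂x) (∂ ln p(z | x)/∂x)ᵀ | x]` at `x`. -/
def HasFisherInfo {ι Z : Type*} [Fintype ι] [DecidableEq ι] [MeasurableSpace Z]
    (P : (ι → ℝ) → Measure Z) (x : ι → ℝ) (J : Matrix ι ι ℝ) : Prop :=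
  ∃ ℓ : Z → ι → ℝ, IsScore P x ℓ ∧ DiffUnderIntegral P x ℓ ∧
    (∀ a, MemLp (fun z => ℓ z a) 2 (P x)) ∧
    ∀ a b, J a b = ∫ z, ℓ z a * ℓ z b ∂(P x)

/-! ### Supremum of a family of symmetric matrices -/

/-- `A` is the supremum of the family `𝒜`: `A` is symmetric and
`vᵀ A v = sup_{B ∈ 𝒜} vᵀ B v` for every vector `v`. -/
def IsMatrixSup {ι : Type*} [Fintype ι] (𝒜 : Set (Matrix ι ι ℝ)) (A : Matrix ι ι ℝ) : Prop :=
  A.IsSymm ∧ ∀ v : ι → ℝ, IsLUB ((fun B : Matrix ι ι ℝ => v ⬝ᵥ B *ᵥ v) '' 𝒜) (v ⬝ᵥ A *ᵥ v)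

/-- The supremum of a family of symmetric matrices is unique. -/
theorem IsMatrixSup.unique {ι : Type*} [Fintype ι] {𝒜 : Set (Matrix ι ι ℝ)}
    {A B : Matrix ι ι ℝ} (hA : IsMatrixSup 𝒜 A) (hB : IsMatrixSup 𝒜 B) : A = B := by
  classical
  have hq : ∀ v : ι → ℝ, v ⬝ᵥ A *ᵥ v = v ⬝ᵥ B *ᵥ v := fun v => (hA.2 v).unique (hB.2 v)
  ext a b
  have h1 := hq (Pi.single a 1)
  have h2 := hq (Pi.single b 1)
  have h3 := hq (Pi.single a 1 + Pi.single b 1)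
  have hAs := hA.1.apply a b
  have hBs := hB.1.apply a b
  simp [Matrix.mulVec_add, add_dotProduct, dotProduct_add, Matrix.mulVec_single] at h1 h2 h3
  linarith

/-! ### Piecewise continuously differentiable functions -/

/-- `f` is piecewise continuously differentiable: the space is covered by a locally finite
sequence of Borel pieces with Lebesgue-null boundary, and on each piece `f` agrees with
a function that is continuously differentiable on an open set containing the piece. -/
def PiecewiseC1 {E F : Type*} [NormedAddCommGroup E] [NormedSpace ℝ E] [MeasureSpace E]
    [NormedAddCommGroup F] [NormedSpace ℝ F] (f : E → F) : Prop :=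
  ∃ A : ℕ → Set E, LocallyFinite A ∧ (⋃ j, A j) = Set.univ ∧
    ∀ j, MeasurableSet (A j) ∧ volume (frontier (A j)) = 0 ∧
      ∃ (U : Set E) (g : E → F), IsOpen U ∧ A j ⊆ U ∧ ContDiffOn ℝ 1 g U ∧ Set.EqOn f g (A j)

/-- `f` is a piecewise continuously differentiable probability density on `ℝ^q`. -/
def IsPC1Density {q : ℕ} (f : (Fin q → ℝ) → ℝ) : Prop :=
  (∀ d, 0 ≤ f d) ∧ PiecewiseC1 f ∧ ∫⁻ d, ENNReal.ofReal (f d) = 1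

/-- The law with Lebesgue density `f`. -/
def densityLaw {q : ℕ} (f : (Fin q → ℝ) → ℝ) : Measure (Fin q → ℝ) :=
  volume.withDensity (fun d => ENNReal.ofReal (f d))

/-! ### Obfuscating a measurement `y = h θ + w`

Here `h θ` is the noiseless measurement, `w ∼ μw` the measurement noise, `d ∼ μd` the privacy
noise, independent of `w`, and `z = M y d` the released output. -/

section Obfuscation

variable {n : ℕ} {Y D Z : Type*} [Add Y] [MeasurableSpace Y] [MeasurableSpace D]
  [MeasurableSpace Z]

/-- The law of the output `z` given the sensitive measurement `y`. -/
def lawGivenY (M : Y → D → Z) (μd : Measure D) (y : Y) : Measure Z :=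
  μd.map (fun d => M y d)

/-- The law of the output `z` given `d`, when the parameter is `θ`. -/
def lawGivenD (h : (Fin n → ℝ) → Y) (μw : Measure Y) (M : Y → D → Z) (d : D)
    (θ : Fin n → ℝ) : Measure Z :=
  μw.map (fun w => M (h θ + w) d)

/-- The law of the output `z` given `w`, when the parameter is `θ`. -/
def lawGivenW (h : (Fin n → ℝ) → Y) (M : Y → D → Z) (μd : Measure D) (w : Y)
    (θ : Fin n → ℝ) : Measure Z :=
  μd.map (fun d => M (h θ + w) d)

/-- The law of the output `z`, when the parameter is `θ`. -/
def outputLaw (h : (Fin n → ℝ) → Y) (μw : Measure Y) (M : Y → D → Z) (μd : Measure D)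
    (θ : Fin n → ℝ) : Measure Z :=
  (μw.prod μd).map (fun x => M (h θ + x.1) x.2)

/-- The orthogonality of the conditional scores required of an admissible mechanism:
`E[(∂ ln p(z | d, θ)/∂θ) (∂ ln p(z | w, θ)/∂θ)ᵀ | θ] = 0` for every `θ`. -/
def ScoresOrthogonal (h : (Fin n → ℝ) → Y) (μw : Measure Y) (M : Y → D → Z)
    (μd : Measure D) : Prop :=
  ∀ θ : Fin n → ℝ, ∃ (sD : D → Z → Fin n → ℝ) (sW : Y → Z → Fin n → ℝ),
    (∀ᵐ d ∂μd, IsScore (lawGivenD h μw M d) θ (sD d)) ∧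
    (∀ᵐ w ∂μw, IsScore (lawGivenW h M μd w) θ (sW w)) ∧
    ∀ a b, Integrable
        (fun x : Y × D => sD x.2 (M (h θ + x.1) x.2) a * sW x.1 (M (h θ + x.1) x.2) b)
        (μw.prod μd) ∧
      ∫ x : Y × D, sD x.2 (M (h θ + x.1) x.2) a * sW x.1 (M (h θ + x.1) x.2) b
        ∂(μw.prod μd) = 0

end Obfuscation

/-! ### A single measurement `y = H θ + w` -/

/-- The mechanism `z = M(y, d)`, `d ∼ f`, is admissible for `y = H θ + w`, `w ∼ μw`. -/
def Admissible {m n q r : ℕ} (H : Matrix (Fin m) (Fin n) ℝ) (μw : Measure (Fin m → ℝ))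
    (M : (Fin m → ℝ) → (Fin q → ℝ) → (Fin r → ℝ)) (f : (Fin q → ℝ) → ℝ) : Prop :=
  PiecewiseC1 (fun x : (Fin m → ℝ) × (Fin q → ℝ) => M x.1 x.2) ∧ IsPC1Density f ∧
    ScoresOrthogonal (fun θ => H *ᵥ θ) μw M (densityLaw f)

/-- The privacy constraint `I_z(y) ≤ S`, at every value `y` of the measurement. -/
def PrivacyConstraint {m q r : ℕ} (S : Matrix (Fin m) (Fin m) ℝ)
    (M : (Fin m → ℝ) → (Fin q → ℝ) → (Fin r → ℝ)) (f : (Fin q → ℝ) → ℝ) : Prop :=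
  ∀ y, ∃ J, HasFisherInfo (lawGivenY M (densityLaw f)) y J ∧ (S - J).PosSemidef

/-- `A` is the privacy-preserving Fisher information matrix of `y = H θ + w`, `w ∼ μw`, at `θ`
under the privacy constraint `I_z(y) ≤ S`: the supremum of `I_z(θ)` over all admissible
mechanisms satisfying the constraint. -/
def IsPPFisher {m n : ℕ} (H : Matrix (Fin m) (Fin n) ℝ) (μw : Measure (Fin m → ℝ))
    (S : Matrix (Fin m) (Fin m) ℝ) (θ : Fin n → ℝ) (A : Matrix (Fin n) (Fin n) ℝ) : Prop :=
  IsMatrixSup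
    {J | ∃ (q r : ℕ) (M : (Fin m → ℝ) → (Fin q → ℝ) → (Fin r → ℝ)) (f : (Fin q → ℝ) → ℝ),
      Admissible H μw M f ∧ PrivacyConstraint S M f ∧
        HasFisherInfo (outputLaw (fun θ' => H *ᵥ θ') μw M (densityLaw f)) θ J} A

/-! ### Measurements `y_{i,k} = H_{i,k} θ + w_{i,k}` of sensors `i` at times `k` -/

section Multi

variable {N K m n : ℕ} {q r : Fin N → Fin K → ℕ}

/-- A family of maps `M_{i,k}` producing `z_{i,k}` from `(y_{i,t})_{t ≤ k}`, `(d_{i,t})_{t ≤ k}`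
and the outputs `(z_{j,t})` of all sensors `j` at all earlier times `t < k`. -/
abbrev RecMechanism (N K m : ℕ) (q r : Fin N → Fin K → ℕ) : Type :=
  ∀ (i : Fin N) (k : Fin K),
    (({t : Fin K // t ≤ k} → Fin m → ℝ) × (∀ t : {t : Fin K // t ≤ k}, Fin (q i t) → ℝ) ×
      (∀ (j : Fin N) (t : {t : Fin K // t < k}), Fin (r j t) → ℝ)) → (Fin (r i k) → ℝ)

/-- The outputs `z_{1,k}, …, z_{N,k}` at time `k`, computed recursively. -/
def recOutput (M : RecMechanism N K m q r) (Y : Fin N → Fin K → Fin m → ℝ)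
    (D : ∀ i k, Fin (q i k) → ℝ) (k : Fin K) (i : Fin N) : Fin (r i k) → ℝ :=
  M i k (fun t => Y i t, fun t => D i t, fun j t => recOutput M Y D t.1 j)
termination_by k
decreasing_by exact t.2

/-- The collective representation `𝒵_K = M_K(𝒴_K, 𝒟_K)` of a recursive mechanism. -/
def collective (M : RecMechanism N K m q r) (Y : Fin N → Fin K → Fin m → ℝ)
    (D : ∀ i k, Fin (q i k) → ℝ) : ∀ i k, Fin (r i k) → ℝ :=
  fun i k => recOutput M Y D k i

/-- The joint law of independent measurement noises `w_{i,k} ∼ μw i k`. -/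
def jointNoise (μw : Fin N → Fin K → Measure (Fin m → ℝ)) :
    Measure (Fin N → Fin K → Fin m → ℝ) :=
  Measure.pi fun i => Measure.pi fun k => μw i k

/-- The joint law of independent privacy noises `d_{i,k}` with densities `f i k`. -/
def jointPrivacyNoise (f : ∀ i k, (Fin (q i k) → ℝ) → ℝ) :
    Measure (∀ i k, Fin (q i k) → ℝ) :=
  Measure.pi fun i => Measure.pi fun k => densityLaw (f i k)

/-- Admissibility of a recursive mechanism: all `M_{i,k}` and `f_{d,i,k}` are piecewise
continuously differentiable and the collective representation has orthogonal scores. -/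
def MultiAdmissible (H : Fin N → Fin K → Matrix (Fin m) (Fin n) ℝ)
    (μw : Fin N → Fin K → Measure (Fin m → ℝ)) (M : RecMechanism N K m q r)
    (f : ∀ i k, (Fin (q i k) → ℝ) → ℝ) : Prop :=
  (∀ i k, PiecewiseC1 (M i k)) ∧ (∀ i k, IsPC1Density (f i k)) ∧
    ScoresOrthogonal (fun θ i k => H i k *ᵥ θ) (jointNoise μw) (collective M)
      (jointPrivacyNoise f)

/-- The user-level privacy constraints `I_{𝒵_K}(Ȳ_{i,K}) ≤ diag(S_{i,k})_k` for every sensor `i`.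
At every point `Y` of measurements, the Fisher information is taken with respect to the
measurements of sensor `i` (listed with index set `Fin m × Fin K`), those of the other
sensors being held fixed. -/
def UserPrivacyConstraint (S : Fin N → Fin K → Matrix (Fin m) (Fin m) ℝ)
    (M : RecMechanism N K m q r) (f : ∀ i k, (Fin (q i k) → ℝ) → ℝ) : Prop :=
  ∀ (Y : Fin N → Fin K → Fin m → ℝ) (i : Fin N),
    ∃ J : Matrix (Fin m × Fin K) (Fin m × Fin K) ℝ,
      HasFisherInfo
        (fun x : Fin m × Fin K → ℝ =>
          lawGivenY (collective M) (jointPrivacyNoise f)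
            (Function.update Y i fun k a => x (a, k)))
        (fun ak => Y i ak.2 ak.1) J ∧
      (Matrix.blockDiagonal (S i) - J).PosSemidef

/-- `A` is the privacy-preserving Fisher information matrix at `θ` of the whole system
`y_{i,k} = H_{i,k} θ + w_{i,k}`, with independent `w_{i,k} ∼ μw i k`, under the user-level privacy
constraints: the supremum of `I_{𝒵_K}(θ)` over all admissible recursive mechanisms
satisfying the constraints. -/
def IsMultiPPFisher (H : Fin N → Fin K → Matrix (Fin m) (Fin n) ℝ)
    (μw : Fin N → Fin K → Measure (Fin m → ℝ)) (S : Fin N → Fin K → Matrix (Fin m) (Fin m) ℝ)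
    (θ : Fin n → ℝ) (A : Matrix (Fin n) (Fin n) ℝ) : Prop :=
  IsMatrixSup
    {J | ∃ (q r : Fin N → Fin K → ℕ) (M : RecMechanism N K m q r)
      (f : ∀ i k, (Fin (q i k) → ℝ) → ℝ),
      MultiAdmissible H μw M f ∧ UserPrivacyConstraint S M f ∧
        HasFisherInfo (outputLaw (fun θ' i k => H i k *ᵥ θ') (jointNoise μw) (collective M)
          (jointPrivacyNoise f)) θ J} A

end Multi

/-- The Gaussian law `N(μ, V)` on `ℝ^m`. -/
def gaussianLaw {m : ℕ} (μ : Fin m → ℝ) (V : Matrix (Fin m) (Fin m) ℝ) : Measure (Fin m → ℝ) :=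
  (multivariateGaussian (WithLp.toLp 2 μ) V).map (fun x => WithLp.ofLp x)

end PrivacyFisher

end

noncomputable section

namespace PrivacyFisher

/-! ### Products of measures with densities -/

/-! Both sides are computed explicitly. Write `S = Cᵀ C` with `C` of full row rank. For one
measurement the optimum is `Hᵀ P H`, where `P = Cᵀ (C V Cᵀ + 1)⁻¹ C` is the parallel sum of `S` and
`V⁻¹`. For the whole system it is the sum of these matrices, so additivity is immediate once both
values are known.

Attainment: release `C y + d` with standard Gaussian `d`, separately for every measurement. All laws
involved are Gaussian location families, treated uniformly by `IsGaussianShift`. The privacy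
constraint holds with equality, and the score given `d` depends on `w` only while the score given
`w` depends on `d` only, so the two are orthogonal. Full row rank makes the law of `C w`
nondegenerate, so that the score given `d` is available in this form.

Upper bound, one measurement: test the output score in direction `v` against a bounded statistic
`h`. With `g(y) = E[h | y]` and `x = H v`, the correlation is `E[g(y) (x ⬝ T(y))]`, where `T` is the
Gaussian score of `y`. Split `x = x₁ + x₂`. Stein's identity turns the `x₁` part into `E[∂g/∂x₁]`,
and privacy bounds `(∂g/∂x₁)²` by `x₁ᵀ S x₁` times the conditional variance of `h`. Cauchy–Schwarz
bounds the `x₂` part by `x₂ᵀ V⁻¹ x₂` times `E[g²]`. The variance and `g²` add up to `E[h²]`, so the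
squared correlation is at most `(x₁ᵀ S x₁ + x₂ᵀ V⁻¹ x₂) E[h²]` (`sq_integral_mul_score_le`); the
optimal split gives `xᵀ P x` (`exists_add_eq_obfuscatedInfo`). Truncations of the score serve as `h`
(`integral_sq_le_of_forall_bounded`).

Upper bound, whole system: the output score is the sum over sensors of the projections of their
measurement scores onto the transcript. Each projection is bounded as above, with the other sensors
frozen. The projections of different sensors are orthogonal, because independent private inputs stay
conditionally independent given the transcript of an interactive protocol
(`condIrrelevant_transcript`); hence their second moments add
(`integral_sq_le_sum_of_uncorrelated`). Interaction between the sensors therefore gains nothing. -/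

theorem pi_withDensity_ofReal {κ : Type*} [Fintype κ] {α : κ → Type*}
    [∀ j, MeasurableSpace (α j)] (μ : ∀ j, Measure (α j)) [∀ j, SigmaFinite (μ j)]
    (f : ∀ j, α j → ℝ) (hf0 : ∀ j x, 0 ≤ f j x) (hf : ∀ j, Integrable (f j) (μ j)) :
    Measure.pi (fun j => (μ j).withDensity fun x => ENNReal.ofReal (f j x)) =
      (Measure.pi μ).withDensity fun x => ENNReal.ofReal (∏ j, f j (x j)) := by
  have : ∀ j, IsFiniteMeasure ((μ j).withDensity fun x => ENNReal.ofReal (f j x)) := fun j =>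
    isFiniteMeasure_withDensity_ofReal (hf j).2
  refine Measure.pi_eq fun s hs => ?_
  rw [withDensity_apply _ (MeasurableSet.univ_pi hs), Measure.restrict_pi_pi,
    ← ofReal_integral_eq_lintegral_ofReal (Integrable.fintype_prod_dep fun j => (hf j).restrict)
      (Filter.Eventually.of_forall fun x => Finset.prod_nonneg fun j _ => hf0 j (x j)),
    integral_fintype_prod_eq_prod,
    ENNReal.ofReal_prod_of_nonneg fun j _ => integral_nonneg (hf0 j)]
  refine Finset.prod_congr rfl fun j _ => ?_
  rw [withDensity_apply _ (hs j), ofReal_integral_eq_lintegral_ofReal (hf j).restrict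
    (Filter.Eventually.of_forall (hf0 j))]

/-! ### Partial derivatives -/

section Derivatives

variable {ι : Type*} [Fintype ι] [DecidableEq ι]

theorem fderiv_eq_sum_pderiv (f : (ι → ℝ) → ℝ) (x v : ι → ℝ) :
    fderiv ℝ f x v = ∑ a, v a * pderiv a f x := by
  conv_lhs => rw [pi_eq_sum_univ' v]
  simp [pderiv, map_sum]

theorem pderiv_eq_of_hasDerivAt {f : (ι → ℝ) → ℝ} {x : ι → ℝ} {a : ι} {c : ℝ}
    (hf : DifferentiableAt ℝ f x)
    (h : HasDerivAt (fun t : ℝ => f (x + t • Pi.single a 1)) c 0) : pderiv a f x = c := by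
  rw [pderiv, ← hf.lineDeriv_eq_fderiv]
  exact h.deriv

end Derivatives

/-! ### Gaussian shift families

A family of laws whose likelihood ratios are `exp (x ⬝ T z - x ⬝ Q x / 2)`; the location families of
Gaussian laws with a fixed covariance matrix, and products of these, are of this form. -/

/-- One format for the noise, the conditional laws and the output laws, so that score and Fisher
information are computed only once. `Q` may be singular; `Q = 0` describes data that carry no
information. -/
structure IsGaussianShift {ι Z : Type*} [Fintype ι] [MeasurableSpace Z]
    (P : (ι → ℝ) → Measure Z) (T : Z → ι → ℝ) (Q : Matrix ι ι ℝ) : Prop where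
  prob : ∀ x, IsProbabilityMeasure (P x)
  meas : Measurable T
  symm : Q.IsSymm
  density : ∀ x, P x =
    (P 0).withDensity fun z => ENNReal.ofReal (Real.exp (x ⬝ᵥ T z - (x ⬝ᵥ Q *ᵥ x) / 2))

namespace IsGaussianShift

section Basic

variable {ι Z : Type*} [Fintype ι] [MeasurableSpace Z]
  {P : (ι → ℝ) → Measure Z} {T : Z → ι → ℝ} {Q : Matrix ι ι ℝ}

theorem measurable_dotProduct (h : IsGaussianShift P T Q) (x : ι → ℝ) :
    Measurable fun z => x ⬝ᵥ T z := by
  have := h.meas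
  simp only [dotProduct]
  fun_prop

theorem lintegral_eq_one (h : IsGaussianShift P T Q) (x : ι → ℝ) :
    ∫⁻ z, ENNReal.ofReal (Real.exp (x ⬝ᵥ T z - (x ⬝ᵥ Q *ᵥ x) / 2)) ∂P 0 = 1 := by
  have := (h.prob x).measure_univ
  rwa [h.density x, withDensity_apply _ .univ, Measure.restrict_univ] at this

theorem integrable_exp_sub (h : IsGaussianShift P T Q) (x : ι → ℝ) :
    Integrable (fun z => Real.exp (x ⬝ᵥ T z - (x ⬝ᵥ Q *ᵥ x) / 2)) (P 0) := by
  refine ⟨(((h.measurable_dotProduct x).sub_const _).exp).aestronglyMeasurable, ?_⟩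
  rw [hasFiniteIntegral_iff_ofReal (Filter.Eventually.of_forall fun z => (Real.exp_pos _).le),
    h.lintegral_eq_one x]
  exact ENNReal.one_lt_top

theorem integrable_exp (h : IsGaussianShift P T Q) (x : ι → ℝ) :
    Integrable (fun z => Real.exp (x ⬝ᵥ T z)) (P 0) := by
  refine ((h.integrable_exp_sub x).mul_const (Real.exp ((x ⬝ᵥ Q *ᵥ x) / 2))).congr
    (Filter.Eventually.of_forall fun z => ?_)
  simp only
  rw [← Real.exp_add]
  ring_nf

/-- This is the normalization of the density at `x`, read as the Laplace transform of `T`: under `P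
0` the statistic is centred Gaussian with covariance `Q`. -/
theorem integral_exp (h : IsGaussianShift P T Q) (x : ι → ℝ) :
    ∫ z, Real.exp (x ⬝ᵥ T z) ∂P 0 = Real.exp ((x ⬝ᵥ Q *ᵥ x) / 2) := by
  have h1 : ∫ z, Real.exp (x ⬝ᵥ T z - (x ⬝ᵥ Q *ᵥ x) / 2) ∂P 0 = 1 := by
    rw [integral_eq_lintegral_of_nonneg_ae
      (Filter.Eventually.of_forall fun z => (Real.exp_pos _).le)
      (h.integrable_exp_sub x).aestronglyMeasurable, h.lintegral_eq_one x, ENNReal.toReal_one]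
  simp_rw [Real.exp_sub, integral_div] at h1
  rwa [div_eq_one_iff_eq (Real.exp_pos _).ne'] at h1

theorem integral_eq (h : IsGaussianShift P T Q) (x : ι → ℝ) (g : Z → ℝ) :
    ∫ z, g z ∂P x = ∫ z, Real.exp (x ⬝ᵥ T z - (x ⬝ᵥ Q *ᵥ x) / 2) * g z ∂P 0 := by
  rw [h.density x, integral_withDensity_eq_integral_toReal_smul
    (((h.measurable_dotProduct x).sub_const _).exp.ennreal_ofReal)
    (Filter.Eventually.of_forall fun z => ENNReal.ofReal_lt_top)]
  simp only [ENNReal.toReal_ofReal (Real.exp_pos _).le, smul_eq_mul]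

/-- A Gaussian shift family may be based at any point. -/
theorem rebase (h : IsGaussianShift P T Q) (y : ι → ℝ) :
    IsGaussianShift (fun x => P (y + x)) (fun z => T z - Q *ᵥ y) Q where
  prob x := h.prob _
  meas := h.meas.sub_const _
  symm := h.symm
  density x := by
    simp only [add_zero]
    rw [h.density y, h.density (y + x), ← withDensity_mul _
      (((h.measurable_dotProduct y).sub_const _).exp.ennreal_ofReal)
      ((by
        simp only [dotProduct_sub]
        exact ((((h.measurable_dotProduct x).sub_const _).sub_const _).exp.ennreal_ofReal)))]
    congr 1
    funext z
    simp only [Pi.mul_apply]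
    rw [← ENNReal.ofReal_mul (Real.exp_pos _).le, ← Real.exp_add]
    congr 2
    have hs : y ⬝ᵥ Q *ᵥ x = x ⬝ᵥ Q *ᵥ y := by
      rw [Matrix.dotProduct_mulVec, ← Matrix.mulVec_transpose, h.symm, dotProduct_comm]
    simp only [Matrix.mulVec_add, add_dotProduct, dotProduct_add, dotProduct_sub, hs]
    ring

/-- Linear reparametrization. -/
theorem comp_mulVec {κ : Type*} [Fintype κ] (h : IsGaussianShift P T Q) (A : Matrix ι κ ℝ) :
    IsGaussianShift (fun x => P (A *ᵥ x)) (fun z => Aᵀ *ᵥ T z) (Aᵀ * Q * A) where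
  prob x := h.prob _
  meas := by
    have := h.meas
    refine measurable_pi_lambda _ fun a => ?_
    simp only [Matrix.mulVec, dotProduct]
    fun_prop
  symm := by
    rw [Matrix.IsSymm, Matrix.transpose_mul, Matrix.transpose_mul, Matrix.transpose_transpose,
      h.symm, Matrix.mul_assoc]
  density x := by
    simp only [Matrix.mulVec_zero]
    rw [h.density]
    congr 1
    funext z
    congr 3
    · rw [Matrix.dotProduct_mulVec, Matrix.vecMul_transpose]
    · rw [← Matrix.mulVec_mulVec, ← Matrix.mulVec_mulVec, Matrix.dotProduct_mulVec x Aᵀ,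
        Matrix.vecMul_transpose]

/-- The image under a map through which the sufficient statistic factors. -/
theorem map {Z' : Type*} [MeasurableSpace Z'] (h : IsGaussianShift P T Q) {e : Z → Z'}
    (he : Measurable e) {T' : Z' → ι → ℝ} (hT' : Measurable T') (hT : ∀ z, T' (e z) = T z) :
    IsGaussianShift (fun x => (P x).map e) T' Q where
  prob x := by
    have := h.prob x
    exact Measure.isProbabilityMeasure_map he.aemeasurable
  meas := hT'
  symm := h.symm
  density x := by
    have hm : Measurable fun z => ENNReal.ofReal (Real.exp (x ⬝ᵥ T' z - (x ⬝ᵥ Q *ᵥ x) / 2)) := by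
      simp only [dotProduct]
      fun_prop
    ext s hs
    rw [Measure.map_apply he hs, h.density x, withDensity_apply _ (he hs), withDensity_apply _ hs,
      setLIntegral_map hs hm he]
    simp only [hT]

/-- Serves for the outputs of sensors whose measurements are held fixed in a user's privacy
constraint. -/
theorem const (μ : Measure Z) [hμ : IsProbabilityMeasure μ] :
    IsGaussianShift (fun _ : ι → ℝ => μ) (fun _ => 0) 0 where
  prob _ := hμ
  meas := measurable_const
  symm := Matrix.transpose_zero
  density x := by simp

/-- Independent products. -/
theorem pi {κ : Type*} [Fintype κ] {Z : κ → Type*} [∀ j, MeasurableSpace (Z j)]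
    {P : ∀ j, (ι → ℝ) → Measure (Z j)} {T : ∀ j, Z j → ι → ℝ} {Q : κ → Matrix ι ι ℝ}
    (h : ∀ j, IsGaussianShift (P j) (T j) (Q j)) :
    IsGaussianShift (fun x => Measure.pi fun j => P j x) (fun z => ∑ j, T j (z j))
      (∑ j, Q j) where
  prob x := by
    have := fun j => (h j).prob x
    infer_instance
  meas := by
    have := fun j => (h j).meas
    fun_prop
  symm := by
    rw [Matrix.IsSymm, Matrix.transpose_sum]
    exact Finset.sum_congr rfl fun j _ => (h j).symm
  density x := by
    have := fun j => (h j).prob 0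
    have h1 : (fun j => P j x) = fun j => (P j 0).withDensity fun z =>
        ENNReal.ofReal (Real.exp (x ⬝ᵥ T j z - (x ⬝ᵥ Q j *ᵥ x) / 2)) :=
      funext fun j => (h j).density x
    rw [h1, pi_withDensity_ofReal _ _ (fun j z => (Real.exp_pos _).le)
      (fun j => (h j).integrable_exp_sub x)]
    congr 1
    funext z
    rw [← Real.exp_sum, Finset.sum_sub_distrib, dotProduct_sum, Matrix.sum_mulVec, dotProduct_sum,
      Finset.sum_div]

theorem gaussianReal_coord [DecidableEq ι] (a : ι) :
    IsGaussianShift (fun x : ι → ℝ => gaussianReal (x a) 1) (fun z => Pi.single a z)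
      (Matrix.single a a 1) where
  prob x := inferInstance
  meas := by
    refine measurable_pi_lambda _ fun b => ?_
    by_cases hb : b = a
    · subst hb
      simpa using measurable_id'
    · simp [hb]
  symm := by simp [Matrix.IsSymm]
  density x := by
    rw [gaussianReal_of_var_ne_zero _ one_ne_zero, gaussianReal_of_var_ne_zero _ one_ne_zero,
      ← withDensity_mul _ (measurable_gaussianPDF _ _) (by simp; fun_prop)]
    congr 1
    funext z
    simp only [gaussianPDF, Pi.mul_apply]
    rw [← ENNReal.ofReal_mul (gaussianPDFReal_nonneg _ _ _)]
    congr 1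
    simp only [gaussianPDFReal, mul_assoc, ← Real.exp_add]
    congr 3
    have : x ⬝ᵥ Function.update 0 a (x a) = x a * x a := dotProduct_single x (x a) a
    simp [Matrix.single_mulVec, this]
    ring

end Basic

end IsGaussianShift

namespace IsGaussianShift

/-! ### Moments of the sufficient statistic -/

section Moments

variable {ι Z : Type*} [Fintype ι] [MeasurableSpace Z]
  {P : (ι → ℝ) → Measure Z} {T : Z → ι → ℝ} {Q : Matrix ι ι ℝ}

theorem integrableExpSet_eq_univ (h : IsGaussianShift P T Q) (v : ι → ℝ) :
    integrableExpSet (fun z => v ⬝ᵥ T z) (P 0) = Set.univ := by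
  ext t
  simp only [integrableExpSet, Set.mem_ofPred_eq, Set.mem_univ, iff_true]
  simpa [smul_dotProduct] using h.integrable_exp (t • v)

theorem memLp_dotProduct_base (h : IsGaussianShift P T Q) (v : ι → ℝ) (p : NNReal) :
    MemLp (fun z => v ⬝ᵥ T z) p (P 0) :=
  memLp_of_mem_interior_integrableExpSet (by simp [h.integrableExpSet_eq_univ v]) p

/-- The moment generating function of `v ⬝ T` is `exp (t² vᵀQv / 2)`, and its second derivative at
`0` is the second moment. -/
theorem integral_sq_base (h : IsGaussianShift P T Q) (v : ι → ℝ) :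
    ∫ z, (v ⬝ᵥ T z) ^ 2 ∂P 0 = v ⬝ᵥ Q *ᵥ v := by
  have h1 := iteratedDeriv_mgf_zero (X := fun z => v ⬝ᵥ T z) (μ := P 0)
    (by simp [h.integrableExpSet_eq_univ v]) 2
  have h2 : mgf (fun z => v ⬝ᵥ T z) (P 0) =
      fun t => Real.exp ((v ⬝ᵥ Q *ᵥ v) / 2 * t ^ 2) := by
    funext t
    have := h.integral_exp (t • v)
    simp only [smul_dotProduct, Matrix.mulVec_smul, dotProduct_smul, smul_eq_mul] at this
    rw [mgf, this]
    ring_nf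
  have hd : ∀ c t : ℝ, HasDerivAt (fun t => Real.exp (c * t ^ 2))
      (2 * c * t * Real.exp (c * t ^ 2)) t := fun c t => by
    have := (((hasDerivAt_id t).pow 2).const_mul c).exp
    convert! this using 1
    simp
    ring
  have h3 : ∀ c : ℝ, iteratedDeriv 2 (fun t => Real.exp (c * t ^ 2)) 0 = 2 * c := fun c => by
    rw [iteratedDeriv_succ, iteratedDeriv_one, funext fun t => (hd c t).deriv]
    have := ((hasDerivAt_id (0 : ℝ)).const_mul (2 * c)).mul (hd c 0)
    refine this.deriv.trans ?_
    simp
  rw [h2, h3] at h1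
  simp only [Pi.pow_apply] at h1
  rw [← h1]
  ring

theorem memLp_dotProduct (h : IsGaussianShift P T Q) (x v : ι → ℝ) :
    MemLp (fun z => v ⬝ᵥ (T z - Q *ᵥ x)) 2 (P x) := by
  simpa using (h.rebase x).memLp_dotProduct_base v 2

theorem integral_sq (h : IsGaussianShift P T Q) (x v : ι → ℝ) :
    ∫ z, (v ⬝ᵥ (T z - Q *ᵥ x)) ^ 2 ∂P x = v ⬝ᵥ Q *ᵥ v := by
  simpa using (h.rebase x).integral_sq_base v

/-- The integrand is one of the summands `exp (s ⬝ T)` over all sign patterns `s ∈ {R, -R}^ι`,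
namely the one that matches the signs of `T z`, and each summand is integrable. -/
theorem integrable_exp_abs (h : IsGaussianShift P T Q) (R : ℝ) :
    Integrable (fun z => Real.exp (R * ∑ a, |T z a|)) (P 0) := by
  classical
  have hsum : Integrable (fun z => ∑ s : ι → Bool,
      Real.exp ((fun a => if s a then R else -R) ⬝ᵥ T z)) (P 0) :=
    integrable_finsetSum _ fun s _ => h.integrable_exp _
  refine hsum.mono' ?_ (Filter.Eventually.of_forall fun z => ?_)
  · have := h.meas
    exact Measurable.aestronglyMeasurable (by fun_prop)
  · rw [Real.norm_of_nonneg (Real.exp_pos _).le]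
    refine le_trans (le_of_eq ?_) (Finset.single_le_sum (fun s _ => (Real.exp_pos _).le)
      (Finset.mem_univ fun a => decide (0 ≤ T z a)))
    congr 1
    rw [dotProduct, Finset.mul_sum]
    refine Finset.sum_congr rfl fun a _ => ?_
    by_cases ha : 0 ≤ T z a
    · simp [ha, abs_of_nonneg]
    · simp [ha, abs_of_neg (not_le.mp ha)]

theorem differentiable_quadratic (Q : Matrix ι ι ℝ) :
    Differentiable ℝ fun x : ι → ℝ => x ⬝ᵥ Q *ᵥ x := by
  simp only [dotProduct, Matrix.mulVec]
  fun_prop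

/-- Dominated differentiation on the unit ball around `x`. There `R = ‖x‖ + 1` controls the
exponent, and the factor `∑ |T a|` produced by the derivative is absorbed by raising `R` to `R + 1`.
-/
theorem hasFDerivAt_integral_exp (h : IsGaussianShift P T Q) (x : ι → ℝ) {g : Z → ℝ}
    (hg : Measurable g) (hgb : ∃ C : ℝ, ∀ z, |g z| ≤ C) :
    HasFDerivAt (fun x' : ι → ℝ => ∫ z, Real.exp (x' ⬝ᵥ T z) * g z ∂P 0)
      (∫ z, (Real.exp (x ⬝ᵥ T z) * g z) •
        (∑ a, T z a • (ContinuousLinearMap.proj a : (ι → ℝ) →L[ℝ] ℝ)) ∂P 0) x ∧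
    Integrable (fun z => (Real.exp (x ⬝ᵥ T z) * g z) •
        (∑ a, T z a • (ContinuousLinearMap.proj a : (ι → ℝ) →L[ℝ] ℝ))) (P 0) := by
  obtain ⟨C, hC⟩ := hgb
  have hT := h.meas
  obtain ⟨R, hR⟩ : ∃ R : ℝ, R = ‖x‖ + 1 := ⟨_, rfl⟩
  have hL : ∀ z, ‖∑ a, T z a • (ContinuousLinearMap.proj a : (ι → ℝ) →L[ℝ] ℝ)‖ ≤
      ∑ a, |T z a| := fun z => by
    refine (norm_sum_le _ _).trans (Finset.sum_le_sum fun a _ => ?_)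
    rw [norm_smul, Real.norm_eq_abs]
    refine mul_le_of_le_one_right (abs_nonneg _)
      (ContinuousLinearMap.opNorm_le_bound _ zero_le_one fun y => ?_)
    simpa using norm_le_pi_norm y a
  have hexp : ∀ x' ∈ Metric.ball x 1, ∀ z, x' ⬝ᵥ T z ≤ R * ∑ a, |T z a| := fun x' hx' z => by
    rw [dotProduct, Finset.mul_sum]
    refine Finset.sum_le_sum fun a _ => (le_abs_self _).trans ?_
    rw [abs_mul]
    refine mul_le_mul_of_nonneg_right ?_ (abs_nonneg _)
    have h1 : ‖x'‖ ≤ ‖x‖ + 1 := by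
      have := norm_le_norm_add_norm_sub' x' x
      rw [Metric.mem_ball, dist_eq_norm] at hx'
      linarith
    exact (norm_le_pi_norm x' a).trans (hR ▸ h1)
  have hbound : ∀ x' ∈ Metric.ball x 1, ∀ z, ‖(Real.exp (x' ⬝ᵥ T z) * g z) •
      (∑ a, T z a • (ContinuousLinearMap.proj a : (ι → ℝ) →L[ℝ] ℝ))‖ ≤
      C * Real.exp ((R + 1) * ∑ a, |T z a|) := fun x' hx' z => by
    have hs : ∑ a, |T z a| ≤ Real.exp (∑ a, |T z a|) :=
      (by linarith : ∑ a, |T z a| ≤ ∑ a, |T z a| + 1).trans (Real.add_one_le_exp _)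
    rw [norm_smul, norm_mul, Real.norm_of_nonneg (Real.exp_pos _).le, Real.norm_eq_abs]
    calc Real.exp (x' ⬝ᵥ T z) * |g z| * ‖_‖
        ≤ Real.exp (R * ∑ a, |T z a|) * C * Real.exp (∑ a, |T z a|) := by
          refine mul_le_mul (mul_le_mul (Real.exp_le_exp.mpr (hexp x' hx' z)) (hC z)
            (abs_nonneg _) (Real.exp_pos _).le) ((hL z).trans hs) (norm_nonneg _) ?_
          exact mul_nonneg (Real.exp_pos _).le ((abs_nonneg _).trans (hC z))
      _ = C * Real.exp ((R + 1) * ∑ a, |T z a|) := by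
          rw [add_mul, one_mul, Real.exp_add]
          ring
  have hmeas : AEStronglyMeasurable (fun z => (Real.exp (x ⬝ᵥ T z) * g z) •
      (∑ a, T z a • (ContinuousLinearMap.proj a : (ι → ℝ) →L[ℝ] ℝ))) (P 0) := by
    refine AEStronglyMeasurable.smul
      ((h.measurable_dotProduct x).exp.mul hg).aestronglyMeasurable ?_
    refine Finset.aestronglyMeasurable_fun_sum _ fun a _ => ?_
    exact (Measurable.aestronglyMeasurable (by fun_prop)).smul_const _
  have hInt := (h.integrable_exp_abs (R + 1)).const_mul C
  refine ⟨hasFDerivAt_integral_of_dominated_of_fderiv_le (Metric.ball_mem_nhds x one_pos)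
    (Filter.Eventually.of_forall fun x' =>
      ((h.measurable_dotProduct x').exp.mul hg).aestronglyMeasurable) ?_ hmeas
    (Filter.Eventually.of_forall fun z x' hx' => hbound x' hx' z) hInt
    (Filter.Eventually.of_forall fun z x' _ => ?_),
    hInt.mono' hmeas (Filter.Eventually.of_forall
      fun z => hbound x (Metric.mem_ball_self one_pos) z)⟩
  · exact (h.integrable_exp x).mul_bdd (c := C) hg.aestronglyMeasurable (Filter.Eventually.of_forall hC)
  · have h1 : HasFDerivAt (fun x' : ι → ℝ => x' ⬝ᵥ T z)
        (∑ a, T z a • (ContinuousLinearMap.proj a : (ι → ℝ) →L[ℝ] ℝ)) x' := by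
      have : (fun x' : ι → ℝ => x' ⬝ᵥ T z) =
          (∑ a, T z a • (ContinuousLinearMap.proj a : (ι → ℝ) →L[ℝ] ℝ)) := by
        funext y
        simp [dotProduct, mul_comm]
      rw [this]
      exact ContinuousLinearMap.hasFDerivAt _
    convert! h1.exp.mul_const (g z) using 1
    rw [smul_smul, mul_comm]

end Moments

/-! ### Score and Fisher information of a Gaussian shift family -/

section Fisher

variable {ι Z : Type*} [Fintype ι] [DecidableEq ι] [MeasurableSpace Z]
  {P : (ι → ℝ) → Measure Z} {T : Z → ι → ℝ} {Q : Matrix ι ι ℝ}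

theorem hasDerivAt_exponent (hQ : Q.IsSymm) (t x : ι → ℝ) (a : ι) :
    HasDerivAt (fun s : ℝ => (x + s • Pi.single a 1) ⬝ᵥ t -
      ((x + s • Pi.single a 1) ⬝ᵥ Q *ᵥ (x + s • Pi.single a 1)) / 2) (t a - (Q *ᵥ x) a) 0 := by
  have hs : x ⬝ᵥ Q *ᵥ Pi.single a 1 = (Q *ᵥ x) a := by
    rw [Matrix.dotProduct_mulVec, ← Matrix.mulVec_transpose, hQ]
    simp
  have : (fun s : ℝ => (x + s • Pi.single a 1) ⬝ᵥ t -
      ((x + s • Pi.single a 1) ⬝ᵥ Q *ᵥ (x + s • Pi.single a 1)) / 2) = fun s =>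
      (x ⬝ᵥ t - (x ⬝ᵥ Q *ᵥ x) / 2) + (t a - (Q *ᵥ x) a) * s - Q a a / 2 * s ^ 2 := by
    funext s
    simp only [Matrix.mulVec_add, Matrix.mulVec_smul, add_dotProduct, dotProduct_add,
      smul_dotProduct, dotProduct_smul, hs, smul_eq_mul]
    simp
    ring
  rw [this]
  have h1 := (((hasDerivAt_id (0 : ℝ)).const_mul (t a - (Q *ᵥ x) a)).const_add
    (x ⬝ᵥ t - (x ⬝ᵥ Q *ᵥ x) / 2)).sub (((hasDerivAt_id (0 : ℝ)).pow 2).const_mul (Q a a / 2))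
  convert! h1 using 1
  simp

theorem isScore (h : IsGaussianShift P T Q) (x : ι → ℝ) :
    IsScore P x fun z => T z - Q *ᵥ x := by
  have := h.prob 0
  refine ⟨P 0, fun x' z => Real.exp (x' ⬝ᵥ T z - (x' ⬝ᵥ Q *ᵥ x') / 2), inferInstance,
    fun x' => ((h.measurable_dotProduct x').sub_const _).exp, fun _ _ => (Real.exp_pos _).le,
    h.density, Filter.Eventually.of_forall fun z => ?_⟩
  have hd : Differentiable ℝ fun x' : ι → ℝ => x' ⬝ᵥ T z - (x' ⬝ᵥ Q *ᵥ x') / 2 := by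
    simp only [dotProduct, Matrix.mulVec]
    fun_prop
  refine ⟨(hd x).exp, fun a => ?_⟩
  simp only [Real.log_exp]
  exact (pderiv_eq_of_hasDerivAt (hd x) (hasDerivAt_exponent h.symm (T z) x a)).symm

theorem diffUnderIntegral (h : IsGaussianShift P T Q) (x : ι → ℝ) :
    DiffUnderIntegral P x fun z => T z - Q *ᵥ x := by
  intro g hg hgb
  obtain ⟨hG, hGint⟩ := h.hasFDerivAt_integral_exp x hg hgb
  -- Splitting off the normalizing factor leaves a Laplace transform, whose derivative is known; the
  -- product rule then produces `T z - Q x`.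
  have heq : (fun x' => ∫ z, g z ∂P x') = fun x' =>
      Real.exp (-((x' ⬝ᵥ Q *ᵥ x') / 2)) * ∫ z, Real.exp (x' ⬝ᵥ T z) * g z ∂P 0 := by
    funext x'
    rw [h.integral_eq, ← integral_const_mul]
    congr 1
    funext z
    rw [sub_eq_add_neg, Real.exp_add]
    ring
  have hq : DifferentiableAt ℝ (fun x' : ι → ℝ => Real.exp (-((x' ⬝ᵥ Q *ᵥ x') / 2))) x :=
    (((differentiable_quadratic Q x).mul_const (2⁻¹ : ℝ)).fun_neg).exp
  have hdiff : DifferentiableAt ℝ (fun x' => ∫ z, g z ∂P x') x := by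
    rw [heq]
    exact hq.mul hG.differentiableAt
  refine ⟨hdiff, fun a => pderiv_eq_of_hasDerivAt hdiff ?_⟩
  have hline : HasDerivAt (fun s : ℝ => x + s • (Pi.single a 1 : ι → ℝ)) (Pi.single a 1) 0 := by
    simpa using ((hasDerivAt_id (0 : ℝ)).smul_const (Pi.single a 1 : ι → ℝ)).const_add x
  have h1 : HasDerivAt (fun s : ℝ => Real.exp (-(((x + s • Pi.single a 1) ⬝ᵥ
      Q *ᵥ (x + s • Pi.single a 1)) / 2)))
      (Real.exp (-((x ⬝ᵥ Q *ᵥ x) / 2)) * (-(Q *ᵥ x) a)) 0 := by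
    have := (hasDerivAt_exponent h.symm 0 x a).exp
    simpa using this
  have hx0 : x = x + (0 : ℝ) • (Pi.single a 1 : ι → ℝ) := by simp
  rw [hx0] at hG
  have h2 := HasFDerivAt.comp_hasDerivAt (0 : ℝ) hG hline
  simp only [Function.comp_def] at h2
  rw [← hx0, ContinuousLinearMap.integral_apply hGint] at h2
  rw [funext_iff] at heq
  simp only [heq]
  have h3 := h1.mul h2
  refine HasDerivAt.congr_deriv h3 ?_
  simp only [zero_smul, add_zero]
  rw [h.integral_eq x, mul_assoc, ← integral_const_mul, ← integral_const_mul, ← integral_const_mul,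
    ← integral_add]
  · congr 1
    funext z
    rw [sub_eq_add_neg (x ⬝ᵥ T z), Real.exp_add]
    simp [Pi.single_apply]
    ring
  · obtain ⟨C, hC⟩ := hgb
    exact (((h.integrable_exp x).mul_bdd (c := C) hg.aestronglyMeasurable
      (Filter.Eventually.of_forall hC)).const_mul _).const_mul _
  · exact (hGint.apply_continuousLinearMap _).const_mul _

theorem memLp_score (h : IsGaussianShift P T Q) (x : ι → ℝ) (a : ι) :
    MemLp (fun z => (T z - Q *ᵥ x) a) 2 (P x) := by
  simpa using h.memLp_dotProduct x (Pi.single a 1)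

theorem hasFisherInfo (h : IsGaussianShift P T Q) (x : ι → ℝ) : HasFisherInfo P x Q := by
  refine ⟨_, h.isScore x, h.diffUnderIntegral x, h.memLp_score x, fun a b => ?_⟩
  -- Polarization: only the quadratic form of the score covariance is known so far.
  have key := h.integral_sq x (Pi.single a 1 + Pi.single b 1)
  have ha := h.integral_sq x (Pi.single a 1)
  have hb := h.integral_sq x (Pi.single b 1)
  have hs := h.symm.apply a b
  have ma := h.memLp_score x a
  have mb := h.memLp_score x b
  simp only [add_dotProduct, single_one_dotProduct, Matrix.mulVec_add, dotProduct_add,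
    Matrix.mulVec_single_one, Matrix.col_apply] at key ha hb
  have hexp : ∀ z, ((T z - Q *ᵥ x) a + (T z - Q *ᵥ x) b) ^ 2 = (T z - Q *ᵥ x) a ^ 2 +
      2 * ((T z - Q *ᵥ x) a * (T z - Q *ᵥ x) b) + (T z - Q *ᵥ x) b ^ 2 := fun z => by ring
  simp only [hexp] at key
  have mab : Integrable (fun z => 2 * ((T z - Q *ᵥ x) a * (T z - Q *ᵥ x) b)) (P x) :=
    (ma.integrable_mul mb).const_mul 2
  rw [integral_add (by exact ma.integrable_sq.add mab) mb.integrable_sq,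
    integral_add ma.integrable_sq mab, integral_const_mul,
    ha, hb] at key
  linarith

end Fisher

end IsGaussianShift

section GaussianLaws

open scoped MatrixOrder

/-! ### Gaussian laws on `ℝ^m` -/

section Gaussian

variable {m r : ℕ}

instance isProbabilityMeasure_gaussianLaw (μ : Fin m → ℝ) (V : Matrix (Fin m) (Fin m) ℝ) :
    IsProbabilityMeasure (gaussianLaw μ V) :=
  Measure.isProbabilityMeasure_map (by fun_prop)

theorem gaussianLaw_eq_map_pi (μ : Fin m → ℝ) (V : Matrix (Fin m) (Fin m) ℝ) :
    gaussianLaw μ V = (Measure.pi fun _ : Fin m => gaussianReal 0 1).map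
      fun z => μ + CFC.sqrt V *ᵥ z := by
  rw [gaussianLaw, multivariateGaussian, ← map_pi_eq_stdGaussian,
    Measure.map_map (by fun_prop) (by fun_prop), Measure.map_map (by fun_prop) (by fun_prop)]
  rfl

theorem gaussianLaw_zero_one :
    gaussianLaw (0 : Fin m → ℝ) 1 = Measure.pi fun _ : Fin m => gaussianReal 0 1 := by
  rw [gaussianLaw_eq_map_pi]
  simp [Measure.map_id']

theorem pi_gaussianReal_shift :
    IsGaussianShift (fun x : Fin m → ℝ => Measure.pi fun a => gaussianReal (x a) 1)
      (fun z => z) 1 := by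
  have := IsGaussianShift.pi fun a : Fin m => IsGaussianShift.gaussianReal_coord a
  convert! this using 1
  · funext z
    exact (Finset.univ_sum_single z).symm
  · ext a b
    rw [Matrix.sum_apply, Finset.sum_eq_single a (fun j _ hj => by simp [hj])
      (by simp)]
    simp [Matrix.one_apply, Matrix.single_apply]

/-- The location family of a nondegenerate Gaussian law. -/
theorem gaussianLaw_shift (c : Fin m → ℝ) {V : Matrix (Fin m) (Fin m) ℝ} (hV : V.PosDef) :
    IsGaussianShift (fun x => gaussianLaw (c + x) V) (fun z => V⁻¹ *ᵥ (z - c)) V⁻¹ := by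
  set R := CFC.sqrt V with hR
  have hRR : R * R = V := CFC.sqrt_mul_sqrt_self V hV.posSemidef.nonneg
  have hRs : Rᵀ = R := by
    have : R.PosSemidef := Matrix.nonneg_iff_posSemidef.mp (CFC.sqrt_nonneg V)
    simpa using this.isHermitian.eq
  have hdet : IsUnit R.det := by
    have : IsUnit (R * R).det := hRR ▸ (Matrix.isUnit_iff_isUnit_det _).mp hV.isUnit
    rw [Matrix.det_mul] at this
    exact isUnit_of_mul_isUnit_left this
  have hinv : V⁻¹ = R⁻¹ * R⁻¹ := by rw [← hRR, Matrix.mul_inv_rev]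
  have hRi : (R⁻¹)ᵀ = R⁻¹ := by rw [Matrix.transpose_nonsing_inv, hRs]
  -- Translating `c + R z` by `x` is translating the standard Gaussian `z` by `R⁻¹ x`, with `R` the
  -- symmetric square root of `V`.
  have h1 := (pi_gaussianReal_shift (m := m)).comp_mulVec R⁻¹
  rw [hRi, Matrix.mul_one, ← hinv] at h1
  have h2 := h1.map (e := fun z => c + R *ᵥ z) (by fun_prop)
    (T' := fun z => V⁻¹ *ᵥ (z - c)) (by fun_prop) (fun z => by
      rw [add_sub_cancel_left, hinv, Matrix.mulVec_mulVec, Matrix.mul_assoc,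
        Matrix.nonsing_inv_mul _ hdet, Matrix.mul_one])
  convert! h2 using 1
  funext x
  have h3 : (Measure.pi fun a => gaussianReal ((R⁻¹ *ᵥ x) a) 1) =
      (Measure.pi fun _ : Fin m => gaussianReal 0 1).map fun z => R⁻¹ *ᵥ x + z := by
    have hz : (fun z : Fin m → ℝ => R⁻¹ *ᵥ x + z) = fun z a => (R⁻¹ *ᵥ x) a + z a := rfl
    have hm : ∀ a, (gaussianReal 0 1).map (fun z => (R⁻¹ *ᵥ x) a + z) =
        gaussianReal ((R⁻¹ *ᵥ x) a) 1 := fun a => by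
      rw [gaussianReal_map_const_add, zero_add]
    have : ∀ a, SigmaFinite ((gaussianReal 0 1).map (fun z => (R⁻¹ *ᵥ x) a + z)) := fun a => by
      rw [hm]
      infer_instance
    rw [hz, Measure.pi_map_pi fun a => by fun_prop]
    simp only [hm]
  rw [h3, gaussianLaw_eq_map_pi, Measure.map_map (by fun_prop) (by fun_prop)]
  congr 1
  funext z
  simp only [Function.comp_apply, Matrix.mulVec_add, Matrix.mulVec_mulVec,
    Matrix.mul_nonsing_inv _ hdet, Matrix.one_mulVec, ← hR]
  abel

theorem integral_cexp_gaussianLaw (μ : Fin m → ℝ) {V : Matrix (Fin m) (Fin m) ℝ}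
    (hV : V.PosSemidef) (t : Fin m → ℝ) :
    ∫ z, Complex.exp (↑(t ⬝ᵥ z) * Complex.I) ∂gaussianLaw μ V =
      Complex.exp (↑(t ⬝ᵥ μ) * Complex.I - ↑(t ⬝ᵥ V *ᵥ t) / 2) := by
  have h := charFun_multivariateGaussian (μ := WithLp.toLp 2 μ) hV (WithLp.toLp 2 t)
  rw [charFun_apply] at h
  rw [gaussianLaw, integral_map (by fun_prop) (by fun_prop)]
  simpa [EuclideanSpace.inner_eq_star_dotProduct, dotProduct_comm] using h

/-- Uniqueness of characteristic functions, carried over from `EuclideanSpace` to the plain function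
space. -/
theorem ext_of_integral_cexp {ρ ρ' : Measure (Fin m → ℝ)} [IsFiniteMeasure ρ] [IsFiniteMeasure ρ']
    (h : ∀ t : Fin m → ℝ, ∫ z, Complex.exp (↑(t ⬝ᵥ z) * Complex.I) ∂ρ =
      ∫ z, Complex.exp (↑(t ⬝ᵥ z) * Complex.I) ∂ρ') : ρ = ρ' := by
  have hmap : ρ.map (WithLp.toLp 2) = ρ'.map (WithLp.toLp 2) := by
    refine Measure.ext_of_charFun (funext fun t => ?_)
    rw [charFun_apply, charFun_apply, integral_map (by fun_prop) (by fun_prop),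
      integral_map (by fun_prop) (by fun_prop)]
    simpa [EuclideanSpace.inner_eq_star_dotProduct, dotProduct_comm] using h t.ofLp
  have := congrArg (Measure.map (fun x : EuclideanSpace ℝ (Fin m) => WithLp.ofLp x)) hmap
  rw [Measure.map_map (by fun_prop) (by fun_prop), Measure.map_map (by fun_prop) (by fun_prop)]
    at this
  simpa [Function.comp_def] using this

theorem continuous_cexp_dotProduct (t : Fin m → ℝ) :
    Continuous fun z : Fin m → ℝ => Complex.exp (↑(t ⬝ᵥ z) * Complex.I) := by
  simp only [dotProduct]
  fun_prop

/-- Characteristic functions are used rather than densities, so that singular covariances are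
allowed. -/
theorem gaussianLaw_map_affine (μ : Fin m → ℝ) {V : Matrix (Fin m) (Fin m) ℝ}
    (hV : V.PosSemidef) (C : Matrix (Fin r) (Fin m) ℝ) (b : Fin r → ℝ) :
    (gaussianLaw μ V).map (fun w => C *ᵥ w + b) = gaussianLaw (C *ᵥ μ + b) (C * V * Cᵀ) := by
  have : IsProbabilityMeasure ((gaussianLaw μ V).map (fun w => C *ᵥ w + b)) :=
    Measure.isProbabilityMeasure_map (by fun_prop)
  refine ext_of_integral_cexp fun t => ?_
  rw [integral_cexp_gaussianLaw _ (by simpa using hV.mul_mul_conjTranspose_same C),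
    integral_map (by fun_prop) (continuous_cexp_dotProduct t).aestronglyMeasurable]
  have h := integral_cexp_gaussianLaw μ hV (Cᵀ *ᵥ t)
  have hd : ∀ w, (Cᵀ *ᵥ t) ⬝ᵥ w = t ⬝ᵥ C *ᵥ w := fun w => by
    rw [Matrix.mulVec_transpose, Matrix.dotProduct_mulVec]
  simp only [hd] at h
  simp only [dotProduct_add, Complex.ofReal_add, add_mul, Complex.exp_add, integral_mul_const, h]
  rw [← Complex.exp_add, ← Matrix.mulVec_mulVec, ← Matrix.mulVec_mulVec]
  ring_nf

theorem gaussianLaw_add (μ ν : Fin m → ℝ) {V U : Matrix (Fin m) (Fin m) ℝ}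
    (hV : V.PosSemidef) (hU : U.PosSemidef) :
    ((gaussianLaw μ V).prod (gaussianLaw ν U)).map (fun x => x.1 + x.2) =
      gaussianLaw (μ + ν) (V + U) := by
  have : IsProbabilityMeasure
      (((gaussianLaw μ V).prod (gaussianLaw ν U)).map (fun x => x.1 + x.2)) :=
    Measure.isProbabilityMeasure_map (by fun_prop)
  refine ext_of_integral_cexp fun t => ?_
  rw [integral_cexp_gaussianLaw _ (hV.add hU),
    integral_map (by fun_prop) (continuous_cexp_dotProduct t).aestronglyMeasurable]
  simp only [dotProduct_add, Complex.ofReal_add, add_mul, Complex.exp_add]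
  rw [integral_prod_mul (fun z : Fin m → ℝ => Complex.exp (↑(t ⬝ᵥ z) * Complex.I))
    (fun z : Fin m → ℝ => Complex.exp (↑(t ⬝ᵥ z) * Complex.I)),
    integral_cexp_gaussianLaw _ hV, integral_cexp_gaussianLaw _ hU, ← Complex.exp_add,
    Matrix.add_mulVec, dotProduct_add]
  push_cast
  ring_nf

/-- The density of the standard Gaussian law on `ℝ^q`. -/
def stdDensity (q : ℕ) (d : Fin q → ℝ) : ℝ := ∏ a, gaussianPDFReal 0 1 (d a)

theorem densityLaw_stdDensity (q : ℕ) : densityLaw (stdDensity q) = gaussianLaw 0 1 := by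
  rw [gaussianLaw_zero_one, densityLaw]
  have := pi_withDensity_ofReal (fun _ : Fin q => (volume : Measure ℝ))
    (fun _ => gaussianPDFReal 0 1) (fun _ => gaussianPDFReal_nonneg 0 1)
    (fun _ => integrable_gaussianPDFReal 0 1)
  rw [gaussianReal_of_var_ne_zero _ one_ne_zero]
  exact this.symm

theorem ContDiff.piecewiseC1 {E F : Type*} [NormedAddCommGroup E] [NormedSpace ℝ E]
    [MeasureSpace E] [NormedAddCommGroup F] [NormedSpace ℝ F] {f : E → F} (hf : ContDiff ℝ 1 f) :
    PiecewiseC1 f := by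
  refine ⟨fun j => if j = 0 then Set.univ else ∅, fun x => ⟨Set.univ, Filter.univ_mem, ?_⟩, ?_,
    fun j => ?_⟩
  · refine (Set.finite_singleton 0).subset fun j hj => ?_
    by_contra hne
    simp only [Set.mem_singleton_iff] at hne
    simp [hne] at hj
  · exact Set.eq_univ_of_forall fun x => Set.mem_iUnion.mpr ⟨0, by simp⟩
  · refine ⟨by dsimp only; split_ifs <;> simp, by dsimp only; split_ifs <;> simp, Set.univ, f, isOpen_univ,
      Set.subset_univ _, hf.contDiffOn, fun x _ => rfl⟩

theorem isPC1Density_stdDensity (q : ℕ) : IsPC1Density (stdDensity q) := by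
  refine ⟨fun d => Finset.prod_nonneg fun a _ => gaussianPDFReal_nonneg _ _ _,
    ContDiff.piecewiseC1 ?_, ?_⟩
  · unfold stdDensity gaussianPDFReal
    fun_prop
  · have h : densityLaw (stdDensity q) Set.univ = 1 := by
      rw [densityLaw_stdDensity]
      exact measure_univ
    rwa [densityLaw, withDensity_apply _ .univ, Measure.restrict_univ] at h

end Gaussian

/-- A positive semidefinite matrix is `Cᵀ C` for a matrix `C` with linearly independent rows. -/
theorem exists_transpose_mul_self_eq {m : ℕ} {S : Matrix (Fin m) (Fin m) ℝ} (hS : S.PosSemidef) :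
    ∃ (r : ℕ) (C : Matrix (Fin r) (Fin m) ℝ), Cᵀ * C = S ∧ (C * Cᵀ).PosDef := by
  classical
  let lam := hS.isHermitian.eigenvalues
  let U : Matrix (Fin m) (Fin m) ℝ := hS.isHermitian.eigenvectorUnitary
  have hU1 : Uᵀ * U = 1 := by
    have := Unitary.coe_star_mul_self hS.isHermitian.eigenvectorUnitary
    simpa [Matrix.star_eq_conjTranspose] using this
  have hspec : S = U * Matrix.diagonal lam * Uᵀ := by
    have := hS.isHermitian.spectral_theorem
    simpa [Unitary.conjStarAlgAut_apply, Matrix.star_eq_conjTranspose, Function.comp_def] using this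
  let e := Fintype.equivFin {i // 0 < lam i}
  -- The rows are the eigenvectors scaled by `√λ`, with the kernel of `S` left out; this makes `C
  -- Cᵀ` diagonal with positive entries.
  let C : Matrix (Fin (Fintype.card {i // 0 < lam i})) (Fin m) ℝ :=
    Matrix.of fun j a => Real.sqrt (lam (e.symm j)) * U a (e.symm j)
  have hl0 : ∀ i, 0 ≤ lam i := hS.eigenvalues_nonneg
  refine ⟨_, C, ?_, ?_⟩
  · ext a b
    rw [hspec]
    have hr : (U * Matrix.diagonal lam * Uᵀ) a b = ∑ i, U a i * lam i * U b i := by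
      rw [Matrix.mul_apply]
      simp only [Matrix.mul_diagonal, Matrix.transpose_apply]
    rw [hr, Matrix.mul_apply]
    simp only [Matrix.transpose_apply, C, Matrix.of_apply]
    rw [← e.sum_comp (fun j => Real.sqrt (lam (e.symm j)) * U a (e.symm j) *
      (Real.sqrt (lam (e.symm j)) * U b (e.symm j)))]
    simp only [Equiv.symm_apply_apply]
    rw [← Finset.sum_filter_of_ne (p := fun i => 0 < lam i) (fun i _ hi => (hl0 i).lt_of_ne' (by
      contrapose! hi
      simp [hi])),
      Finset.sum_subtype (p := fun i => 0 < lam i) _ (by simp)]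
    refine Finset.sum_congr rfl fun i _ => ?_
    have := Real.mul_self_sqrt (hl0 i)
    calc Real.sqrt (lam i) * U a i * (Real.sqrt (lam i) * U b i)
        = U a i * (Real.sqrt (lam i) * Real.sqrt (lam i)) * U b i := by ring
      _ = U a i * lam i * U b i := by rw [this]
  · have : C * Cᵀ = Matrix.diagonal fun j => lam (e.symm j) := by
      ext j k
      have h1 := congrFun (congrFun hU1 (e.symm j)) (e.symm k)
      simp only [Matrix.mul_apply, Matrix.transpose_apply] at h1
      simp only [Matrix.mul_apply, Matrix.transpose_apply, C, Matrix.of_apply]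
      have h2 : ∀ a, Real.sqrt (lam (e.symm j)) * U a (e.symm j) *
          (Real.sqrt (lam (e.symm k)) * U a (e.symm k)) = Real.sqrt (lam (e.symm j)) *
          Real.sqrt (lam (e.symm k)) * (U a (e.symm j) * U a (e.symm k)) := fun a => by ring
      simp only [h2, ← Finset.mul_sum, h1]
      by_cases hjk : j = k
      · subst hjk
        simp [Real.mul_self_sqrt (hl0 _)]
      · have : (e.symm j : Fin m) ≠ e.symm k := fun h => hjk (e.symm.injective (Subtype.ext h))
        simp [hjk, this]
    rw [this]
    exact Matrix.PosDef.diagonal fun j => (e.symm j).2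

end GaussianLaws

/-! ### Fisher information bounds for the derivatives of expectations -/

theorem sq_integral_mul_le {Ω : Type*} [MeasurableSpace Ω] {μ : Measure Ω} {f g : Ω → ℝ}
    (hf : MemLp f 2 μ) (hg : MemLp g 2 μ) :
    (∫ ω, f ω * g ω ∂μ) ^ 2 ≤ (∫ ω, f ω ^ 2 ∂μ) * ∫ ω, g ω ^ 2 ∂μ := by
  have hfg : Integrable (fun ω => f ω * g ω) μ := hf.integrable_mul hg
  have key : ∀ t : ℝ, 0 ≤ (∫ ω, g ω ^ 2 ∂μ) * (t * t) + 2 * (∫ ω, f ω * g ω ∂μ) * t +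
      ∫ ω, f ω ^ 2 ∂μ := fun t => by
    have h0 : 0 ≤ ∫ ω, (f ω + t * g ω) ^ 2 ∂μ := integral_nonneg fun ω => sq_nonneg _
    have h1 : ∀ ω, (f ω + t * g ω) ^ 2 =
        f ω ^ 2 + 2 * t * (f ω * g ω) + t ^ 2 * g ω ^ 2 := fun ω => by ring
    simp only [h1] at h0
    have hi : Integrable (fun ω => f ω ^ 2 + 2 * t * (f ω * g ω)) μ :=
      hf.integrable_sq.add (hfg.const_mul _)
    rw [integral_add hi (hg.integrable_sq.const_mul _),
      integral_add hf.integrable_sq (hfg.const_mul _), integral_const_mul, integral_const_mul] at h0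
    linarith
  have := discrim_le_zero key
  rw [discrim] at this
  linarith

/-- Cauchy–Schwarz in `ℝ²` for `(√p, √q)` and `(√v, √w)`. It joins the privacy bound with the
Gaussian bound. -/
theorem add_sq_le_of_sq_le {A B p q v w : ℝ} (hp : 0 ≤ p) (hq : 0 ≤ q) (hv : 0 ≤ v) (hw : 0 ≤ w)
    (hA : A ^ 2 ≤ p * v) (hB : B ^ 2 ≤ q * w) : (A + B) ^ 2 ≤ (p + q) * (v + w) := by
  have h1 : (2 * (A * B)) ^ 2 ≤ (p * w + q * v) ^ 2 := by
    have h2 : A ^ 2 * B ^ 2 ≤ p * v * (q * w) :=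
      mul_le_mul hA hB (sq_nonneg B) (mul_nonneg hp hv)
    nlinarith [sq_nonneg (p * w - q * v)]
  have h3 := abs_le_of_sq_le_sq h1 (by positivity)
  nlinarith [le_of_abs_le h3]

section Bound

variable {ι Z : Type*} [Fintype ι] [MeasurableSpace Z]

theorem quadratic_eq_integral_sq {μ : Measure Z} {J : Matrix ι ι ℝ}
    {ℓ : Z → ι → ℝ} (hL : ∀ a, MemLp (fun z => ℓ z a) 2 μ)
    (hJ : ∀ a b, J a b = ∫ z, ℓ z a * ℓ z b ∂μ) (v : ι → ℝ) :
    v ⬝ᵥ J *ᵥ v = ∫ z, (v ⬝ᵥ ℓ z) ^ 2 ∂μ := by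
  have hi : ∀ a b, Integrable (fun z => ℓ z a * ℓ z b) μ := fun a b =>
    (hL a).integrable_mul (hL b)
  have h1 : ∀ z, (v ⬝ᵥ ℓ z) ^ 2 = ∑ a, ∑ b, v a * v b * (ℓ z a * ℓ z b) := fun z => by
    rw [sq, dotProduct, Finset.sum_mul_sum]
    exact Finset.sum_congr rfl fun a _ => Finset.sum_congr rfl fun b _ => by ring
  simp only [h1]
  rw [integral_finsetSum _ fun a _ => integrable_finsetSum _ fun b _ => (hi a b).const_mul _]
  simp only [dotProduct, Matrix.mulVec, Finset.mul_sum]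
  refine Finset.sum_congr rfl fun a _ => ?_
  rw [integral_finsetSum _ fun b _ => (hi a b).const_mul _]
  refine Finset.sum_congr rfl fun b _ => ?_
  rw [integral_const_mul, hJ]
  ring

theorem memLp_dotProduct_score {μ : Measure Z} {ℓ : Z → ι → ℝ}
    (hL : ∀ a, MemLp (fun z => ℓ z a) 2 μ) (v : ι → ℝ) :
    MemLp (fun z => v ⬝ᵥ ℓ z) 2 μ := by
  simp only [dotProduct]
  exact memLp_finsetSum _ fun a _ => (hL a).const_mul _

variable [DecidableEq ι]

theorem DiffUnderIntegral.fderiv_apply {P : (ι → ℝ) → Measure Z} {x : ι → ℝ}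
    [IsFiniteMeasure (P x)] {ℓ : Z → ι → ℝ} (hD : DiffUnderIntegral P x ℓ)
    (hL : ∀ a, MemLp (fun z => ℓ z a) 2 (P x)) {h : Z → ℝ} (hm : Measurable h) {C : ℝ}
    (hC : ∀ z, |h z| ≤ C) (v : ι → ℝ) :
    fderiv ℝ (fun x' => ∫ z, h z ∂P x') x v = ∫ z, h z * (v ⬝ᵥ ℓ z) ∂P x := by
  have hh : MemLp h 2 (P x) := MemLp.of_bound hm.aestronglyMeasurable C
    (Filter.Eventually.of_forall hC)
  rw [fderiv_eq_sum_pderiv]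
  simp only [dotProduct, Finset.mul_sum]
  rw [integral_finsetSum]
  · refine Finset.sum_congr rfl fun a _ => ?_
    rw [(hD h hm ⟨C, hC⟩).2 a, ← integral_const_mul]
    congr 1
    funext z
    ring
  · intro a _
    exact hh.integrable_mul ((hL a).const_mul (v a))

/-- Differentiate the total mass, that is, take the statistic `h = 1`. -/
theorem DiffUnderIntegral.integral_score_eq_zero {P : (ι → ℝ) → Measure Z}
    [∀ x, IsProbabilityMeasure (P x)] {x : ι → ℝ} {ℓ : Z → ι → ℝ} (hD : DiffUnderIntegral P x ℓ)
    (hL : ∀ a, MemLp (fun z => ℓ z a) 2 (P x)) (v : ι → ℝ) : ∫ z, v ⬝ᵥ ℓ z ∂P x = 0 := by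
  have := hD.fderiv_apply hL (h := fun _ => 1) measurable_const (C := 1) (by simp) v
  simpa using this.symm

/-- The derivative of the expectation of `h` is bounded by the Fisher information and the
variance of `h`. -/
theorem HasFisherInfo.sq_fderiv_le {P : (ι → ℝ) → Measure Z} [∀ x, IsProbabilityMeasure (P x)]
    {x : ι → ℝ} {S J : Matrix ι ι ℝ} (hJ : HasFisherInfo P x J) (hS : (S - J).PosSemidef)
    {h : Z → ℝ} (hm : Measurable h) {C : ℝ} (hC : ∀ z, |h z| ≤ C) (v : ι → ℝ) :
    0 ≤ v ⬝ᵥ S *ᵥ v ∧ DifferentiableAt ℝ (fun x' => ∫ z, h z ∂P x') x ∧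
    (fderiv ℝ (fun x' => ∫ z, h z ∂P x') x v) ^ 2 ≤
      (v ⬝ᵥ S *ᵥ v) * ((∫ z, h z ^ 2 ∂P x) - (∫ z, h z ∂P x) ^ 2) := by
  obtain ⟨ℓ, -, hD, hL, hJe⟩ := hJ
  have hq := quadratic_eq_integral_sq hL hJe v
  have hle : v ⬝ᵥ J *ᵥ v ≤ v ⬝ᵥ S *ᵥ v := by
    have := hS.dotProduct_mulVec_nonneg v
    simp only [star_trivial, Matrix.sub_mulVec, dotProduct_sub] at this
    linarith
  have hJ0 : 0 ≤ v ⬝ᵥ J *ᵥ v := hq ▸ integral_nonneg fun z => sq_nonneg _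
  refine ⟨hJ0.trans hle, (hD h hm ⟨C, hC⟩).1, ?_⟩
  set g := ∫ z, h z ∂P x
  have hh : MemLp h 2 (P x) := MemLp.of_bound hm.aestronglyMeasurable C
    (Filter.Eventually.of_forall hC)
  have hv := memLp_dotProduct_score hL v
  have hmean := hD.integral_score_eq_zero hL v
  have hhg : MemLp (fun z => h z - g) 2 (P x) := hh.sub (memLp_const g)
  -- Since the score is centred, `h` may be centred as well. This yields the variance rather than
  -- the second moment, which is what leaves room for the `g²` term later.
  have hfd : fderiv ℝ (fun x' => ∫ z, h z ∂P x') x v = ∫ z, (h z - g) * (v ⬝ᵥ ℓ z) ∂P x := by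
    rw [hD.fderiv_apply hL hm hC v]
    simp only [sub_mul]
    rw [integral_sub (by exact hh.integrable_mul hv)
      ((hv.integrable one_le_two).const_mul g), integral_const_mul, hmean, mul_zero, sub_zero]
  have hvar : ∫ z, (h z - g) ^ 2 ∂P x = (∫ z, h z ^ 2 ∂P x) - g ^ 2 := by
    have h1 : ∀ z, (h z - g) ^ 2 = h z ^ 2 - 2 * g * h z + g ^ 2 := fun z => by ring
    simp only [h1]
    have hi := hh.integrable one_le_two
    rw [integral_add (by exact hh.integrable_sq.sub (hi.const_mul _)) (integrable_const _),
      integral_sub hh.integrable_sq (hi.const_mul _), integral_const_mul]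
    simp only [integral_const, probReal_univ, one_smul]
    ring
  rw [hfd, ← hvar, mul_comm (v ⬝ᵥ S *ᵥ v)]
  refine (sq_integral_mul_le hhg hv).trans ?_
  rw [← hq]
  exact mul_le_mul_of_nonneg_left hle (integral_nonneg fun z => sq_nonneg _)

/-- A Gaussian input observed through a channel with Fisher information at most `S`: the
correlation of a statistic of the output with the score of the input in the direction
`x₁ + x₂` is controlled by the information `S` in direction `x₁` and `Q` in direction `x₂`. -/
theorem sq_integral_mul_score_le {P : (ι → ℝ) → Measure Z} [∀ x, IsProbabilityMeasure (P x)]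
    {S : Matrix ι ι ℝ} (hP : ∀ y, ∃ J, HasFisherInfo P y J ∧ (S - J).PosSemidef)
    {γ : Measure (ι → ℝ)} [IsProbabilityMeasure γ] {T : (ι → ℝ) → ι → ℝ} {Q : Matrix ι ι ℝ}
    (hγ : IsGaussianShift (fun x => γ.map (fun y => x + y)) T Q)
    {h : Z → ℝ} (hm : Measurable h) {C : ℝ} (hC : ∀ z, |h z| ≤ C)
    (hg2 : Measurable fun y => ∫ z, h z ^ 2 ∂P y) (x₁ x₂ : ι → ℝ) :
    (∫ y, (∫ z, h z ∂P y) * ((x₁ + x₂) ⬝ᵥ T y) ∂γ) ^ 2 ≤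
      (x₁ ⬝ᵥ S *ᵥ x₁ + x₂ ⬝ᵥ Q *ᵥ x₂) * ∫ y, ∫ z, h z ^ 2 ∂P y ∂γ := by
  set g : (ι → ℝ) → ℝ := fun y => ∫ z, h z ∂P y with hg
  have hdiff : Differentiable ℝ g := fun y => by
    obtain ⟨J, hJ, hS⟩ := hP y
    exact (hJ.sq_fderiv_le hS hm hC x₁).2.1
  have hp : 0 ≤ x₁ ⬝ᵥ S *ᵥ x₁ := by
    obtain ⟨J, hJ, hS⟩ := hP 0
    exact (hJ.sq_fderiv_le hS hm hC x₁).1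
  have hder : ∀ y, (fderiv ℝ g y x₁) ^ 2 ≤
      (x₁ ⬝ᵥ S *ᵥ x₁) * ((∫ z, h z ^ 2 ∂P y) - g y ^ 2) := fun y => by
    obtain ⟨J, hJ, hS⟩ := hP y
    exact (hJ.sq_fderiv_le hS hm hC x₁).2.2
  have hC0 : 0 ≤ C := by
    obtain ⟨z⟩ := (P 0).nonempty_of_neZero
    exact (abs_nonneg _).trans (hC z)
  have hgm : Measurable g := hdiff.continuous.measurable
  have hgC : ∀ y, |g y| ≤ C := fun y => by
    have := norm_integral_le_of_norm_le_const (μ := P y) (f := h) (Filter.Eventually.of_forall hC)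
    simpa using this
  have h2C : ∀ y, |∫ z, h z ^ 2 ∂P y| ≤ C ^ 2 := fun y => by
    have := norm_integral_le_of_norm_le_const (μ := P y) (f := fun z => h z ^ 2) (C := C ^ 2)
      (Filter.Eventually.of_forall fun z => by
        rw [norm_pow]
        exact pow_le_pow_left₀ (norm_nonneg _) (hC z) 2)
    simpa using this
  have hγ0 : γ.map (fun y => 0 + y) = γ := by simp [Measure.map_id']
  have hTL : ∀ v, MemLp (fun y => v ⬝ᵥ T y) 2 γ := fun v => by
    simpa [hγ0] using hγ.memLp_dotProduct 0 v
  have hTsq : ∀ v, ∫ y, (v ⬝ᵥ T y) ^ 2 ∂γ = v ⬝ᵥ Q *ᵥ v := fun v => by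
    simpa [hγ0] using hγ.integral_sq 0 v
  have hgL : MemLp g 2 γ := MemLp.of_bound hgm.aestronglyMeasurable C
    (Filter.Eventually.of_forall hgC)
  have hi2 : Integrable (fun y => ∫ z, h z ^ 2 ∂P y) γ :=
    Integrable.of_bound hg2.aestronglyMeasurable (C ^ 2) (Filter.Eventually.of_forall h2C)
  -- The identity of Stein, by differentiating `E g(y + t x₁)` in two ways.
  have hK : ∀ y, ‖fderiv ℝ g y x₁‖ ≤ Real.sqrt ((x₁ ⬝ᵥ S *ᵥ x₁) * C ^ 2) := fun y => by
    refine Real.le_sqrt_of_sq_le ?_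
    rw [Real.norm_eq_abs, sq_abs]
    refine (hder y).trans (mul_le_mul_of_nonneg_left ?_ hp)
    linarith [sq_nonneg (g y), (abs_le.mp (h2C y)).2]
  have hstein : ∫ y, g y * (x₁ ⬝ᵥ T y) ∂γ = ∫ y, fderiv ℝ g y x₁ ∂γ := by
    have hline : ∀ (y : ι → ℝ) (t : ℝ),
        HasDerivAt (fun t : ℝ => y + t • x₁) x₁ t := fun y t => by
      simpa using ((hasDerivAt_id t).smul_const x₁).const_add y
    -- Here the derivative falls on the shifted law `γ`.
    have hA : HasDerivAt (fun t : ℝ => ∫ y, g (y + t • x₁) ∂γ)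
        (∫ y, g y * (x₁ ⬝ᵥ T y) ∂γ) 0 := by
      have hD := hγ.diffUnderIntegral 0
      have : IsProbabilityMeasure (γ.map (fun y => 0 + y)) := hγ.prob 0
      have hd := (hD g hgm ⟨C, hgC⟩).1.hasFDerivAt
      have hf := hD.fderiv_apply (hγ.memLp_score 0) hgm hgC x₁
      simp only [Matrix.mulVec_zero, sub_zero, hγ0] at hf
      have h0 : HasDerivAt (fun t : ℝ => t • x₁) x₁ 0 := by
        simpa using (hasDerivAt_id (0 : ℝ)).smul_const x₁
      rw [show (0 : ι → ℝ) = (0 : ℝ) • x₁ by simp] at hd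
      have hc := HasFDerivAt.comp_hasDerivAt (0 : ℝ) hd h0
      rw [zero_smul, hf] at hc
      refine hc.congr_of_eventuallyEq (Filter.Eventually.of_forall fun t => ?_)
      simp only [Function.comp_apply]
      rw [integral_map (by fun_prop) hgm.aestronglyMeasurable]
      simp only [add_comm]
    -- Here it falls on `g`, dominated by the uniform derivative bound that comes from privacy.
    have hB := (hasDerivAt_integral_of_dominated_loc_of_deriv_le (μ := γ)
      (F := fun (t : ℝ) y => g (y + t • x₁)) (F' := fun t y => fderiv ℝ g (y + t • x₁) x₁)
      (x₀ := (0 : ℝ)) (s := Set.univ)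
      (bound := fun _ => Real.sqrt ((x₁ ⬝ᵥ S *ᵥ x₁) * C ^ 2)) Filter.univ_mem
      (Filter.Eventually.of_forall fun t =>
        (hgm.comp (by fun_prop)).aestronglyMeasurable)
      (by simpa using hgL.integrable one_le_two)
      (by simpa using (measurable_fderiv_apply_const ℝ g x₁).aestronglyMeasurable)
      (Filter.Eventually.of_forall fun y t _ => hK _) (integrable_const _)
      (Filter.Eventually.of_forall fun y t _ =>
        HasFDerivAt.comp_hasDerivAt t (hdiff _).hasFDerivAt (hline y t))).2
    simp only [zero_smul, add_zero] at hB
    exact hA.unique hB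
  have hdL : MemLp (fun y => fderiv ℝ g y x₁) 2 γ :=
    MemLp.of_bound (measurable_fderiv_apply_const ℝ g x₁).aestronglyMeasurable _
      (Filter.Eventually.of_forall hK)
  have hvarI : Integrable (fun y => (∫ z, h z ^ 2 ∂P y) - g y ^ 2) γ := hi2.sub hgL.integrable_sq
  have hA : (∫ y, g y * (x₁ ⬝ᵥ T y) ∂γ) ^ 2 ≤
      (x₁ ⬝ᵥ S *ᵥ x₁) * ∫ y, ((∫ z, h z ^ 2 ∂P y) - g y ^ 2) ∂γ := by
    rw [hstein]
    have h1 := sq_integral_mul_le hdL (memLp_const (μ := γ) (p := 2) (1 : ℝ))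
    simp only [mul_one, one_pow, integral_const, probReal_univ, smul_eq_mul] at h1
    refine h1.trans ?_
    rw [← integral_const_mul]
    exact integral_mono hdL.integrable_sq (hvarI.const_mul _) hder
  have hB : (∫ y, g y * (x₂ ⬝ᵥ T y) ∂γ) ^ 2 ≤ (x₂ ⬝ᵥ Q *ᵥ x₂) * ∫ y, g y ^ 2 ∂γ := by
    rw [mul_comm, ← hTsq]
    exact sq_integral_mul_le hgL (hTL x₂)
  have hvar0 : ∀ y, 0 ≤ (∫ z, h z ^ 2 ∂P y) - g y ^ 2 := fun y => by
    have hh : MemLp h 2 (P y) := MemLp.of_bound hm.aestronglyMeasurable C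
      (Filter.Eventually.of_forall hC)
    have h1 := sq_integral_mul_le hh (memLp_const (μ := P y) (p := 2) (1 : ℝ))
    simp only [mul_one, one_pow, integral_const, probReal_univ, smul_eq_mul] at h1
    exact sub_nonneg.mpr h1
  -- Mean conditional variance plus mean of `g²` is the mean of `h²`.
  have hfin := add_sq_le_of_sq_le hp (hTsq x₂ ▸ integral_nonneg fun y => sq_nonneg _)
    (integral_nonneg hvar0) (integral_nonneg fun y => sq_nonneg (g y)) hA hB
  rw [integral_sub hi2 hgL.integrable_sq, sub_add_cancel,
    ← integral_add (by exact hgL.integrable_mul (hTL x₁)) (by exact hgL.integrable_mul (hTL x₂))]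
    at hfin
  simpa only [add_dotProduct, mul_add] using hfin

end Bound

/-- A square integrable function whose correlation with bounded functions is controlled has a
controlled second moment. -/
theorem integral_sq_le_of_forall_bounded {Ω : Type*} [MeasurableSpace Ω] {μ : Measure Ω}
    [IsFiniteMeasure μ] {F : Ω → ℝ} (hF : MemLp F 2 μ) {c : ℝ}
    (h : ∀ f : Ω → ℝ, Measurable f → (∃ C : ℝ, ∀ ω, |f ω| ≤ C) →
      (∫ ω, f ω * F ω ∂μ) ^ 2 ≤ c * ∫ ω, f ω ^ 2 ∂μ) :
    ∫ ω, F ω ^ 2 ∂μ ≤ max c 0 := by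
  obtain ⟨G, hGm, hFG⟩ := hF.1.aemeasurable
  have hG : MemLp G 2 μ := (memLp_congr_ae hFG).mp hF
  have hFG2 : ∫ ω, F ω ^ 2 ∂μ = ∫ ω, G ω ^ 2 ∂μ := integral_congr_ae (hFG.mono fun ω hω => by
    simp only [hω])
  rw [hFG2]
  -- Testing with a truncation of the function itself makes the correlation equal to the second
  -- moment of the truncation; dividing by it gives the bound.
  let f : ℕ → Ω → ℝ := fun n => {ω | |G ω| ≤ n}.indicator G
  have hfm : ∀ n, Measurable (f n) := fun n =>
    hGm.indicator (measurableSet_le hGm.abs measurable_const)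
  have hfC : ∀ n ω, |f n ω| ≤ n := fun n ω => by
    by_cases hω : |G ω| ≤ n
    · simp [f, hω]
    · simp [f, hω]
  have hff : ∀ n ω, f n ω * G ω = f n ω ^ 2 := fun n ω => by
    by_cases hω : |G ω| ≤ n
    · simp [f, hω, sq]
    · simp [f, hω]
  have hle : ∀ n ω, f n ω ^ 2 ≤ G ω ^ 2 := fun n ω => by
    by_cases hω : |G ω| ≤ n
    · simp [f, hω]
    · simp [f, hω, sq_nonneg]
  have hbound : ∀ n, ∫ ω, f n ω ^ 2 ∂μ ≤ max c 0 := fun n => by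
    have h1 := h (f n) (hfm n) ⟨n, hfC n⟩
    have h2 : ∫ ω, f n ω * F ω ∂μ = ∫ ω, f n ω ^ 2 ∂μ := integral_congr_ae (hFG.mono fun ω hω => by
      simp only [hω, hff])
    rw [h2] at h1
    have h0 : 0 ≤ ∫ ω, f n ω ^ 2 ∂μ := integral_nonneg fun ω => sq_nonneg _
    rcases h0.eq_or_lt with h0 | h0
    · rw [← h0]
      exact le_max_right _ _
    · exact le_max_of_le_left (le_of_mul_le_mul_right (by rwa [sq] at h1) h0)
  refine le_of_tendsto' (tendsto_integral_of_dominated_convergence (fun ω => G ω ^ 2)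
    (fun n => ((hfm n).pow_const 2).aestronglyMeasurable) hG.integrable_sq
    (fun n => Filter.Eventually.of_forall fun ω => ?_)
    (Filter.Eventually.of_forall fun ω => ?_)) hbound
  · rw [Real.norm_of_nonneg (sq_nonneg _)]
    exact hle n ω
  · obtain ⟨N, hN⟩ := exists_nat_ge |G ω|
    refine tendsto_const_nhds.congr' ?_
    filter_upwards [Filter.eventually_ge_atTop N] with n hn
    have : |G ω| ≤ n := hN.trans (by exact_mod_cast hn)
    simp [f, this]

/-! ### Measurability -/

/-- The function is continuous on each of countably many Borel pieces. -/
theorem PiecewiseC1.measurable {E F : Type*} [NormedAddCommGroup E] [NormedSpace ℝ E]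
    [MeasureSpace E] [OpensMeasurableSpace E] [NormedAddCommGroup F] [NormedSpace ℝ F]
    [MeasurableSpace F] [BorelSpace F] {f : E → F} (hf : PiecewiseC1 f) : Measurable f := by
  obtain ⟨A, -, hcov, hA⟩ := hf
  intro t ht
  have hpre : f ⁻¹' t = ⋃ j, Subtype.val '' ((A j).domRestrict f ⁻¹' t) := by
    ext x
    simp only [Set.mem_preimage, Set.mem_iUnion, Set.mem_image, Subtype.exists, Set.domRestrict_apply,
      exists_and_right, exists_eq_right]
    refine ⟨fun hx => ?_, fun ⟨j, hj, hx⟩ => hx⟩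
    obtain ⟨j, hj⟩ := Set.mem_iUnion.mp (hcov ▸ Set.mem_univ x)
    exact ⟨j, hj, hx⟩
  rw [hpre]
  refine MeasurableSet.iUnion fun j => ?_
  obtain ⟨hAj, -, U, g, -, hAU, hg, hfg⟩ := hA j
  refine MeasurableSet.subtype_image hAj ?_
  have hcont : Continuous ((A j).domRestrict f) := by
    rw [← continuousOn_iff_continuous_domRestrict]
    exact (hg.continuousOn.mono hAU).congr hfg
  exact hcont.measurable ht

theorem IsPC1Density.isProbabilityMeasure {q : ℕ} {f : (Fin q → ℝ) → ℝ} (hf : IsPC1Density f) :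
    IsProbabilityMeasure (densityLaw f) :=
  ⟨by rw [densityLaw, withDensity_apply _ .univ, Measure.restrict_univ, hf.2.2]⟩

/-! ### The information that survives obfuscation -/

/-- The Fisher information about `y` of `C (y + w) + d`, with independent `w ∼ N(0, V)` and
`d ∼ N(0, 1)`. -/
def obfuscatedInfo {m r : ℕ} (C : Matrix (Fin r) (Fin m) ℝ) (V : Matrix (Fin m) (Fin m) ℝ) :
    Matrix (Fin m) (Fin m) ℝ :=
  Cᵀ * (C * V * Cᵀ + 1)⁻¹ * C

section Obfuscated

variable {m r : ℕ} (C : Matrix (Fin r) (Fin m) ℝ) {V : Matrix (Fin m) (Fin m) ℝ}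

theorem posDef_mul_mul_transpose_add_one (hV : V.PosSemidef) : (C * V * Cᵀ + 1).PosDef := by
  have : (C * V * Cᵀ).PosSemidef := by simpa using hV.mul_mul_conjTranspose_same C
  exact Matrix.PosDef.posSemidef_add this Matrix.PosDef.one

theorem obfuscatedInfo_posSemidef (hV : V.PosSemidef) : (obfuscatedInfo C V).PosSemidef := by
  have := (posDef_mul_mul_transpose_add_one C hV).inv.posSemidef.conjTranspose_mul_mul_same C
  simpa [obfuscatedInfo] using this

/-- `obfuscatedInfo C V` is the parallel sum of `Cᵀ C` and `V⁻¹`. -/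
theorem exists_add_eq_obfuscatedInfo (hV : V.PosDef) (x : Fin m → ℝ) :
    ∃ x₁ x₂ : Fin m → ℝ, x₁ + x₂ = x ∧
      x₁ ⬝ᵥ (Cᵀ * C) *ᵥ x₁ + x₂ ⬝ᵥ V⁻¹ *ᵥ x₂ = x ⬝ᵥ obfuscatedInfo C V *ᵥ x := by
  have hG := posDef_mul_mul_transpose_add_one C hV.posSemidef
  set G := C * V * Cᵀ + 1 with hGdef
  have hGu : IsUnit G.det := (Matrix.isUnit_iff_isUnit_det _).mp hG.isUnit
  have hVu : IsUnit V.det := (Matrix.isUnit_iff_isUnit_det _).mp hV.isUnit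
  have hVs : Vᵀ = V := by simpa using hV.isHermitian.eq
  -- The split `x₂ = V Cᵀ y` satisfies `C x₁ = y`, hence `Cᵀ C x₁ = V⁻¹ x₂`: the stationarity
  -- condition for minimizing the sum of the two quadratic forms.
  set y := G⁻¹ *ᵥ (C *ᵥ x) with hy
  have hGy : G *ᵥ y = C *ᵥ x := by
    rw [hy, Matrix.mulVec_mulVec, Matrix.mul_nonsing_inv _ hGu, Matrix.one_mulVec]
  have hCx : C *ᵥ (V *ᵥ (Cᵀ *ᵥ y)) = C *ᵥ x - y := by
    rw [← hGy, hGdef, Matrix.add_mulVec, Matrix.one_mulVec, add_sub_cancel_right,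
      Matrix.mulVec_mulVec, Matrix.mulVec_mulVec, Matrix.mul_assoc]
  have hT : ∀ a : Fin m → ℝ, ∀ b : Fin r → ℝ, a ⬝ᵥ Cᵀ *ᵥ b = C *ᵥ a ⬝ᵥ b := fun a b => by
    rw [Matrix.dotProduct_mulVec, Matrix.vecMul_transpose]
  refine ⟨x - V *ᵥ (Cᵀ *ᵥ y), V *ᵥ (Cᵀ *ᵥ y), sub_add_cancel _ _, ?_⟩
  have h1 : C *ᵥ (x - V *ᵥ (Cᵀ *ᵥ y)) = y := by
    rw [Matrix.mulVec_sub, hCx, sub_sub_cancel]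
  have h2 : V⁻¹ *ᵥ (V *ᵥ (Cᵀ *ᵥ y)) = Cᵀ *ᵥ y := by
    rw [Matrix.mulVec_mulVec, Matrix.nonsing_inv_mul _ hVu, Matrix.one_mulVec]
  rw [← Matrix.mulVec_mulVec, hT, h1, h2, hT, hCx, obfuscatedInfo, ← Matrix.mulVec_mulVec,
    ← Matrix.mulVec_mulVec, hT, ← hy, sub_dotProduct]
  ring

end Obfuscated

/-! ### Expectations under the output law -/

section Output

variable {n : ℕ} {Y D Z : Type*} [MeasurableSpace Y] [MeasurableSpace D]
  [MeasurableSpace Z] {M : Y → D → Z} {μd : Measure D}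

theorem integral_lawGivenY (hM : Measurable fun x : Y × D => M x.1 x.2) {h : Z → ℝ}
    (hh : Measurable h) (y : Y) : ∫ z, h z ∂lawGivenY M μd y = ∫ d, h (M y d) ∂μd :=
  integral_map (by fun_prop) hh.aestronglyMeasurable

variable [IsProbabilityMeasure μd]

theorem isProbabilityMeasure_lawGivenY (hM : Measurable fun x : Y × D => M x.1 x.2) (y : Y) :
    IsProbabilityMeasure (lawGivenY M μd y) :=
  Measure.isProbabilityMeasure_map (by fun_prop)

theorem measurable_integral_lawGivenY (hM : Measurable fun x : Y × D => M x.1 x.2) {h : Z → ℝ}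
    (hh : Measurable h) : Measurable fun y => ∫ z, h z ∂lawGivenY M μd y := by
  simp only [integral_lawGivenY hM hh]
  exact ((hh.comp hM).stronglyMeasurable.integral_prod_right').measurable

theorem abs_integral_lawGivenY_le (hM : Measurable fun x : Y × D => M x.1 x.2) {h : Z → ℝ} {C : ℝ}
    (hC : ∀ z, |h z| ≤ C) (y : Y) : |∫ z, h z ∂lawGivenY M μd y| ≤ C := by
  have := isProbabilityMeasure_lawGivenY (μd := μd) hM y
  simpa using norm_integral_le_of_norm_le_const (μ := lawGivenY M μd y) (f := h)
    (Filter.Eventually.of_forall hC)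

variable [Add Y] [MeasurableAdd Y]

/-- Conditioning on the measurement: `θ` enters only through the law of `y`, and the channel from
`y` to `z` is the one restricted by privacy. -/
theorem integral_outputLaw (hM : Measurable fun x : Y × D => M x.1 x.2)
    (μw : Measure Y) [IsProbabilityMeasure μw] (H : (Fin n → ℝ) → Y) (θ : Fin n → ℝ)
    {h : Z → ℝ} (hh : Measurable h) {C : ℝ} (hC : ∀ z, |h z| ≤ C) :
    ∫ z, h z ∂outputLaw H μw M μd θ =
      ∫ y, ∫ z, h z ∂lawGivenY M μd y ∂μw.map (fun w => H θ + w) := by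
  have hm : Measurable fun x : Y × D => M (H θ + x.1) x.2 :=
    hM.comp (f := fun x : Y × D => (H θ + x.1, x.2)) (by fun_prop)
  rw [outputLaw, integral_map hm.aemeasurable hh.aestronglyMeasurable, integral_prod,
    integral_map (by fun_prop) (measurable_integral_lawGivenY hM hh).aestronglyMeasurable]
  · simp only [integral_lawGivenY hM hh]
  · exact Integrable.of_bound (hh.comp hm).aestronglyMeasurable C
      (Filter.Eventually.of_forall fun x => hC _)

theorem integral_mul_lawGivenY (hM : Measurable fun x : Y × D => M x.1 x.2)
    (μw : Measure Y) [IsProbabilityMeasure μw] (c : Y)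
    {h : Z → ℝ} (hh : Measurable h) {C : ℝ} (hC : ∀ z, |h z| ≤ C) {u : Y → ℝ} (hu : Measurable u)
    (hui : Integrable (fun w => u (c + w)) μw) :
    ∫ y, (∫ z, h z ∂lawGivenY M μd y) * u y ∂μw.map (fun w => c + w) =
      ∫ x : Y × D, h (M (c + x.1) x.2) * u (c + x.1) ∂μw.prod μd := by
  have hm : Measurable fun x : Y × D => M (c + x.1) x.2 :=
    hM.comp (f := fun x : Y × D => (c + x.1, x.2)) (by fun_prop)
  rw [integral_map (f := fun y => (∫ z, h z ∂lawGivenY M μd y) * u y) (by fun_prop)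
    ((measurable_integral_lawGivenY hM hh).mul hu).aestronglyMeasurable, integral_prod]
  · simp only [integral_lawGivenY hM hh, integral_mul_const]
  · exact (hui.comp_fst μd).bdd_mul (c := C) (hh.comp hm).aestronglyMeasurable
      (Filter.Eventually.of_forall fun x => hC _)

/-- The score of the output is correlated with statistics of the output like the score of
the measurements. -/
theorem integral_mul_score_outputLaw (hM : Measurable fun x : Y × D => M x.1 x.2)
    {μw : Measure Y} [IsProbabilityMeasure μw] {H : (Fin n → ℝ) → Y}
    {T : Y → Fin n → ℝ} {Q : Matrix (Fin n) (Fin n) ℝ}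
    (hΓ : IsGaussianShift (fun θ => μw.map (fun w => H θ + w)) T Q) {θ : Fin n → ℝ}
    {ℓ : Z → Fin n → ℝ} (hD : DiffUnderIntegral (outputLaw H μw M μd) θ ℓ)
    (hL : ∀ a, MemLp (fun z => ℓ z a) 2 (outputLaw H μw M μd θ))
    {h : Z → ℝ} (hh : Measurable h) {C : ℝ} (hC : ∀ z, |h z| ≤ C) (v : Fin n → ℝ) :
    ∫ z, h z * (v ⬝ᵥ ℓ z) ∂outputLaw H μw M μd θ =
      ∫ y, (∫ z, h z ∂lawGivenY M μd y) * (v ⬝ᵥ (T y - Q *ᵥ θ)) ∂μw.map (fun w => H θ + w) := by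
  have hm : Measurable fun x : Y × D => M (H θ + x.1) x.2 :=
    hM.comp (f := fun x : Y × D => (H θ + x.1, x.2)) (by fun_prop)
  have : IsProbabilityMeasure (outputLaw H μw M μd θ) :=
    Measure.isProbabilityMeasure_map hm.aemeasurable
  have := hΓ.prob θ
  -- One expectation is differentiated in `θ` in two ways: through the output laws, and through the
  -- Gaussian location family of the measurements with the fixed statistic `E[h | y]`.
  rw [← hD.fderiv_apply hL hh hC v, funext fun θ' => integral_outputLaw hM μw H θ' hh hC]
  exact (hΓ.diffUnderIntegral θ).fderiv_apply (hΓ.memLp_score θ)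
    (measurable_integral_lawGivenY hM hh) (abs_integral_lawGivenY_le hM hC) v

end Output

/-! ### The upper bound for a single measurement -/

theorem gaussianLaw_map_add {m : ℕ} (μ c : Fin m → ℝ) {V : Matrix (Fin m) (Fin m) ℝ}
    (hV : V.PosSemidef) : (gaussianLaw μ V).map (fun w => c + w) = gaussianLaw (μ + c) V := by
  have := gaussianLaw_map_affine μ hV 1 c
  simpa [add_comm c] using this

theorem gaussianLaw_isGaussianShift_map {m : ℕ} (μ : Fin m → ℝ) {V : Matrix (Fin m) (Fin m) ℝ}
    (hV : V.PosDef) : IsGaussianShift (fun x => (gaussianLaw μ V).map (fun y => x + y))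
      (fun y => V⁻¹ *ᵥ (y - μ)) V⁻¹ := by
  simp only [gaussianLaw_map_add _ _ hV.posSemidef]
  exact gaussianLaw_shift μ hV

/-- The upper bound for the Fisher information of an obfuscated measurement. -/
theorem single_fisher_le {m n q r p : ℕ} {H : Matrix (Fin m) (Fin n) ℝ} {μ : Fin m → ℝ}
    {V : Matrix (Fin m) (Fin m) ℝ} (hV : V.PosDef) (C : Matrix (Fin p) (Fin m) ℝ)
    {M : (Fin m → ℝ) → (Fin q → ℝ) → (Fin r → ℝ)} {f : (Fin q → ℝ) → ℝ}
    (hM : Measurable fun x : (Fin m → ℝ) × (Fin q → ℝ) => M x.1 x.2) (hf : IsPC1Density f)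
    (hpriv : PrivacyConstraint (Cᵀ * C) M f) {θ : Fin n → ℝ} {J : Matrix (Fin n) (Fin n) ℝ}
    (hJ : HasFisherInfo (outputLaw (fun θ' => H *ᵥ θ') (gaussianLaw μ V) M (densityLaw f)) θ J)
    (v : Fin n → ℝ) :
    v ⬝ᵥ J *ᵥ v ≤ (H *ᵥ v) ⬝ᵥ obfuscatedInfo C V *ᵥ (H *ᵥ v) := by
  have := hf.isProbabilityMeasure
  obtain ⟨ℓ, -, hD, hL, hJe⟩ := hJ
  have hm : Measurable fun x : (Fin m → ℝ) × (Fin q → ℝ) => M (H *ᵥ θ + x.1) x.2 :=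
    hM.comp (f := fun x : (Fin m → ℝ) × (Fin q → ℝ) => (H *ᵥ θ + x.1, x.2)) (by fun_prop)
  have : IsProbabilityMeasure
      (outputLaw (fun θ' => H *ᵥ θ') (gaussianLaw μ V) M (densityLaw f) θ) :=
    Measure.isProbabilityMeasure_map hm.aemeasurable
  have := isProbabilityMeasure_lawGivenY (μd := densityLaw f) hM
  have h0 : 0 ≤ (H *ᵥ v) ⬝ᵥ obfuscatedInfo C V *ᵥ (H *ᵥ v) := by
    simpa using (obfuscatedInfo_posSemidef C hV.posSemidef).dotProduct_mulVec_nonneg (H *ᵥ v)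
  rw [quadratic_eq_integral_sq hL hJe, ← max_eq_left h0]
  refine integral_sq_le_of_forall_bounded (memLp_dotProduct_score hL v) fun h hh ⟨K, hK⟩ => ?_
  have hΓ := (gaussianLaw_isGaussianShift_map μ hV).comp_mulVec H
  rw [integral_mul_score_outputLaw hM hΓ hD hL hh hK v]
  obtain ⟨x₁, x₂, hx, hq⟩ := exists_add_eq_obfuscatedInfo C hV (H *ᵥ v)
  have hh2 : Measurable fun z => h z ^ 2 := hh.pow_const 2
  have hK2 : ∀ z, |h z ^ 2| ≤ K ^ 2 := fun z => by
    rw [abs_pow]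
    exact pow_le_pow_left₀ (abs_nonneg _) (hK z) 2
  rw [integral_outputLaw hM _ _ θ hh2 hK2, ← hq]
  -- The input law for the channel bound is the law of `y` at the parameter `θ`.
  have hγ := gaussianLaw_isGaussianShift_map (μ + H *ᵥ θ) hV
  rw [← gaussianLaw_map_add _ _ hV.posSemidef] at hγ
  have := hΓ.prob θ
  have key := sq_integral_mul_score_le hpriv hγ hh hK
    (measurable_integral_lawGivenY hM hh2) x₁ x₂
  rw [hx] at key
  convert! key using 5 with y
  rw [← Matrix.mulVec_mulVec, ← Matrix.mulVec_mulVec, ← Matrix.mulVec_sub, ← Matrix.mulVec_sub,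
    Matrix.dotProduct_mulVec, Matrix.vecMul_transpose]
  congr 2
  abel

/-! ### Conditional independence of the users of an interactive protocol -/

section CondIndep

variable {Ω : Type*} {mΩ : MeasurableSpace Ω}

/-- Given `𝒢`, the events of `ℬ` do not depend on `𝒜`. -/
def CondIrrelevant (μ : Measure Ω) (𝒜 ℬ 𝒢 : MeasurableSpace Ω) : Prop :=
  ∀ b, MeasurableSet[ℬ] b →
    μ[b.indicator (fun _ => (1 : ℝ)) | 𝒜 ⊔ 𝒢] =ᵐ[μ] μ[b.indicator (fun _ => (1 : ℝ)) | 𝒢]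

theorem isPiSystem_inter (m₁ m₂ : MeasurableSpace Ω) :
    IsPiSystem {s : Set Ω | ∃ b c, MeasurableSet[m₁] b ∧ MeasurableSet[m₂] c ∧ b ∩ c = s} := by
  rintro _ ⟨b, c, hb, hc, rfl⟩ _ ⟨b', c', hb', hc', rfl⟩ -
  exact ⟨b ∩ b', c ∩ c', hb.inter hb', hc.inter hc', Set.inter_inter_inter_comm b b' c c'⟩

theorem sup_eq_generateFrom_inter (m₁ m₂ : MeasurableSpace Ω) :
    m₁ ⊔ m₂ = MeasurableSpace.generateFrom
      {s : Set Ω | ∃ b c, MeasurableSet[m₁] b ∧ MeasurableSet[m₂] c ∧ b ∩ c = s} := by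
  refine le_antisymm (sup_le (fun s hs => ?_) fun s hs => ?_)
    (MeasurableSpace.generateFrom_le ?_)
  · exact MeasurableSpace.measurableSet_generateFrom
      ⟨s, Set.univ, hs, MeasurableSet.univ, Set.inter_univ s⟩
  · exact MeasurableSpace.measurableSet_generateFrom
      ⟨Set.univ, s, MeasurableSet.univ, hs, Set.univ_inter s⟩
  · rintro _ ⟨b, c, hb, hc, rfl⟩
    exact MeasurableSet.inter ((le_sup_left : m₁ ≤ m₁ ⊔ m₂) _ hb)
      ((le_sup_right : m₂ ≤ m₁ ⊔ m₂) _ hc)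

/-- The reverse direction of conditional independence, for functions. It suffices to integrate over
`b ∩ c` with `b ∈ ℬ`, `c ∈ 𝒢`: conditioning on `𝒜 ⊔ 𝒢` replaces the indicator of `b` by its
`𝒢`-conditional expectation, and conditioning on `𝒢` then moves the conditional expectation over to
`f`. -/
theorem CondIrrelevant.condExp_sup_eq {μ : Measure Ω} [IsProbabilityMeasure μ]
    {𝒜 ℬ 𝒢 : MeasurableSpace Ω} (h𝒜 : 𝒜 ≤ mΩ) (hℬ : ℬ ≤ mΩ) (h𝒢 : 𝒢 ≤ mΩ)
    (h : CondIrrelevant μ 𝒜 ℬ 𝒢) {f : Ω → ℝ} (hf : StronglyMeasurable[𝒜] f)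
    (hfi : Integrable f μ) : μ[f | ℬ ⊔ 𝒢] =ᵐ[μ] μ[f | 𝒢] := by
  symm
  refine ae_eq_condExp_of_forall_setIntegral_eq (sup_le hℬ h𝒢) hfi
    (fun s _ _ => integrable_condExp.integrableOn) (fun s hs hlt => ?_)
    ⟨_, stronglyMeasurable_condExp.mono le_sup_right, Filter.EventuallyEq.rfl⟩
  clear hlt
  induction s, hs using MeasurableSpace.induction_on_inter (sup_eq_generateFrom_inter ℬ 𝒢)
    (isPiSystem_inter ℬ 𝒢) with
  | empty => simp
  | basic s hs =>
    obtain ⟨b, c, hb, hc, rfl⟩ := hs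
    set χ : Ω → ℝ := b.indicator fun _ => (1 : ℝ) with hχ
    have hχm : Measurable[mΩ] χ := measurable_const.indicator (hℬ _ hb)
    have hχb : ∀ ω, |χ ω| ≤ 1 := fun ω => by
      by_cases hω : ω ∈ b <;> simp [hχ, hω]
    have hχi : Integrable χ μ := Integrable.of_bound hχm.aestronglyMeasurable 1
      (Filter.Eventually.of_forall hχb)
    have hmul : ∀ {g : Ω → ℝ}, Integrable g μ → Integrable (g * χ) μ := fun hg =>
      hg.mul_bdd (c := 1) hχm.aestronglyMeasurable (Filter.Eventually.of_forall hχb)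
    have hset : ∀ g : Ω → ℝ, ∫ ω in b ∩ c, g ω ∂μ = ∫ ω in c, (g * χ) ω ∂μ := fun g => by
      rw [Set.inter_comm, ← setIntegral_indicator (hℬ _ hb)]
      congr 1
      funext ω
      by_cases hω : ω ∈ b <;> simp [hχ, hω]
    have hB1 : ∀ᵐ ω ∂μ, |(μ[χ | 𝒢]) ω| ≤ 1 :=
      ae_bdd_abs_condExp_of_ae_bdd_abs (Filter.Eventually.of_forall hχb)
    have hfB : Integrable (f * μ[χ | 𝒢]) μ := hfi.mul_bdd (c := 1)
      (stronglyMeasurable_condExp.mono h𝒢).aestronglyMeasurable hB1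
    rw [hset, hset]
    have hcongr : ∀ {g g' : Ω → ℝ}, g =ᵐ[μ] g' → ∫ ω in c, g ω ∂μ = ∫ ω in c, g' ω ∂μ :=
      fun hgg => integral_congr_ae (ae_restrict_of_ae hgg)
    symm
    calc ∫ ω in c, (f * χ) ω ∂μ
        = ∫ ω in c, (μ[f * χ | 𝒜 ⊔ 𝒢]) ω ∂μ :=
          (setIntegral_condExp (sup_le h𝒜 h𝒢) (hmul hfi)
            ((le_sup_right : 𝒢 ≤ 𝒜 ⊔ 𝒢) _ hc)).symm
      _ = ∫ ω in c, (f * μ[χ | 𝒜 ⊔ 𝒢]) ω ∂μ := hcongr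
          (condExp_mul_of_stronglyMeasurable_left (hf.mono le_sup_left) (hmul hfi) hχi)
      _ = ∫ ω in c, (f * μ[χ | 𝒢]) ω ∂μ := hcongr (by
          filter_upwards [h b hb] with ω hω
          rw [Pi.mul_apply, Pi.mul_apply, hω])
      _ = ∫ ω in c, (μ[f * μ[χ | 𝒢] | 𝒢]) ω ∂μ := (setIntegral_condExp h𝒢 hfB hc).symm
      _ = ∫ ω in c, (μ[f | 𝒢] * μ[χ | 𝒢]) ω ∂μ := hcongr
          (condExp_mul_of_stronglyMeasurable_right stronglyMeasurable_condExp hfB hfi)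
      _ = ∫ ω in c, (μ[μ[f | 𝒢] * χ | 𝒢]) ω ∂μ := hcongr
          (condExp_mul_of_stronglyMeasurable_left stronglyMeasurable_condExp
            (hmul integrable_condExp) hχi).symm
      _ = ∫ ω in c, (μ[f | 𝒢] * χ) ω ∂μ :=
          setIntegral_condExp h𝒢 (hmul integrable_condExp) hc
  | compl s hs ih =>
    have hs' := sup_le hℬ h𝒢 _ hs
    rw [setIntegral_compl hs' integrable_condExp, setIntegral_compl hs' hfi, ih,
      integral_condExp h𝒢]
  | iUnion s hd hs ih =>
    have hs' := fun j => sup_le hℬ h𝒢 _ (hs j)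
    rw [integral_iUnion hs' hd integrable_condExp.integrableOn,
      integral_iUnion hs' hd hfi.integrableOn]
    simp only [ih]

theorem CondIrrelevant.symm {μ : Measure Ω} [IsProbabilityMeasure μ]
    {𝒜 ℬ 𝒢 : MeasurableSpace Ω} (h𝒜 : 𝒜 ≤ mΩ) (hℬ : ℬ ≤ mΩ) (h𝒢 : 𝒢 ≤ mΩ)
    (h : CondIrrelevant μ 𝒜 ℬ 𝒢) : CondIrrelevant μ ℬ 𝒜 𝒢 := fun _ ha =>
  h.condExp_sup_eq h𝒜 hℬ h𝒢 (stronglyMeasurable_const.indicator ha)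
    ((integrable_const _).indicator (h𝒜 _ ha))

/-- A message computed from `𝒜` and the past may be added to the conditioning: `𝒜 ⊔ 𝒢'` is still `𝒜
⊔ 𝒢`, and the conditional expectation given it is already measurable for `𝒢 ≤ 𝒢'`. -/
theorem CondIrrelevant.enlarge {μ : Measure Ω} [IsProbabilityMeasure μ]
    {𝒜 ℬ 𝒢 𝒢' : MeasurableSpace Ω} (h𝒜 : 𝒜 ≤ mΩ) (h𝒢 : 𝒢 ≤ mΩ) (h : CondIrrelevant μ 𝒜 ℬ 𝒢)
    (h₁ : 𝒢 ≤ 𝒢') (h₂ : 𝒢' ≤ 𝒜 ⊔ 𝒢) : CondIrrelevant μ 𝒜 ℬ 𝒢' := fun b hb => by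
  have hsup : 𝒜 ⊔ 𝒢' = 𝒜 ⊔ 𝒢 := le_antisymm (sup_le le_sup_left h₂) (sup_le_sup_left h₁ 𝒜)
  have hle := sup_le h𝒜 h𝒢
  rw [hsup]
  have h3 := condExp_condExp_of_le (f := b.indicator fun _ => (1 : ℝ)) (μ := μ) h₂ hle
  have h4 : μ[μ[b.indicator (fun _ => (1 : ℝ)) | 𝒜 ⊔ 𝒢] | 𝒢'] =ᵐ[μ]
      μ[μ[b.indicator (fun _ => (1 : ℝ)) | 𝒢] | 𝒢'] := condExp_congr_ae (h b hb)
  rw [condExp_of_stronglyMeasurable (h₂.trans hle) (stronglyMeasurable_condExp.mono h₁)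
    integrable_condExp] at h4
  exact (h b hb).trans (h4.symm.trans h3)

theorem Indep.condIrrelevant_bot {μ : Measure Ω} [IsProbabilityMeasure μ] {𝒜 ℬ : MeasurableSpace Ω}
    (h𝒜 : 𝒜 ≤ mΩ) (hℬ : ℬ ≤ mΩ) (h : Indep ℬ 𝒜 μ) : CondIrrelevant μ 𝒜 ℬ ⊥ := fun b hb => by
  rw [sup_bot_eq, condExp_bot]
  exact condExp_indep_eq hℬ h𝒜 (stronglyMeasurable_const.indicator hb) h

theorem integral_mul_condExp {μ : Measure Ω} [IsProbabilityMeasure μ] {𝒢 : MeasurableSpace Ω}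
    (h𝒢 : 𝒢 ≤ mΩ) {F g : Ω → ℝ} (hF : StronglyMeasurable[𝒢] F) (hF2 : MemLp F 2 μ)
    (hg : MemLp g 2 μ) : ∫ ω, F ω * (μ[g | 𝒢]) ω ∂μ = ∫ ω, F ω * g ω ∂μ := by
  have h1 := condExp_mul_of_stronglyMeasurable_left hF (hF2.integrable_mul hg)
    (hg.integrable one_le_two)
  rw [← integral_condExp h𝒢 (f := fun ω => F ω * g ω)]
  exact integral_congr_ae h1.symm

/-- In an interactive protocol, where the message `Z k i` of user `i` at time `k` is computed from
the private input `X i` and the previous messages of all users, independent private inputs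
remain independent given the transcript. -/
theorem condIrrelevant_transcript {N K : ℕ} {𝒳 : Fin N → Type*} [∀ i, MeasurableSpace (𝒳 i)]
    {R : Fin N → Fin K → Type*} [∀ i k, MeasurableSpace (R i k)] {μ : Measure Ω}
    [IsProbabilityMeasure μ] {X : ∀ i, Ω → 𝒳 i} (hX : ∀ i, Measurable (X i)) (hind : iIndepFun X μ)
    {Z : ∀ k i, Ω → R i k}
    {φ : ∀ i k, 𝒳 i × (∀ (j : Fin N) (t : {t : Fin K // t < k}), R j t) → R i k}
    (hφ : ∀ i k, Measurable (φ i k))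
    (hZ : ∀ k i ω, Z k i ω = φ i k (X i ω, fun j t => Z t j ω)) (i : Fin N) :
    CondIrrelevant μ (MeasurableSpace.comap (X i) inferInstance)
      (⨆ j ∈ ({i}ᶜ : Set (Fin N)), MeasurableSpace.comap (X j) inferInstance)
      (⨆ k, ⨆ j, MeasurableSpace.comap (Z k j) inferInstance) := by
  have hZm : ∀ (k : Fin K) (j : Fin N), Measurable (Z k j) := by
    intro k
    induction k using WellFoundedLT.induction with
    | ind k ih =>
      intro j
      rw [funext (hZ k j)]
      exact (hφ j k).comp ((hX j).prodMk (measurable_pi_lambda _ fun j' =>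
        measurable_pi_lambda _ fun t : {t // t < k} => ih t.1 t.2 j'))
  set 𝒜 : MeasurableSpace Ω := MeasurableSpace.comap (X i) inferInstance with h𝒜def
  set ℬ : MeasurableSpace Ω :=
    ⨆ j ∈ ({i}ᶜ : Set (Fin N)), MeasurableSpace.comap (X j) inferInstance with hℬdef
  let 𝒢 : ℕ → MeasurableSpace Ω := fun l =>
    ⨆ k : {k : Fin K // k.1 < l}, ⨆ j, MeasurableSpace.comap (Z k j) inferInstance
  have h𝒜 : 𝒜 ≤ mΩ := (hX i).comap_le
  have hℬ : ℬ ≤ mΩ := iSup₂_le fun j _ => (hX j).comap_le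
  have hZ𝒢 : ∀ (l : ℕ) (k : Fin K) (j : Fin N), k.1 < l → Measurable[𝒢 l] (Z k j) :=
    fun l k j hk => Measurable.of_comap_le
      (le_iSup_of_le (⟨k, hk⟩ : {k : Fin K // k.1 < l}) (le_iSup_of_le j le_rfl))
  have hstep : ∀ (k : Fin K) (j : Fin N) (m : MeasurableSpace Ω), Measurable[m] (X j) →
      𝒢 k ≤ m → MeasurableSpace.comap (Z k j) inferInstance ≤ m := fun k j m hm hle => by
    refine Measurable.comap_le ?_
    rw [funext (hZ k j)]
    refine (hφ j k).comp (hm.prodMk ?_)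
    exact measurable_pi_lambda _ fun j' => measurable_pi_lambda _ fun t =>
      (hZ𝒢 k t j' t.2).mono hle le_rfl
  have h𝒢 : ∀ l, 𝒢 l ≤ mΩ := fun l => iSup_le fun k => iSup_le fun j => (hZm k j).comap_le
  -- Induction on the number of completed rounds; `𝒢 l` is generated by the messages at times before
  -- `l`.
  have key : ∀ l, CondIrrelevant μ 𝒜 ℬ (𝒢 l) := fun l => by
    induction l with
    | zero =>
      have h0 : 𝒢 0 = ⊥ := by
        have : IsEmpty {k : Fin K // k.1 < 0} := ⟨fun k => absurd k.2 (Nat.not_lt_zero _)⟩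
        exact iSup_of_empty _
      rw [h0]
      refine Indep.condIrrelevant_bot h𝒜 hℬ ?_
      have h1 := indep_iSup_of_disjoint (fun j => (hX j).comap_le) hind.iIndep
        (S := ({i}ᶜ : Set (Fin N))) (T := {i}) disjoint_compl_left
      simpa only [Set.mem_singleton_iff, iSup_iSup_eq_left] using h1
    | succ l ih =>
      have hmono : 𝒢 l ≤ 𝒢 (l + 1) := iSup_le fun k => iSup_le fun j =>
        (hZ𝒢 (l + 1) k j (k.2.trans (Nat.lt_succ_self l))).comap_le
      by_cases hl : l < K
      -- A round is added in two halves: first the message of user `i`, measurable for `𝒜 ⊔ 𝒢 l`,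
      -- then, with the roles of `𝒜` and `ℬ` exchanged, the messages of all others.
      · set 𝒢₁ := 𝒢 l ⊔ MeasurableSpace.comap (Z ⟨l, hl⟩ i) inferInstance with h𝒢₁
        have h₁le : 𝒢₁ ≤ 𝒜 ⊔ 𝒢 l := sup_le le_sup_right
          (hstep ⟨l, hl⟩ i _ (Measurable.of_comap_le le_sup_left) le_sup_right)
        have hm₁ : 𝒢₁ ≤ mΩ := h₁le.trans (sup_le h𝒜 (h𝒢 l))
        have c₁ : CondIrrelevant μ ℬ 𝒜 𝒢₁ :=
          (ih.enlarge h𝒜 (h𝒢 l) le_sup_left h₁le).symm h𝒜 hℬ hm₁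
        refine (c₁.enlarge hℬ hm₁ (sup_le hmono
          (hZ𝒢 (l + 1) ⟨l, hl⟩ i (Nat.lt_succ_self l)).comap_le) ?_).symm hℬ h𝒜 (h𝒢 _)
        refine iSup_le fun k => iSup_le fun j => ?_
        rcases (Nat.lt_succ_iff.mp k.2).lt_or_eq with hk | hk
        · exact ((hZ𝒢 l k j hk).mono (le_sup_left.trans le_sup_right) le_rfl).comap_le
        · have hkl : (k : Fin K) = ⟨l, hl⟩ := Fin.ext hk
          rw [hkl]
          by_cases hj : j = i
          · rw [hj]
            exact le_sup_right.trans le_sup_right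
          · refine hstep ⟨l, hl⟩ j _ (Measurable.of_comap_le (le_sup_of_le_left ?_))
              (le_sup_left.trans le_sup_right)
            exact le_iSup₂_of_le j (by simpa using hj) le_rfl
      · have : 𝒢 (l + 1) ≤ 𝒢 l := iSup_le fun k => iSup_le fun j =>
          (hZ𝒢 l k j (by have := k.1.2; omega)).comap_le
        rw [le_antisymm this hmono]
        exact ih
  have hK : (⨆ k, ⨆ j, MeasurableSpace.comap (Z k j) inferInstance) = 𝒢 K :=
    le_antisymm (iSup_le fun k => iSup_le fun j => (hZ𝒢 K k j k.2).comap_le)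
      (iSup_le fun k => le_iSup_of_le k.1 le_rfl)
  rw [hK]
  exact key K

/-- Centred functions of independent inputs remain uncorrelated after conditioning. -/
theorem integral_condExp_mul_condExp_eq_zero {μ : Measure Ω} [IsProbabilityMeasure μ]
    {𝒜 ℬ 𝒢 : MeasurableSpace Ω} (h𝒜 : 𝒜 ≤ mΩ) (hℬ : ℬ ≤ mΩ) (h𝒢 : 𝒢 ≤ mΩ)
    (h : CondIrrelevant μ 𝒜 ℬ 𝒢) {f g : Ω → ℝ} (hf : StronglyMeasurable[𝒜] f)
    (hg : StronglyMeasurable[ℬ] g) (hf2 : MemLp f 2 μ) (hg2 : MemLp g 2 μ)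
    (hfg : ∫ ω, f ω * g ω ∂μ = 0) :
    ∫ ω, (μ[f | 𝒢]) ω * (μ[g | 𝒢]) ω ∂μ = 0 := by
  rw [integral_mul_condExp h𝒢 stronglyMeasurable_condExp (hf2.condExp one_le_two) hg2]
  have h1 := h.condExp_sup_eq h𝒜 hℬ h𝒢 hf (hf2.integrable one_le_two)
  rw [← hfg]
  calc ∫ ω, (μ[f | 𝒢]) ω * g ω ∂μ = ∫ ω, g ω * (μ[f | ℬ ⊔ 𝒢]) ω ∂μ := integral_congr_ae (by
        filter_upwards [h1] with ω hω
        rw [hω, mul_comm])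
    _ = ∫ ω, g ω * f ω ∂μ :=
        integral_mul_condExp (sup_le hℬ h𝒢) (hg.mono le_sup_left) hg2 hf2
    _ = ∫ ω, f ω * g ω ∂μ := by simp only [mul_comm]

/-- A statistic `L` of the transcript that is correlated with bounded statistics like `∑ i, U i`,
with conditionally uncorrelated `U i`, has a second moment controlled by the correlations of the
`U i` with the transcript. -/
theorem integral_sq_le_sum_of_uncorrelated {κ Z : Type*} [Fintype κ] [MeasurableSpace Z]
    {μ : Measure Ω} [IsProbabilityMeasure μ] {ζ : Ω → Z} (hζ : Measurable ζ) {U : κ → Ω → ℝ}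
    (hU : ∀ i, MemLp (U i) 2 μ) {L : Z → ℝ} (hL : MemLp L 2 (μ.map ζ))
    (hLU : ∀ h : Z → ℝ, Measurable h → (∃ C : ℝ, ∀ z, |h z| ≤ C) →
      ∫ z, h z * L z ∂μ.map ζ = ∑ i, ∫ ω, h (ζ ω) * U i ω ∂μ)
    {c : κ → ℝ} (hc : ∀ i, 0 ≤ c i)
    (hUc : ∀ i, ∀ h : Z → ℝ, Measurable h → (∃ C : ℝ, ∀ z, |h z| ≤ C) →
      (∫ ω, h (ζ ω) * U i ω ∂μ) ^ 2 ≤ c i * ∫ z, h z ^ 2 ∂μ.map ζ)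
    (horth : ∀ i j, i ≠ j →
      ∫ ω, (μ[U i | MeasurableSpace.comap ζ inferInstance]) ω *
        (μ[U j | MeasurableSpace.comap ζ inferInstance]) ω ∂μ = 0) :
    ∫ z, L z ^ 2 ∂μ.map ζ ≤ ∑ i, c i := by
  classical
  have : IsProbabilityMeasure (μ.map ζ) := Measure.isProbabilityMeasure_map hζ.aemeasurable
  have hm : MeasurableSpace.comap ζ inferInstance ≤ mΩ := hζ.comap_le
  -- Each projection, being measurable for the transcript, is a function of the transcript.
  have hex : ∀ i, ∃ e : Z → ℝ, Measurable e ∧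
      μ[U i | MeasurableSpace.comap ζ inferInstance] = e ∘ ζ := fun i => by
    obtain ⟨e, he, heq⟩ := (stronglyMeasurable_condExp (f := U i) (μ := μ)
      (m := MeasurableSpace.comap ζ inferInstance)).measurable.exists_eq_measurable_comp
    exact ⟨e, he, heq⟩
  choose e he hee using hex
  have heL : ∀ i, MemLp (e i) 2 (μ.map ζ) := fun i => by
    rw [memLp_map_measure_iff (he i).aestronglyMeasurable hζ.aemeasurable, ← hee i]
    exact (hU i).condExp one_le_two
  have hInt : ∀ i (h : Z → ℝ), Measurable h → (∃ C : ℝ, ∀ z, |h z| ≤ C) →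
      ∫ z, h z * e i z ∂μ.map ζ = ∫ ω, h (ζ ω) * U i ω ∂μ := fun i h hh ⟨C, hC⟩ => by
    rw [integral_map (f := fun z => h z * e i z) hζ.aemeasurable
      (hh.mul (he i)).aestronglyMeasurable]
    have h1 : ∀ ω, e i (ζ ω) = (μ[U i | MeasurableSpace.comap ζ inferInstance]) ω := fun ω => by
      rw [hee i, Function.comp_apply]
    simp only [h1]
    refine integral_mul_condExp hm (F := fun ω => h (ζ ω)) ?_ ?_ (hU i)
    · exact (hh.comp (comap_measurable ζ)).stronglyMeasurable
    · exact MemLp.of_bound (hh.comp hζ).aestronglyMeasurable C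
        (Filter.Eventually.of_forall fun ω => hC _)
  have hbd : ∀ {h : Z → ℝ}, Measurable h → (∃ C : ℝ, ∀ z, |h z| ≤ C) → MemLp h 2 (μ.map ζ) :=
    fun hh ⟨C, hC⟩ => MemLp.of_bound hh.aestronglyMeasurable C (Filter.Eventually.of_forall hC)
  have hsumL : MemLp (fun z => ∑ i, e i z) 2 (μ.map ζ) := memLp_finsetSum _ fun i _ => heL i
  -- `L` and the sum of the projections have the same correlation with every bounded statistic, so
  -- their difference satisfies the truncation bound with constant `0`.
  have hzero : ∫ z, (L z - ∑ i, e i z) ^ 2 ∂μ.map ζ = 0 := by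
    refine le_antisymm ?_ (integral_nonneg fun z => sq_nonneg _)
    refine (integral_sq_le_of_forall_bounded (c := 0) (hL.sub hsumL) fun h hh hb => ?_).trans
      (max_self (0 : ℝ)).le
    simp only [Pi.sub_apply, mul_sub]
    rw [integral_sub (by exact (hbd hh hb).integrable_mul hL)
      (by exact (hbd hh hb).integrable_mul hsumL), hLU h hh hb]
    simp only [Finset.mul_sum]
    rw [integral_finsetSum _ fun i _ => by exact (hbd hh hb).integrable_mul (heL i)]
    simp only [hInt _ h hh hb]
    simp
  have hae : ∀ᵐ z ∂μ.map ζ, L z = ∑ i, e i z := by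
    have := (integral_eq_zero_iff_of_nonneg (fun z => sq_nonneg _)
      (hL.sub hsumL).integrable_sq).mp hzero
    filter_upwards [this] with z hz
    exact sub_eq_zero.mp (pow_eq_zero_iff two_ne_zero |>.mp hz)
  have hcross : ∀ i j, i ≠ j → ∫ z, e i z * e j z ∂μ.map ζ = 0 := fun i j hij => by
    rw [integral_map (f := fun z => e i z * e j z) hζ.aemeasurable
      ((he i).mul (he j)).aestronglyMeasurable, ← horth i j hij]
    simp only [hee, Function.comp_apply]
  calc ∫ z, L z ^ 2 ∂μ.map ζ = ∫ z, ∑ i, ∑ j, e i z * e j z ∂μ.map ζ :=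
        integral_congr_ae (hae.mono fun z hz => by
          simp only [hz, sq, Finset.sum_mul_sum])
    _ = ∑ i, ∑ j, ∫ z, e i z * e j z ∂μ.map ζ := by
        rw [integral_finsetSum _ fun i _ => integrable_finsetSum _ fun j _ => by
          exact (heL i).integrable_mul (heL j)]
        exact Finset.sum_congr rfl fun i _ => integral_finsetSum _ fun j _ => by
          exact (heL i).integrable_mul (heL j)
    _ = ∑ i, ∫ z, e i z ^ 2 ∂μ.map ζ := Finset.sum_congr rfl fun i _ => by
        rw [Finset.sum_eq_single i (fun j _ hj => hcross i j hj.symm) (by simp)]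
        simp only [sq]
    _ ≤ ∑ i, c i := Finset.sum_le_sum fun i _ => by
        rw [← max_eq_left (hc i)]
        refine integral_sq_le_of_forall_bounded (heL i) fun h hh hb => ?_
        rw [hInt i h hh hb]
        exact hUc i h hh hb

end CondIndep

/-! ### Products of measures -/

section Products

variable {κ : Type*} [Fintype κ]

/-- Regroups all measurement noises and all privacy noises into independent pairs, one for each
index. The inverse regrouping is checked on rectangles. -/
theorem map_prod_pi_pi {α β : κ → Type*} [∀ i, MeasurableSpace (α i)] [∀ i, MeasurableSpace (β i)]
    (μ : ∀ i, Measure (α i)) (ν : ∀ i, Measure (β i)) [∀ i, IsProbabilityMeasure (μ i)]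
    [∀ i, IsProbabilityMeasure (ν i)] :
    ((Measure.pi μ).prod (Measure.pi ν)).map (fun x i => (x.1 i, x.2 i)) =
      Measure.pi fun i => (μ i).prod (ν i) := by
  have h : (Measure.pi fun i => (μ i).prod (ν i)).map
      (fun x => (fun i => (x i).1, fun i => (x i).2)) = (Measure.pi μ).prod (Measure.pi ν) := by
    refine (Measure.FiniteSpanningSetsIn.ext ?_ (isPiSystem_pi.prod isPiSystem_pi)
      ((Measure.FiniteSpanningSetsIn.pi fun i => (μ i).toFiniteSpanningSetsIn).prod
      (Measure.FiniteSpanningSetsIn.pi (fun i => (ν i).toFiniteSpanningSetsIn))) ?_).symm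
    · refine (generateFrom_eq_prod generateFrom_pi generateFrom_pi ?_ ?_).symm
      · exact (Measure.FiniteSpanningSetsIn.pi
          (fun i => (μ i).toFiniteSpanningSetsIn)).isCountablySpanning
      · exact (Measure.FiniteSpanningSetsIn.pi
          (fun i => (ν i).toFiniteSpanningSetsIn)).isCountablySpanning
    · rintro _ ⟨_, ⟨s, hs, rfl⟩, ⟨_, ⟨t, ht, rfl⟩, rfl⟩⟩
      have hs' : ∀ i, MeasurableSet (s i) := fun i => hs i (Set.mem_univ i)
      have ht' : ∀ i, MeasurableSet (t i) := fun i => ht i (Set.mem_univ i)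
      rw [Measure.map_apply (by fun_prop)
        ((MeasurableSet.univ_pi hs').prod (MeasurableSet.univ_pi ht'))]
      rw [show (fun x : ∀ i, α i × β i => ((fun i => (x i).1, fun i => (x i).2) :
          (∀ i, α i) × ∀ i, β i)) ⁻¹' (Set.univ.pi s ×ˢ Set.univ.pi t) =
          (Set.univ.pi fun i => s i ×ˢ t i) by
          ext; simp [Set.mem_pi, forall_and]]
      simp_rw [Measure.pi_pi, Measure.prod_prod, Measure.pi_pi, Finset.prod_mul_distrib]
  rw [← h, Measure.map_map (by fun_prop) (by fun_prop)]
  exact Measure.map_id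

theorem iIndepFun_prod_pi_pi {α β : κ → Type*} [∀ i, MeasurableSpace (α i)]
    [∀ i, MeasurableSpace (β i)]
    (μ : ∀ i, Measure (α i)) (ν : ∀ i, Measure (β i)) [∀ i, IsProbabilityMeasure (μ i)]
    [∀ i, IsProbabilityMeasure (ν i)] :
    iIndepFun (fun i (x : (∀ i, α i) × ∀ i, β i) => (x.1 i, x.2 i))
      ((Measure.pi μ).prod (Measure.pi ν)) := by
  rw [iIndepFun_iff_map_fun_eq_pi_map (fun i => by fun_prop), map_prod_pi_pi]
  congr 1
  funext i
  have : (fun x : (∀ i, α i) × ∀ i, β i => (x.1 i, x.2 i)) =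
      Prod.map (fun y : ∀ i, α i => y i) (fun y : ∀ i, β i => y i) := rfl
  rw [this, ← Measure.map_prod_map _ _ (by fun_prop) (by fun_prop),
    (measurePreserving_eval μ i).map_eq, (measurePreserving_eval ν i).map_eq]

/-- Resampling one coordinate preserves a product law. This permits integrating over one sensor with
the others fixed, without splitting the index set. -/
theorem map_update_prod_pi [DecidableEq κ] {α : κ → Type*} [∀ i, MeasurableSpace (α i)]
    (μ : ∀ i, Measure (α i)) [∀ i, IsProbabilityMeasure (μ i)] (i : κ) :
    ((Measure.pi μ).prod (μ i)).map (fun p => Function.update p.1 i p.2) = Measure.pi μ := by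
  symm
  refine Measure.pi_eq fun s hs => ?_
  have hm : Measurable fun p : (∀ j, α j) × α i => Function.update p.1 i p.2 := by
    refine measurable_pi_lambda _ fun j => ?_
    by_cases hj : j = i
    · subst hj
      simpa using measurable_snd
    · simp only [Function.update_of_ne hj]
      fun_prop
  rw [Measure.map_apply hm (MeasurableSet.univ_pi hs)]
  have hset : (fun p : (∀ j, α j) × α i => Function.update p.1 i p.2) ⁻¹' Set.univ.pi s =
      (Set.univ.pi (Function.update s i Set.univ)) ×ˢ s i := by
    ext p
    simp only [Set.mem_preimage, Set.mem_univ_pi, Set.mem_prod]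
    refine ⟨fun h => ⟨fun j => ?_, by simpa using h i⟩, fun h j => ?_⟩
    · by_cases hj : j = i
      · subst hj
        simp
      · simpa [Function.update_of_ne hj] using h j
    · by_cases hj : j = i
      · subst hj
        simpa using h.2
      · simpa [Function.update_of_ne hj] using h.1 j
  rw [hset, Measure.prod_prod, Measure.pi_pi, ← Finset.prod_erase_mul _ _ (Finset.mem_univ i),
    ← Finset.prod_erase_mul _ _ (Finset.mem_univ i)]
  simp only [Function.update_self, measure_univ, mul_one]
  congr 1
  exact Finset.prod_congr rfl fun j hj => by rw [Function.update_of_ne (Finset.ne_of_mem_erase hj)]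

theorem integral_pi_eq_integral_update [DecidableEq κ] {α : κ → Type*}
    [∀ i, MeasurableSpace (α i)] (μ : ∀ i, Measure (α i)) [∀ i, IsProbabilityMeasure (μ i)] (i : κ)
    {F : (∀ i, α i) → ℝ} (hF : Measurable F) (hFi : Integrable F (Measure.pi μ)) :
    ∫ y, F y ∂Measure.pi μ = ∫ y, ∫ x, F (Function.update y i x) ∂μ i ∂Measure.pi μ := by
  -- A map that is not almost everywhere measurable has image measure `0`, whereas this image is a
  -- probability measure.
  have hm : AEMeasurable (fun p : (∀ j, α j) × α i => Function.update p.1 i p.2)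
      ((Measure.pi μ).prod (μ i)) := AEMeasurable.of_map_ne_zero (by
    rw [map_update_prod_pi]
    exact IsProbabilityMeasure.ne_zero _)
  conv_lhs => rw [← map_update_prod_pi μ i]
  rw [integral_map hm hF.aestronglyMeasurable]
  refine integral_prod _ ?_
  rw [← map_update_prod_pi μ i] at hFi
  exact hFi.comp_aemeasurable hm

theorem pi_pi_map_pi {κ' : Type*} [Fintype κ'] {α β : κ → κ' → Type*}
    [∀ i k, MeasurableSpace (α i k)] [∀ i k, MeasurableSpace (β i k)]
    (μ : ∀ i k, Measure (α i k)) [∀ i k, IsProbabilityMeasure (μ i k)]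
    {g : ∀ i k, α i k → β i k} (hg : ∀ i k, Measurable (g i k)) :
    (Measure.pi fun i => Measure.pi fun k => μ i k).map (fun w i k => g i k (w i k)) =
      Measure.pi fun i => Measure.pi fun k => (μ i k).map (g i k) := by
  have : ∀ i k, IsProbabilityMeasure ((μ i k).map (g i k)) := fun i k =>
    Measure.isProbabilityMeasure_map (hg i k).aemeasurable
  have h1 : ∀ i, (Measure.pi fun k => μ i k).map (fun w k => g i k (w k)) =
      Measure.pi fun k => (μ i k).map (g i k) := fun i =>
    Measure.pi_map_pi fun k => (hg i k).aemeasurable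
  have : ∀ i, IsProbabilityMeasure ((Measure.pi fun k => μ i k).map
      (fun w k => g i k (w k))) := fun i => by
    rw [h1]
    infer_instance
  have hg' : ∀ i, Measurable fun (w : ∀ k, α i k) k => g i k (w k) := fun i => by fun_prop
  rw [Measure.pi_map_pi (f := fun i (w : ∀ k, α i k) k => g i k (w k))
    fun i => (hg' i).aemeasurable]
  simp only [h1]

end Products

/-! ### The measurements of one sensor -/

section User

variable {K m : ℕ}

/-- The matrix that selects the measurement at time `k`. -/
def selectTime (K m : ℕ) (k : Fin K) : Matrix (Fin m) (Fin m × Fin K) ℝ :=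
  Matrix.of fun a bl => if bl = (a, k) then 1 else 0

theorem selectTime_mulVec (k : Fin K) (x : Fin m × Fin K → ℝ) :
    selectTime K m k *ᵥ x = fun a => x (a, k) := by
  funext a
  simp [selectTime, Matrix.mulVec, dotProduct]

theorem dotProduct_selectTime_transpose (k : Fin K) (x : Fin m × Fin K → ℝ) (y : Fin m → ℝ) :
    x ⬝ᵥ (selectTime K m k)ᵀ *ᵥ y = (fun a => x (a, k)) ⬝ᵥ y := by
  rw [Matrix.dotProduct_mulVec, Matrix.vecMul_transpose, selectTime_mulVec]

theorem dotProduct_blockDiagonal_mulVec (S : Fin K → Matrix (Fin m) (Fin m) ℝ)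
    (x : Fin m × Fin K → ℝ) :
    x ⬝ᵥ Matrix.blockDiagonal S *ᵥ x =
      ∑ k, (fun a => x (a, k)) ⬝ᵥ S k *ᵥ fun a => x (a, k) := by
  simp only [dotProduct, Matrix.mulVec, Fintype.sum_prod_type, Matrix.blockDiagonal_apply]
  rw [Finset.sum_comm]
  refine Finset.sum_congr rfl fun k _ => Finset.sum_congr rfl fun a _ => ?_
  congr 1
  refine Finset.sum_congr rfl fun b _ => ?_
  simp

/-- The location family of the measurements of one sensor, listed as in
`UserPrivacyConstraint`. -/
theorem isGaussianShift_user (c : Fin K → Fin m → ℝ) {V : Fin K → Matrix (Fin m) (Fin m) ℝ}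
    (hV : ∀ k, (V k).PosDef) :
    IsGaussianShift (fun x : Fin m × Fin K → ℝ =>
        ((Measure.pi fun k => gaussianLaw (c k) (V k)).map
          (fun (y : Fin K → Fin m → ℝ) (ak : Fin m × Fin K) => y ak.2 ak.1)).map (fun y => x + y))
      (fun y => ∑ k, (selectTime K m k)ᵀ *ᵥ ((V k)⁻¹ *ᵥ ((fun a => y (a, k)) - c k)))
      (∑ k, (selectTime K m k)ᵀ * (V k)⁻¹ * selectTime K m k) := by
  have h := (IsGaussianShift.pi fun k =>
    (gaussianLaw_isGaussianShift_map (c k) (hV k)).comp_mulVec (selectTime K m k)).map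
    (e := fun (y : Fin K → Fin m → ℝ) (ak : Fin m × Fin K) => y ak.2 ak.1) (by fun_prop)
    (T' := fun y => ∑ k, (selectTime K m k)ᵀ *ᵥ ((V k)⁻¹ *ᵥ ((fun a => y (a, k)) - c k)))
    (by fun_prop) (fun z => rfl)
  convert! h using 1
  funext x
  have : ∀ k, IsProbabilityMeasure
      ((gaussianLaw (c k) (V k)).map (fun y => selectTime K m k *ᵥ x + y)) := fun k =>
    Measure.isProbabilityMeasure_map (by fun_prop)
  rw [← Measure.pi_map_pi (fun k => by fun_prop), Measure.map_map (by fun_prop) (by fun_prop),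
    Measure.map_map (by fun_prop) (by fun_prop)]
  congr 1
  funext y ak
  simp [selectTime_mulVec]

/-- The bound of `sq_integral_mul_score_le` for the measurements of one sensor. -/
theorem sq_integral_mul_user_score_le {Z : Type*} [MeasurableSpace Z] {p : Fin K → ℕ}
    {P : (Fin K → Fin m → ℝ) → Measure Z} [∀ y, IsProbabilityMeasure (P y)]
    (C : ∀ k, Matrix (Fin (p k)) (Fin m) ℝ)
    (hP : ∀ y : Fin K → Fin m → ℝ, ∃ J, HasFisherInfo
      (fun x : Fin m × Fin K → ℝ => P fun k a => x (a, k)) (fun ak => y ak.2 ak.1) J ∧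
      (Matrix.blockDiagonal (fun k => (C k)ᵀ * C k) - J).PosSemidef)
    (c : Fin K → Fin m → ℝ) {V : Fin K → Matrix (Fin m) (Fin m) ℝ} (hV : ∀ k, (V k).PosDef)
    {h : Z → ℝ} (hh : Measurable h) {R : ℝ} (hR : ∀ z, |h z| ≤ R)
    (hg : Measurable fun y => ∫ z, h z ∂P y) (hg2 : Measurable fun y => ∫ z, h z ^ 2 ∂P y)
    (x : Fin K → Fin m → ℝ) :
    (∫ y, (∫ z, h z ∂P y) * (∑ k, x k ⬝ᵥ (V k)⁻¹ *ᵥ (y k - c k))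
        ∂Measure.pi fun k => gaussianLaw (c k) (V k)) ^ 2 ≤
      (∑ k, x k ⬝ᵥ obfuscatedInfo (C k) (V k) *ᵥ x k) *
        ∫ y, ∫ z, h z ^ 2 ∂P y ∂Measure.pi fun k => gaussianLaw (c k) (V k) := by
  -- Both the privacy bound and the noise information are block diagonal in time, so the optimal
  -- splitting is made separately at each time.
  choose x₁ x₂ hx hq using fun k => exists_add_eq_obfuscatedInfo (C k) (hV k) (x k)
  have hγ := isGaussianShift_user c hV
  have huncurry : Measurable
      fun (y : Fin K → Fin m → ℝ) (ak : Fin m × Fin K) => y ak.2 ak.1 := by fun_prop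
  have : IsProbabilityMeasure ((Measure.pi fun k => gaussianLaw (c k) (V k)).map
      (fun (y : Fin K → Fin m → ℝ) (ak : Fin m × Fin K) => y ak.2 ak.1)) :=
    Measure.isProbabilityMeasure_map huncurry.aemeasurable
  have hcurry : Measurable fun (y : Fin m × Fin K → ℝ) (k : Fin K) (a : Fin m) => y (a, k) := by
    fun_prop
  have key := sq_integral_mul_score_le (P := fun x : Fin m × Fin K → ℝ => P fun k a => x (a, k))
    (fun y => hP fun k a => y (a, k)) hγ hh hR (hg2.comp hcurry)
    (fun ak => x₁ ak.2 ak.1) (fun ak => x₂ ak.2 ak.1)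
  have hmap : ∀ F : (Fin m × Fin K → ℝ) → ℝ, Measurable F →
      ∫ y, F y ∂(Measure.pi fun k => gaussianLaw (c k) (V k)).map
        (fun (y : Fin K → Fin m → ℝ) (ak : Fin m × Fin K) => y ak.2 ak.1) =
      ∫ y, F (fun ak => y ak.2 ak.1) ∂Measure.pi fun k => gaussianLaw (c k) (V k) := fun F hF =>
    integral_map huncurry.aemeasurable hF.aestronglyMeasurable
  rw [hmap, hmap] at key
  rotate_left
  · exact hg2.comp hcurry
  · exact (hg.comp hcurry).mul (hγ.measurable_dotProduct _)
  have hquad : (fun ak : Fin m × Fin K => x₁ ak.2 ak.1) ⬝ᵥ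
      Matrix.blockDiagonal (fun k => (C k)ᵀ * C k) *ᵥ (fun ak => x₁ ak.2 ak.1) +
      (fun ak : Fin m × Fin K => x₂ ak.2 ak.1) ⬝ᵥ
      (∑ k, (selectTime K m k)ᵀ * (V k)⁻¹ * selectTime K m k) *ᵥ (fun ak => x₂ ak.2 ak.1) =
      ∑ k, x k ⬝ᵥ obfuscatedInfo (C k) (V k) *ᵥ x k := by
    rw [dotProduct_blockDiagonal_mulVec, Matrix.sum_mulVec, dotProduct_sum,
      ← Finset.sum_add_distrib]
    refine Finset.sum_congr rfl fun k _ => ?_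
    rw [Matrix.mul_assoc, ← Matrix.mulVec_mulVec _ (selectTime K m k)ᵀ,
      dotProduct_selectTime_transpose, ← Matrix.mulVec_mulVec _ (V k)⁻¹, selectTime_mulVec]
    exact hq k
  rw [hquad] at key
  have hlin : ∀ y : Fin K → Fin m → ℝ, ((fun ak : Fin m × Fin K => x₁ ak.2 ak.1) +
      fun ak => x₂ ak.2 ak.1) ⬝ᵥ (∑ k, (selectTime K m k)ᵀ *ᵥ ((V k)⁻¹ *ᵥ
        ((fun a => y k a) - c k))) = ∑ k, x k ⬝ᵥ (V k)⁻¹ *ᵥ (y k - c k) := fun y => by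
    rw [dotProduct_sum]
    refine Finset.sum_congr rfl fun k _ => ?_
    rw [dotProduct_selectTime_transpose, ← hx k]
    rfl
  simp only [hlin] at key
  exact key

end User

/-! ### The upper bound for the whole system -/

section Multi

variable {N K m n : ℕ} {q r : Fin N → Fin K → ℕ}

theorem measurable_recOutput {M : RecMechanism N K m q r} (hM : ∀ i k, Measurable (M i k))
    (k : Fin K) (i : Fin N) :
    Measurable fun x : (Fin N → Fin K → Fin m → ℝ) × (∀ i k, Fin (q i k) → ℝ) =>
      recOutput M x.1 x.2 k i := by
  induction k using WellFoundedLT.induction generalizing i with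
  | ind k ih =>
    have h : (fun x : (Fin N → Fin K → Fin m → ℝ) × (∀ i k, Fin (q i k) → ℝ) =>
        recOutput M x.1 x.2 k i) = fun x => M i k (fun t => x.1 i t, fun t => x.2 i t,
          fun j t => recOutput M x.1 x.2 t.1 j) := by
      funext x
      rw [recOutput]
    rw [h]
    refine (hM i k).comp (Measurable.prodMk (by fun_prop) (Measurable.prodMk (by fun_prop) ?_))
    exact measurable_pi_lambda _ fun j => measurable_pi_lambda _ fun t => ih t.1 t.2 j

theorem measurable_collective {M : RecMechanism N K m q r} (hM : ∀ i k, Measurable (M i k)) :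
    Measurable fun x : (Fin N → Fin K → Fin m → ℝ) × (∀ i k, Fin (q i k) → ℝ) =>
      collective M x.1 x.2 :=
  measurable_pi_lambda _ fun i => measurable_pi_lambda _ fun k => measurable_recOutput hM k i

/-- Identifies conditioning on the collective output with conditioning on the transcript of the
protocol. -/
theorem comap_collective_eq_iSup {Ω : Type*} (M : RecMechanism N K m q r)
    (Y : Ω → Fin N → Fin K → Fin m → ℝ) (D : Ω → ∀ i k, Fin (q i k) → ℝ) :
    MeasurableSpace.comap (fun ω => collective M (Y ω) (D ω)) inferInstance =
      ⨆ k, ⨆ j, MeasurableSpace.comap (fun ω => recOutput M (Y ω) (D ω) k j) inferInstance := by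
  change MeasurableSpace.comap _ MeasurableSpace.pi = _
  simp only [MeasurableSpace.pi, MeasurableSpace.comap_iSup, MeasurableSpace.comap_comp]
  rw [iSup_comm]
  rfl

/-- The location family of all measurements. -/
theorem isGaussianShift_jointNoise (H : Fin N → Fin K → Matrix (Fin m) (Fin n) ℝ)
    (μ : Fin N → Fin K → Fin m → ℝ) {V : Fin N → Fin K → Matrix (Fin m) (Fin m) ℝ}
    (hV : ∀ i k, (V i k).PosDef) :
    IsGaussianShift (fun θ => (jointNoise fun i k => gaussianLaw (μ i k) (V i k)).map
        (fun w => (fun i k => H i k *ᵥ θ) + w))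
      (fun y => ∑ i, ∑ k, (H i k)ᵀ *ᵥ ((V i k)⁻¹ *ᵥ (y i k - μ i k)))
      (∑ i, ∑ k, (H i k)ᵀ * (V i k)⁻¹ * H i k) := by
  have h := IsGaussianShift.pi fun i => IsGaussianShift.pi fun k =>
    (gaussianLaw_isGaussianShift_map (μ i k) (hV i k)).comp_mulVec (H i k)
  convert! h using 1
  funext θ
  exact pi_pi_map_pi (fun i k => gaussianLaw (μ i k) (V i k))
    (g := fun i k w => H i k *ᵥ θ + w) fun i k => by fun_prop

theorem jointNoise_map_add (c μ : Fin N → Fin K → Fin m → ℝ)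
    {V : Fin N → Fin K → Matrix (Fin m) (Fin m) ℝ} (hV : ∀ i k, (V i k).PosSemidef) :
    (jointNoise fun i k => gaussianLaw (μ i k) (V i k)).map (fun w => c + w) =
      Measure.pi fun i => Measure.pi fun k => gaussianLaw (μ i k + c i k) (V i k) := by
  have := pi_pi_map_pi (fun i k => gaussianLaw (μ i k) (V i k))
    (g := fun i k w => c i k + w) fun i k => by fun_prop
  simp only [gaussianLaw_map_add _ _ (hV _ _)] at this
  exact this

theorem memLp_user_score (H : Fin K → Matrix (Fin m) (Fin n) ℝ) (μ : Fin K → Fin m → ℝ)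
    {V : Fin K → Matrix (Fin m) (Fin m) ℝ} (hV : ∀ k, (V k).PosDef) (v : Fin n → ℝ) :
    MemLp (fun w : Fin K → Fin m → ℝ => ∑ k, (H k *ᵥ v) ⬝ᵥ (V k)⁻¹ *ᵥ (w k - μ k)) 2
        (Measure.pi fun k => gaussianLaw (μ k) (V k)) ∧
      ∫ w : Fin K → Fin m → ℝ, ∑ k, (H k *ᵥ v) ⬝ᵥ (V k)⁻¹ *ᵥ (w k - μ k)
        ∂(Measure.pi fun k => gaussianLaw (μ k) (V k)) = 0 := by
  have h := IsGaussianShift.pi fun k =>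
    (gaussianLaw_isGaussianShift_map (μ k) (hV k)).comp_mulVec (H k)
  have hb : ∀ w : Fin K → Fin m → ℝ, v ⬝ᵥ (∑ k, (H k)ᵀ *ᵥ ((V k)⁻¹ *ᵥ (w k - μ k))) =
      ∑ k, (H k *ᵥ v) ⬝ᵥ (V k)⁻¹ *ᵥ (w k - μ k) := fun w => by
    rw [dotProduct_sum]
    refine Finset.sum_congr rfl fun k _ => ?_
    rw [Matrix.dotProduct_mulVec, Matrix.vecMul_transpose]
  have h1 := h.memLp_dotProduct 0 v
  have := h.prob
  have h2 := (h.diffUnderIntegral 0).integral_score_eq_zero (h.memLp_score 0) v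
  simp only [Matrix.mulVec_zero, sub_zero, zero_add, Measure.map_id', hb] at h1 h2
  exact ⟨h1, h2⟩

/-- The correlation of a statistic of the outputs with the score of one sensor's measurements. -/
theorem sq_integral_mul_sensor_score_le {p : Fin N → Fin K → ℕ}
    {M : RecMechanism N K m q r} {f : ∀ i k, (Fin (q i k) → ℝ) → ℝ}
    (hM : ∀ i k, Measurable (M i k)) [IsProbabilityMeasure (jointPrivacyNoise f)]
    (C : ∀ i k, Matrix (Fin (p i k)) (Fin m) ℝ)
    (hpriv : UserPrivacyConstraint (fun i k => (C i k)ᵀ * C i k) M f)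
    (c : Fin N → Fin K → Fin m → ℝ) {V : Fin N → Fin K → Matrix (Fin m) (Fin m) ℝ}
    (hV : ∀ i k, (V i k).PosDef) {h : (∀ i k, Fin (r i k) → ℝ) → ℝ} (hh : Measurable h) {R : ℝ}
    (hR : ∀ z, |h z| ≤ R) (i : Fin N) (x : Fin K → Fin m → ℝ)
    (hu : Integrable (fun w : Fin K → Fin m → ℝ => ∑ k, x k ⬝ᵥ (V i k)⁻¹ *ᵥ (w k - c i k))
      (Measure.pi fun k => gaussianLaw (c i k) (V i k))) :
    (∫ y, (∫ z, h z ∂lawGivenY (collective M) (jointPrivacyNoise f) y) *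
        (∑ k, x k ⬝ᵥ (V i k)⁻¹ *ᵥ (y i k - c i k))
        ∂Measure.pi fun i => Measure.pi fun k => gaussianLaw (c i k) (V i k)) ^ 2 ≤
      (∑ k, x k ⬝ᵥ obfuscatedInfo (C i k) (V i k) *ᵥ x k) *
        ∫ y, ∫ z, h z ^ 2 ∂lawGivenY (collective M) (jointPrivacyNoise f) y
          ∂Measure.pi fun i => Measure.pi fun k => gaussianLaw (c i k) (V i k) := by
  have hMc := measurable_collective hM
  have hprob := isProbabilityMeasure_lawGivenY (μd := jointPrivacyNoise f) hMc
  have hh2 : Measurable fun z => h z ^ 2 := hh.pow_const 2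
  have hR2 : ∀ z, |h z ^ 2| ≤ R ^ 2 := fun z => by
    rw [abs_pow]
    exact pow_le_pow_left₀ (abs_nonneg _) (hR z) 2
  set γ : ∀ i : Fin N, Measure (Fin K → Fin m → ℝ) :=
    fun i => Measure.pi fun k => gaussianLaw (c i k) (V i k) with hγ
  set a : ℝ := ∑ k, x k ⬝ᵥ obfuscatedInfo (C i k) (V i k) *ᵥ x k with ha
  set g := fun y => ∫ z, h z ∂lawGivenY (collective M) (jointPrivacyNoise f) y with hg
  set g2 := fun y => ∫ z, h z ^ 2 ∂lawGivenY (collective M) (jointPrivacyNoise f) y with hg2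
  have hgm : Measurable g := measurable_integral_lawGivenY hMc hh
  have hg2m : Measurable g2 := measurable_integral_lawGivenY hMc hh2
  have hgR : ∀ y, |g y| ≤ R := abs_integral_lawGivenY_le hMc hR
  have hg2R : ∀ y, |g2 y| ≤ R ^ 2 := abs_integral_lawGivenY_le hMc hR2
  set u : (Fin K → Fin m → ℝ) → ℝ := fun w => ∑ k, x k ⬝ᵥ (V i k)⁻¹ *ᵥ (w k - c i k) with hudef
  have hum : Measurable u := by
    simp only [hudef, dotProduct]
    fun_prop
  have ha0 : 0 ≤ a := Finset.sum_nonneg fun k _ => by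
    simpa using (obfuscatedInfo_posSemidef (C i k) (hV i k).posSemidef).dotProduct_mulVec_nonneg (x k)
  have hupd : ∀ y : Fin N → Fin K → Fin m → ℝ,
      Measurable fun w : Fin K → Fin m → ℝ => Function.update y i w := fun y =>
    measurable_update y
  -- With the other sensors frozen at `y`, the user-level constraint is the hypothesis of the bound
  -- for one sensor; averaging over `y` then needs only Cauchy–Schwarz.
  have hinner : ∀ y : Fin N → Fin K → Fin m → ℝ,
      (∫ w, g (Function.update y i w) * u w ∂γ i) ^ 2 ≤
        a * ∫ w, g2 (Function.update y i w) ∂γ i := fun y => by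
    refine sq_integral_mul_user_score_le
      (P := fun w => lawGivenY (collective M) (jointPrivacyNoise f) (Function.update y i w))
      (C i) (fun w => ?_) (c i) (hV i) hh hR (hgm.comp (hupd y)) (hg2m.comp (hupd y)) x
    have := hpriv (Function.update y i w) i
    simpa only [Function.update_idem, Function.update_self] using this
  have hupd2 : Measurable fun p : (Fin N → Fin K → Fin m → ℝ) × (Fin K → Fin m → ℝ) =>
      Function.update p.1 i p.2 := by
    refine measurable_pi_lambda _ fun j => ?_
    by_cases hj : j = i
    · subst hj
      simpa using measurable_snd
    · simp only [Function.update_of_ne hj]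
      fun_prop
  have hbig : Integrable (fun y => g y * u (y i)) (Measure.pi γ) := by
    have h1 : Integrable (fun y : Fin N → Fin K → Fin m → ℝ => u (y i)) (Measure.pi γ) :=
      integrable_comp_eval hu
    exact h1.bdd_mul (c := R) hgm.aestronglyMeasurable (Filter.Eventually.of_forall hgR)
  have hg2i : Integrable g2 (Measure.pi γ) := Integrable.of_bound hg2m.aestronglyMeasurable (R ^ 2)
    (Filter.Eventually.of_forall hg2R)
  rw [integral_pi_eq_integral_update γ i (F := fun y => g y * u (y i))
      (hgm.mul (hum.comp (measurable_pi_apply i))) hbig,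
    integral_pi_eq_integral_update γ i hg2m hg2i]
  simp only [Function.update_self]
  have hAm : Measurable fun y => ∫ w, g (Function.update y i w) * u w ∂γ i :=
    (((hgm.comp hupd2).mul (hum.comp measurable_snd)).stronglyMeasurable.integral_prod_right'
      (ν := γ i)).measurable
  have hBm : Measurable fun y => ∫ w, g2 (Function.update y i w) ∂γ i :=
    ((hg2m.comp hupd2).stronglyMeasurable.integral_prod_right' (ν := γ i)).measurable
  have hBb : ∀ y, |∫ w, g2 (Function.update y i w) ∂γ i| ≤ R ^ 2 := fun y => by
    simpa using norm_integral_le_of_norm_le_const (μ := γ i)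
      (f := fun w => g2 (Function.update y i w)) (Filter.Eventually.of_forall fun w => hg2R _)
  have hBi : Integrable (fun y => ∫ w, g2 (Function.update y i w) ∂γ i) (Measure.pi γ) :=
    Integrable.of_bound hBm.aestronglyMeasurable (R ^ 2) (Filter.Eventually.of_forall hBb)
  have hAL : MemLp (fun y => ∫ w, g (Function.update y i w) * u w ∂γ i) 2 (Measure.pi γ) := by
    refine MemLp.of_bound hAm.aestronglyMeasurable (Real.sqrt (a * R ^ 2))
      (Filter.Eventually.of_forall fun y => Real.le_sqrt_of_sq_le ?_)
    rw [Real.norm_eq_abs, sq_abs]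
    exact (hinner y).trans (mul_le_mul_of_nonneg_left ((le_abs_self _).trans (hBb y)) ha0)
  have h1 := sq_integral_mul_le hAL (memLp_const (μ := Measure.pi γ) (p := 2) (1 : ℝ))
  simp only [mul_one, one_pow, integral_const, probReal_univ, smul_eq_mul] at h1
  refine h1.trans ?_
  rw [← integral_const_mul]
  exact integral_mono hAL.integrable_sq (hBi.const_mul _) hinner

/-- The upper bound for the Fisher information of the outputs of the whole system. -/
theorem multi_fisher_le {H : Fin N → Fin K → Matrix (Fin m) (Fin n) ℝ}
    {μ : Fin N → Fin K → Fin m → ℝ} {V : Fin N → Fin K → Matrix (Fin m) (Fin m) ℝ}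
    (hV : ∀ i k, (V i k).PosDef) {p : Fin N → Fin K → ℕ}
    (C : ∀ i k, Matrix (Fin (p i k)) (Fin m) ℝ)
    {M : RecMechanism N K m q r} {f : ∀ i k, (Fin (q i k) → ℝ) → ℝ}
    (hM : ∀ i k, Measurable (M i k)) (hf : ∀ i k, IsPC1Density (f i k))
    (hpriv : UserPrivacyConstraint (fun i k => (C i k)ᵀ * C i k) M f) {θ : Fin n → ℝ}
    {J : Matrix (Fin n) (Fin n) ℝ}
    (hJ : HasFisherInfo (outputLaw (fun θ' i k => H i k *ᵥ θ')
      (jointNoise fun i k => gaussianLaw (μ i k) (V i k)) (collective M)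
      (jointPrivacyNoise f)) θ J) (v : Fin n → ℝ) :
    v ⬝ᵥ J *ᵥ v ≤ ∑ i, ∑ k, (H i k *ᵥ v) ⬝ᵥ obfuscatedInfo (C i k) (V i k) *ᵥ (H i k *ᵥ v) := by
  have hMc := measurable_collective hM
  have hfp : ∀ i k, IsProbabilityMeasure (densityLaw (f i k)) := fun i k =>
    (hf i k).isProbabilityMeasure
  have hμd : IsProbabilityMeasure (jointPrivacyNoise f) := by
    unfold jointPrivacyNoise
    infer_instance
  set μw := jointNoise fun i k => gaussianLaw (μ i k) (V i k) with hμw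
  have hμwp : IsProbabilityMeasure μw := by
    rw [hμw, jointNoise]
    infer_instance
  obtain ⟨ℓ, -, hD, hL, hJe⟩ := hJ
  set c : Fin N → Fin K → Fin m → ℝ := fun i k => H i k *ᵥ θ with hc
  set ζ : (Fin N → Fin K → Fin m → ℝ) × (∀ i k, Fin (q i k) → ℝ) → ∀ i k, Fin (r i k) → ℝ :=
    fun x => collective M (c + x.1) x.2 with hζdef
  have hζ : Measurable ζ :=
    hMc.comp (f := fun x : (Fin N → Fin K → Fin m → ℝ) × (∀ i k, Fin (q i k) → ℝ) =>
      (c + x.1, x.2)) (by fun_prop)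
  have hlaw : outputLaw (fun θ' i k => H i k *ᵥ θ') μw (collective M) (jointPrivacyNoise f) θ =
      (μw.prod (jointPrivacyNoise f)).map ζ := rfl
  let u : Fin N → (Fin K → Fin m → ℝ) → ℝ := fun i w =>
    ∑ k, (H i k *ᵥ v) ⬝ᵥ (V i k)⁻¹ *ᵥ (w k - μ i k)
  -- `u` is the sensor score as a function of the noise, `u'` the same score as a function of the
  -- measurement `y = c + w`.
  let u' : Fin N → (Fin K → Fin m → ℝ) → ℝ := fun i w =>
    ∑ k, (H i k *ᵥ v) ⬝ᵥ (V i k)⁻¹ *ᵥ (w k - (μ i k + c i k))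
  have huu' : ∀ i (w : Fin K → Fin m → ℝ), u' i (c i + w) = u i w := fun i w => by
    refine Finset.sum_congr rfl fun k _ => ?_
    rw [Pi.add_apply, add_comm (μ i k), add_sub_add_left_eq_sub]
  have hum : ∀ i, Measurable (u i) := fun i => by
    simp only [u, dotProduct]
    fun_prop
  have hum' : ∀ i, Measurable (u' i) := fun i => by
    simp only [u', dotProduct]
    fun_prop
  have huL : ∀ i, MemLp (u i) 2 (Measure.pi fun k => gaussianLaw (μ i k) (V i k)) := fun i =>
    (memLp_user_score (H i) (μ i) (hV i) v).1
  have hu0 : ∀ i, ∫ w, u i w ∂(Measure.pi fun k => gaussianLaw (μ i k) (V i k)) = 0 := fun i =>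
    (memLp_user_score (H i) (μ i) (hV i) v).2
  have huwL : ∀ i, MemLp (fun w : Fin N → Fin K → Fin m → ℝ => u i (w i)) 2 μw := fun i =>
    (huL i).comp_measurePreserving
      (measurePreserving_eval (fun i => Measure.pi fun k => gaussianLaw (μ i k) (V i k)) i)
  let U : Fin N → (Fin N → Fin K → Fin m → ℝ) × (∀ i k, Fin (q i k) → ℝ) → ℝ := fun i x =>
    u i (x.1 i)
  have hUL : ∀ i, MemLp (U i) 2 (μw.prod (jointPrivacyNoise f)) := fun i =>
    (huwL i).comp_measurePreserving measurePreserving_fst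
  have hU0 : ∀ i, ∫ x, U i x ∂μw.prod (jointPrivacyNoise f) = 0 := fun i => by
    have hp := (measurePreserving_eval
      (fun i => Measure.pi fun k => gaussianLaw (μ i k) (V i k)) i).comp
      (measurePreserving_fst (μ := μw) (ν := jointPrivacyNoise f))
    rw [← hu0 i, ← hp.map_eq, integral_map hp.aemeasurable (hum i).aestronglyMeasurable]
    rfl
  have hprivate : ∀ (i : Fin N) (h : (∀ i k, Fin (r i k) → ℝ) → ℝ), Measurable h →
      (∃ R : ℝ, ∀ z, |h z| ≤ R) →
      ∫ x, h (ζ x) * U i x ∂μw.prod (jointPrivacyNoise f) =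
        ∫ y, (∫ z, h z ∂lawGivenY (collective M) (jointPrivacyNoise f) y) * u' i (y i)
          ∂μw.map (fun w => c + w) := fun i h hh ⟨R, hR⟩ => by
    rw [integral_mul_lawGivenY hMc μw c hh hR (u := fun y => u' i (y i))
      ((hum' i).comp (measurable_pi_apply i))]
    · simp only [Pi.add_apply, huu', U, ζ]
    · simp only [Pi.add_apply, huu']
      exact (huwL i).integrable one_le_two
  have hΓ := isGaussianShift_jointNoise H μ hV
  have hmapc := jointNoise_map_add c μ fun i k => (hV i k).posSemidef
  rw [quadratic_eq_integral_sq hL hJe, hlaw]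
  refine integral_sq_le_sum_of_uncorrelated hζ hUL (memLp_dotProduct_score hL v) ?_ ?_ ?_ ?_
  · intro h hh ⟨R, hR⟩
    rw [← hlaw, integral_mul_score_outputLaw hMc hΓ hD hL hh hR v]
    simp only [hprivate _ h hh ⟨R, hR⟩]
    rw [← integral_finsetSum]
    · congr 1
      funext y
      rw [← Finset.mul_sum]
      congr 1
      rw [dotProduct_sub, dotProduct_sum, Matrix.sum_mulVec, dotProduct_sum,
        ← Finset.sum_sub_distrib]
      refine Finset.sum_congr rfl fun i _ => ?_
      rw [dotProduct_sum, Matrix.sum_mulVec, dotProduct_sum, ← Finset.sum_sub_distrib]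
      refine Finset.sum_congr rfl fun k _ => ?_
      rw [Matrix.mul_assoc, ← Matrix.mulVec_mulVec, ← Matrix.mulVec_mulVec, ← dotProduct_sub,
        ← Matrix.mulVec_sub, ← Matrix.mulVec_sub, Matrix.dotProduct_mulVec,
        Matrix.vecMul_transpose, sub_sub]
    · intro i _
      have hi : Integrable (fun y : Fin N → Fin K → Fin m → ℝ => u' i (y i))
          (μw.map fun w => c + w) := by
        refine (integrable_map_measure (g := fun y : Fin N → Fin K → Fin m → ℝ => u' i (y i))
          ((hum' i).comp (measurable_pi_apply i)).aestronglyMeasurable (by fun_prop)).2 ?_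
        simpa only [Function.comp_def, Pi.add_apply, huu'] using (huwL i).integrable one_le_two
      exact hi.bdd_mul (c := R) (measurable_integral_lawGivenY hMc hh).aestronglyMeasurable
        (Filter.Eventually.of_forall (abs_integral_lawGivenY_le hMc hR))
  · exact fun i => Finset.sum_nonneg fun k _ => by
      simpa using (obfuscatedInfo_posSemidef (C i k)
        (hV i k).posSemidef).dotProduct_mulVec_nonneg (H i k *ᵥ v)
  · intro i h hh ⟨R, hR⟩
    rw [hprivate i h hh ⟨R, hR⟩, ← hlaw, integral_outputLaw hMc _ _ θ (hh.pow_const 2)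
      (C := R ^ 2) (fun z => by
        rw [abs_pow]
        exact pow_le_pow_left₀ (abs_nonneg _) (hR z) 2)]
    change _ ≤ _ * ∫ y, _ ∂μw.map (fun w => c + w)
    rw [hmapc]
    refine sq_integral_mul_sensor_score_le hM C hpriv (fun i k => μ i k + c i k) hV hh hR i
      (fun k => H i k *ᵥ v) ?_
    exact (memLp_user_score (H i) (fun k => μ i k + c i k) (hV i) v).1.integrable one_le_two
  · intro i j hij
    -- The private input of a sensor is its whole noise record: measurement noise together with
    -- privacy noise.
    let X : ∀ i : Fin N, (Fin N → Fin K → Fin m → ℝ) × (∀ i k, Fin (q i k) → ℝ) →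
      (Fin K → Fin m → ℝ) × (∀ k, Fin (q i k) → ℝ) := fun i x => (x.1 i, x.2 i)
    have hX : ∀ i, Measurable (X i) := fun i => by fun_prop
    have hind : iIndepFun X (μw.prod (jointPrivacyNoise f)) := iIndepFun_prod_pi_pi _ _
    have hci := condIrrelevant_transcript hX hind
      (Z := fun k i x => recOutput M (c + x.1) x.2 k i)
      (φ := fun i k xz => M i k (fun t => c i t + xz.1.1 t, fun t => xz.1.2 t, xz.2))
      (fun i k => (hM i k).comp (by fun_prop))
      (fun k i x => by
        rw [recOutput]
        rfl) i
    rw [← comap_collective_eq_iSup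
      (Ω := (Fin N → Fin K → Fin m → ℝ) × (∀ i k, Fin (q i k) → ℝ)) M
      (fun x => c + x.1) (fun x => x.2)] at hci
    refine integral_condExp_mul_condExp_eq_zero (hX i).comap_le
      (iSup₂_le fun j _ => (hX j).comap_le) hζ.comap_le hci ?_ ?_ (hUL i) (hUL j) ?_
    · exact (((hum i).comp measurable_fst).comp (comap_measurable (X i))).stronglyMeasurable
    · have hle : MeasurableSpace.comap (X j) inferInstance ≤
          ⨆ l ∈ ({i}ᶜ : Set (Fin N)), MeasurableSpace.comap (X l) inferInstance :=
        le_iSup₂ (f := fun l (_ : l ∈ ({i}ᶜ : Set (Fin N))) =>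
          MeasurableSpace.comap (X l) inferInstance) j (by simpa using hij.symm)
      exact (((hum j).comp measurable_fst).comp
        (comap_measurable (X j))).stronglyMeasurable.mono hle
    -- Before conditioning, the sensor scores are uncorrelated because they are independent and
    -- centred.
    · have hUind : IndepFun (U i) (U j) (μw.prod (jointPrivacyNoise f)) :=
        (hind.indepFun hij).comp ((hum i).comp measurable_fst) ((hum j).comp measurable_fst)
      have := hUind.integral_mul_eq_mul_integral (hUL i).1 (hUL j).1
      rw [hU0, zero_mul] at this
      exact this

end Multi

/-! ### Additive Gaussian obfuscation -/

theorem IsGaussianShift.integral_score_apply {ι Z : Type*} [Fintype ι] [DecidableEq ι]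
    [MeasurableSpace Z] {P : (ι → ℝ) → Measure Z} {T : Z → ι → ℝ} {Q : Matrix ι ι ℝ}
    (h : IsGaussianShift P T Q) (x : ι → ℝ) (a : ι) : ∫ z, (T z - Q *ᵥ x) a ∂P x = 0 := by
  have := h.prob
  simpa using (h.diffUnderIntegral x).integral_score_eq_zero (h.memLp_score x) (Pi.single a 1)

/-- If the score given `d` depends on `w` only and the score given `w` depends on `d` only, then
the two scores are orthogonal. -/
theorem scoresOrthogonal_of_isGaussianShift {n : ℕ} {Y D Z : Type*} [Add Y] [MeasurableSpace Y]
    [MeasurableSpace D] [MeasurableSpace Z] {h : (Fin n → ℝ) → Y} {μw : Measure Y}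
    [IsProbabilityMeasure μw] {M : Y → D → Z} {μd : Measure D} [IsProbabilityMeasure μd]
    (hMw : ∀ θ d, Measurable fun w => M (h θ + w) d)
    (hMd : ∀ θ w, Measurable fun d => M (h θ + w) d)
    {TD : D → Z → Fin n → ℝ} {QD : Matrix (Fin n) (Fin n) ℝ}
    (hD : ∀ d, IsGaussianShift (lawGivenD h μw M d) (TD d) QD)
    {TW : Y → Z → Fin n → ℝ} {QW : Matrix (Fin n) (Fin n) ℝ}
    (hW : ∀ w, IsGaussianShift (lawGivenW h M μd w) (TW w) QW)
    {gD : Y → Fin n → ℝ} (hgD : ∀ θ w d, TD d (M (h θ + w) d) - QD *ᵥ θ = gD w)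
    {gW : D → Fin n → ℝ} (hgW : ∀ θ w d, TW w (M (h θ + w) d) - QW *ᵥ θ = gW d) :
    ScoresOrthogonal h μw M μd := by
  intro θ
  -- As `gD` does not depend on `d`, nor `gW` on `w`, one fixed value of the other noise suffices to
  -- read off integrability, and the zero mean of `gD`, from the conditional score.
  obtain ⟨w₀⟩ := nonempty_of_isProbabilityMeasure μw
  obtain ⟨d₀⟩ := nonempty_of_isProbabilityMeasure μd
  have hDm : ∀ a, Measurable fun z => (TD d₀ z - QD *ᵥ θ) a := fun a =>
    (measurable_pi_apply a).comp ((hD d₀).meas.sub_const _)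
  have hWm : ∀ a, Measurable fun z => (TW w₀ z - QW *ᵥ θ) a := fun a =>
    (measurable_pi_apply a).comp ((hW w₀).meas.sub_const _)
  have hDi : ∀ a, Integrable (fun w => gD w a) μw := fun a => by
    have := (hD d₀).prob θ
    have := ((hD d₀).memLp_score θ a).integrable one_le_two
    rw [lawGivenD, integrable_map_measure (hDm a).aestronglyMeasurable
      (hMw θ d₀).aemeasurable] at this
    simpa only [Function.comp_def, hgD] using this
  have hWi : ∀ a, Integrable (fun d => gW d a) μd := fun a => by
    have := (hW w₀).prob θ
    have := ((hW w₀).memLp_score θ a).integrable one_le_two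
    rw [lawGivenW, integrable_map_measure (hWm a).aestronglyMeasurable
      (hMd θ w₀).aemeasurable] at this
    simpa only [Function.comp_def, hgW] using this
  have hD0 : ∀ a, ∫ w, gD w a ∂μw = 0 := fun a => by
    have := (hD d₀).integral_score_apply θ a
    rw [lawGivenD, integral_map (hMw θ d₀).aemeasurable (hDm a).aestronglyMeasurable] at this
    simpa only [hgD] using this
  refine ⟨fun d z => TD d z - QD *ᵥ θ, fun w z => TW w z - QW *ᵥ θ,
    Filter.Eventually.of_forall fun d => (hD d).isScore θ,
    Filter.Eventually.of_forall fun w => (hW w).isScore θ, fun a b => ?_⟩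
  simp only [hgD, hgW]
  refine ⟨(hDi a).mul_prod (hWi b), ?_⟩
  rw [integral_prod_mul (fun w => gD w a) (fun d => gW d b), hD0, zero_mul]

section Additive

variable {m n p : ℕ} (H : Matrix (Fin m) (Fin n) ℝ) (C : Matrix (Fin p) (Fin m) ℝ)
  (μ : Fin m → ℝ) {V : Matrix (Fin m) (Fin m) ℝ}

theorem isGaussianShift_additive_givenY :
    IsGaussianShift (fun y => (densityLaw (stdDensity p)).map (fun d => C *ᵥ y + d))
      (fun z => Cᵀ *ᵥ z) (Cᵀ * C) := by
  rw [densityLaw_stdDensity]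
  simpa using (gaussianLaw_isGaussianShift_map (0 : Fin p → ℝ) Matrix.PosDef.one).comp_mulVec C

theorem isGaussianShift_additive_givenW (w : Fin m → ℝ) :
    IsGaussianShift (fun θ => (densityLaw (stdDensity p)).map (fun d => C *ᵥ (H *ᵥ θ + w) + d))
      (fun z => (C * H)ᵀ *ᵥ (z - C *ᵥ w)) ((C * H)ᵀ * (C * H)) := by
  have h := (gaussianLaw_shift (C *ᵥ w) Matrix.PosDef.one).comp_mulVec (C * H)
  rw [inv_one, Matrix.mul_one] at h
  simp only [Matrix.one_mulVec] at h
  convert! h using 1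
  funext θ
  rw [densityLaw_stdDensity, gaussianLaw_map_add _ _ Matrix.PosSemidef.one, zero_add,
    Matrix.mulVec_add, Matrix.mulVec_mulVec, add_comm]

theorem isGaussianShift_additive_givenD (hV : V.PosSemidef) (hCV : (C * V * Cᵀ).PosDef)
    (d : Fin p → ℝ) :
    IsGaussianShift (fun θ => (gaussianLaw μ V).map (fun w => C *ᵥ (H *ᵥ θ + w) + d))
      (fun z => (C * H)ᵀ *ᵥ ((C * V * Cᵀ)⁻¹ *ᵥ (z - (C *ᵥ μ + d))))
      ((C * H)ᵀ * (C * V * Cᵀ)⁻¹ * (C * H)) := by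
  have h := (gaussianLaw_shift (C *ᵥ μ + d) hCV).comp_mulVec (C * H)
  convert! h using 1
  funext θ
  rw [← Matrix.mulVec_mulVec, add_assoc, ← gaussianLaw_map_affine _ hV]
  congr 1
  funext w
  rw [Matrix.mulVec_add]
  abel

theorem isGaussianShift_additive_output (hV : V.PosSemidef) :
    IsGaussianShift (fun θ => ((gaussianLaw μ V).prod (densityLaw (stdDensity p))).map
        (fun x => C *ᵥ (H *ᵥ θ + x.1) + x.2))
      (fun z => (C * H)ᵀ *ᵥ ((C * V * Cᵀ + 1)⁻¹ *ᵥ (z - C *ᵥ μ)))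
      (Hᵀ * obfuscatedInfo C V * H) := by
  have h := (gaussianLaw_shift (C *ᵥ μ) (posDef_mul_mul_transpose_add_one C hV)).comp_mulVec (C * H)
  rw [show (C * H)ᵀ * (C * V * Cᵀ + 1)⁻¹ * (C * H) = Hᵀ * obfuscatedInfo C V * H by
    simp only [obfuscatedInfo, Matrix.transpose_mul, Matrix.mul_assoc]] at h
  convert! h using 1
  funext θ
  have hCV : (C * V * Cᵀ).PosSemidef := by simpa using hV.mul_mul_conjTranspose_same C
  have h2 : (fun x : (Fin m → ℝ) × (Fin p → ℝ) => C *ᵥ (H *ᵥ θ + x.1) + x.2) =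
      (fun x => x.1 + x.2) ∘ Prod.map (fun w => C *ᵥ w + C *ᵥ (H *ᵥ θ)) id := by
    funext x
    simp [Matrix.mulVec_add, add_comm]
  rw [h2, ← Measure.map_map (by fun_prop) (by fun_prop), densityLaw_stdDensity,
    ← Measure.map_prod_map _ _ (by fun_prop) (by fun_prop), gaussianLaw_map_affine _ hV,
    Measure.map_id, gaussianLaw_add _ _ hCV Matrix.PosSemidef.one, add_zero, Matrix.mulVec_mulVec]

/-- The score given the privacy noise is a function of the measurement noise. -/
theorem additive_score_givenD (θ : Fin n → ℝ) (w : Fin m → ℝ) (d : Fin p → ℝ) :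
    (C * H)ᵀ *ᵥ ((C * V * Cᵀ)⁻¹ *ᵥ (C *ᵥ (H *ᵥ θ + w) + d - (C *ᵥ μ + d))) -
      ((C * H)ᵀ * (C * V * Cᵀ)⁻¹ * (C * H)) *ᵥ θ =
      (C * H)ᵀ *ᵥ ((C * V * Cᵀ)⁻¹ *ᵥ (C *ᵥ (w - μ))) := by
  rw [← Matrix.mulVec_mulVec, ← Matrix.mulVec_mulVec, ← Matrix.mulVec_sub, ← Matrix.mulVec_sub,
    ← Matrix.mulVec_mulVec, Matrix.mulVec_add, Matrix.mulVec_sub C w μ]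
  congr 2
  abel

/-- The score given the measurement noise is a function of the privacy noise. -/
theorem additive_score_givenW (θ : Fin n → ℝ) (w : Fin m → ℝ) (d : Fin p → ℝ) :
    (C * H)ᵀ *ᵥ (C *ᵥ (H *ᵥ θ + w) + d - C *ᵥ w) - ((C * H)ᵀ * (C * H)) *ᵥ θ =
      (C * H)ᵀ *ᵥ d := by
  rw [← Matrix.mulVec_mulVec, ← Matrix.mulVec_sub, ← Matrix.mulVec_mulVec, Matrix.mulVec_add]
  congr 1
  abel

/-- Positive definiteness of `C Cᵀ` says that the rows of `C` are independent; this keeps the law of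
the output given `d` nondegenerate. -/
theorem posDef_mul_mul_transpose {C : Matrix (Fin p) (Fin m) ℝ} (hC : (C * Cᵀ).PosDef)
    (hV : V.PosDef) : (C * V * Cᵀ).PosDef := by
  have hinj : Function.Injective C.vecMul := fun x y hxy => by
    by_contra hne
    have h := hC.dotProduct_mulVec_pos (sub_ne_zero.mpr hne)
    rw [← Matrix.mulVec_mulVec, Matrix.dotProduct_mulVec] at h
    simp [Matrix.mulVec_transpose, Matrix.sub_vecMul, hxy] at h
  simpa using hV.mul_mul_conjTranspose_same hinj

end Additive

theorem contDiff_mulVec {m p : ℕ} (C : Matrix (Fin p) (Fin m) ℝ) :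
    ContDiff ℝ 1 fun y : Fin m → ℝ => C *ᵥ y :=
  (LinearMap.toContinuousLinearMap C.mulVecLin).contDiff

/-! ### The matrices attained -/

/-- Additive Gaussian obfuscation of a single measurement is optimal. -/
theorem isPPFisher_obfuscatedInfo {m n p : ℕ} (H : Matrix (Fin m) (Fin n) ℝ) (μ : Fin m → ℝ)
    {V : Matrix (Fin m) (Fin m) ℝ} (hV : V.PosDef) {C : Matrix (Fin p) (Fin m) ℝ}
    (hC : (C * Cᵀ).PosDef) (θ : Fin n → ℝ) :
    IsPPFisher H (gaussianLaw μ V) (Cᵀ * C) θ (Hᵀ * obfuscatedInfo C V * H) := by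
  have hprob := (isPC1Density_stdDensity p).isProbabilityMeasure
  have hout := isGaussianShift_additive_output H C μ hV.posSemidef
  -- One mechanism is optimal in all directions `v` at once, so the supremum is a maximum and exists
  -- as a matrix.
  refine ⟨hout.symm, fun v => IsGreatest.isLUB ⟨⟨_, ⟨p, p, fun y d => C *ᵥ y + d, stdDensity p,
    ⟨?_, isPC1Density_stdDensity p, ?_⟩, fun y => ?_, hout.hasFisherInfo θ⟩, rfl⟩, ?_⟩⟩
  · exact ContDiff.piecewiseC1 
      (((contDiff_mulVec C).comp contDiff_fst).add contDiff_snd)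
  · exact scoresOrthogonal_of_isGaussianShift (fun θ d => by fun_prop) (fun θ w => by fun_prop)
      (isGaussianShift_additive_givenD H C μ hV.posSemidef (posDef_mul_mul_transpose hC hV))
      (isGaussianShift_additive_givenW H C) (additive_score_givenD H C μ)
      (additive_score_givenW H C)
  · refine ⟨_, (isGaussianShift_additive_givenY C).hasFisherInfo y, ?_⟩
    rw [sub_self]
    exact Matrix.PosSemidef.zero
  · rintro _ ⟨J, ⟨q, r, M, f, hadm, hpriv, hJ⟩, rfl⟩
    refine (single_fisher_le hV C hadm.1.measurable hadm.2.1 hpriv hJ v).trans_eq ?_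
    rw [Matrix.mul_assoc, ← Matrix.mulVec_mulVec, ← Matrix.mulVec_mulVec,
      Matrix.dotProduct_mulVec v, Matrix.vecMul_transpose]

theorem sum_selectTime_eq_blockDiagonal {K m : ℕ} (S : Fin K → Matrix (Fin m) (Fin m) ℝ) :
    ∑ k, (selectTime K m k)ᵀ * S k * selectTime K m k = Matrix.blockDiagonal S := by
  ext ⟨a, k⟩ ⟨b, l⟩
  rw [Matrix.sum_apply, Matrix.blockDiagonal_apply]
  simp [Matrix.mul_apply, selectTime, Prod.ext_iff, ite_and]
  split_ifs with h
  · rw [h]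
  · rfl

theorem map_prod_pi_pi_pi {κ κ' : Type*} [Fintype κ] [Fintype κ'] {α β γ : κ → κ' → Type*}
    [∀ i k, MeasurableSpace (α i k)] [∀ i k, MeasurableSpace (β i k)]
    [∀ i k, MeasurableSpace (γ i k)] (μ : ∀ i k, Measure (α i k)) (ν : ∀ i k, Measure (β i k))
    [∀ i k, IsProbabilityMeasure (μ i k)] [∀ i k, IsProbabilityMeasure (ν i k)]
    {g : ∀ i k, α i k × β i k → γ i k} (hg : ∀ i k, Measurable (g i k)) :
    ((Measure.pi fun i => Measure.pi fun k => μ i k).prod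
        (Measure.pi fun i => Measure.pi fun k => ν i k)).map
      (fun x i k => g i k (x.1 i k, x.2 i k)) =
      Measure.pi fun i => Measure.pi fun k => ((μ i k).prod (ν i k)).map (g i k) := by
  rw [← pi_pi_map_pi (fun i k => (μ i k).prod (ν i k)) hg]
  have h1 : ∀ i, ((Measure.pi fun k => μ i k).prod (Measure.pi fun k => ν i k)).map
      (fun x k => (x.1 k, x.2 k)) = Measure.pi fun k => (μ i k).prod (ν i k) := fun i =>
    map_prod_pi_pi (μ i) (ν i)
  have : ∀ i, IsProbabilityMeasure (((Measure.pi fun k => μ i k).prod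
      (Measure.pi fun k => ν i k)).map (fun x k => (x.1 k, x.2 k))) := fun i => by
    rw [h1]
    infer_instance
  simp only [← h1]
  rw [← Measure.pi_map_pi (fun i => by fun_prop), ← map_prod_pi_pi,
    Measure.map_map (by fun_prop) (by fun_prop), Measure.map_map (by fun_prop) (by fun_prop)]
  rfl

/-! ### Separate obfuscation in the whole system -/

section Multi

variable {N K m n : ℕ} {p : Fin N → Fin K → ℕ}

/-- The mechanism that obfuscates every measurement separately. -/
def additiveMechanism (C : ∀ i k, Matrix (Fin (p i k)) (Fin m) ℝ) : RecMechanism N K m p p :=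
  fun i k x => C i k *ᵥ x.1 ⟨k, le_rfl⟩ + x.2.1 ⟨k, le_rfl⟩

theorem collective_additiveMechanism (C : ∀ i k, Matrix (Fin (p i k)) (Fin m) ℝ)
    (Y : Fin N → Fin K → Fin m → ℝ) (D : ∀ i k, Fin (p i k) → ℝ) :
    collective (additiveMechanism C) Y D = fun i k => C i k *ᵥ Y i k + D i k := by
  funext i k
  rw [collective, recOutput, additiveMechanism]

/-- The constraint holds with equality: given the measurements the outputs are independent, the
other sensors contribute no information, and the contributions of sensor `i` over time assemble to
the block diagonal matrix. -/
theorem userPrivacyConstraint_additiveMechanism (C : ∀ i k, Matrix (Fin (p i k)) (Fin m) ℝ) :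
    UserPrivacyConstraint (fun i k => (C i k)ᵀ * C i k) (additiveMechanism C)
      (fun i k => stdDensity (p i k)) := by
  intro Y i
  have hprob := fun i k => (isPC1Density_stdDensity (p i k)).isProbabilityMeasure
  have hlaw : ∀ y : Fin N → Fin K → Fin m → ℝ, lawGivenY (collective (additiveMechanism C))
      (jointPrivacyNoise fun i k => stdDensity (p i k)) y = Measure.pi fun j =>
        Measure.pi fun k => (densityLaw (stdDensity (p j k))).map (fun d => C j k *ᵥ y j k + d) :=
    fun y => by
      simp only [lawGivenY, collective_additiveMechanism]
      exact pi_pi_map_pi (fun i k => densityLaw (stdDensity (p i k)))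
        (g := fun i k d => C i k *ᵥ y i k + d) fun i k => by fun_prop
  have hsensor : ∀ j, ∃ T, IsGaussianShift (fun x : Fin m × Fin K → ℝ => Measure.pi fun k =>
      (densityLaw (stdDensity (p j k))).map
        (fun d => C j k *ᵥ (Function.update Y i (fun k a => x (a, k)) j k) + d)) T
      (if j = i then Matrix.blockDiagonal (fun k => (C i k)ᵀ * C i k) else 0) := fun j => by
    by_cases hj : j = i
    · subst hj
      rw [if_pos rfl, ← sum_selectTime_eq_blockDiagonal]
      simp only [Function.update_self]
      have := IsGaussianShift.pi fun k =>
        (isGaussianShift_additive_givenY (C j k)).comp_mulVec (selectTime K m k)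
      simp only [selectTime_mulVec] at this
      exact ⟨_, this⟩
    · rw [if_neg hj]
      simp only [Function.update_of_ne hj]
      have : ∀ k, IsProbabilityMeasure ((densityLaw (stdDensity (p j k))).map
          (fun d => C j k *ᵥ Y j k + d)) := fun k =>
        Measure.isProbabilityMeasure_map (by fun_prop)
      exact ⟨_, IsGaussianShift.const _⟩
  choose T hT using hsensor
  have h := IsGaussianShift.pi hT
  rw [Finset.sum_ite_eq' Finset.univ i fun _ => Matrix.blockDiagonal fun k => (C i k)ᵀ * C i k,
    if_pos (Finset.mem_univ i)] at h
  refine ⟨_, ?_, (sub_self (Matrix.blockDiagonal fun k => (C i k)ᵀ * C i k)).symm ▸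
    Matrix.PosSemidef.zero⟩
  simp only [hlaw]
  exact h.hasFisherInfo _

/-- Conditional scores of independent outputs add up, so the collective score given `d` is again a
function of `w` only, and the one given `w` a function of `d` only. -/
theorem multiAdmissible_additiveMechanism (H : Fin N → Fin K → Matrix (Fin m) (Fin n) ℝ)
    (μ : Fin N → Fin K → Fin m → ℝ) {V : Fin N → Fin K → Matrix (Fin m) (Fin m) ℝ}
    (hV : ∀ i k, (V i k).PosDef) {C : ∀ i k, Matrix (Fin (p i k)) (Fin m) ℝ}
    (hC : ∀ i k, (C i k * (C i k)ᵀ).PosDef) :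
    MultiAdmissible H (fun i k => gaussianLaw (μ i k) (V i k)) (additiveMechanism C)
      (fun i k => stdDensity (p i k)) := by
  have hprob := fun i k => (isPC1Density_stdDensity (p i k)).isProbabilityMeasure
  have hd : IsProbabilityMeasure (jointPrivacyNoise fun i k => stdDensity (p i k)) := by
    unfold jointPrivacyNoise
    infer_instance
  have hw : IsProbabilityMeasure (jointNoise fun i k => gaussianLaw (μ i k) (V i k)) := by
    unfold jointNoise
    infer_instance
  refine ⟨fun i k => ContDiff.piecewiseC1 ?_, fun i k => isPC1Density_stdDensity _, ?_⟩
  · exact ((contDiff_mulVec (C i k)).comp (by fun_prop)).add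
      ((ContinuousLinearMap.proj (R := ℝ) (φ := fun t : {t : Fin K // t ≤ k} => Fin (p i t) → ℝ)
        ⟨k, le_rfl⟩).contDiff.comp (contDiff_fst.comp contDiff_snd))
  · have hlawD : ∀ d : ∀ i k, Fin (p i k) → ℝ, (fun θ => Measure.pi fun i => Measure.pi fun k =>
        (gaussianLaw (μ i k) (V i k)).map (fun w => C i k *ᵥ (H i k *ᵥ θ + w) + d i k)) =
        lawGivenD (fun θ i k => H i k *ᵥ θ) (jointNoise fun i k => gaussianLaw (μ i k) (V i k))
          (collective (additiveMechanism C)) d := fun d => by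
      funext θ
      simp only [lawGivenD, collective_additiveMechanism]
      exact (pi_pi_map_pi (fun i k => gaussianLaw (μ i k) (V i k))
        (g := fun i k w => C i k *ᵥ (H i k *ᵥ θ + w) + d i k) fun i k => by fun_prop).symm
    have hlawW : ∀ w : Fin N → Fin K → Fin m → ℝ, (fun θ => Measure.pi fun i =>
        Measure.pi fun k => (densityLaw (stdDensity (p i k))).map
          (fun d => C i k *ᵥ (H i k *ᵥ θ + w i k) + d)) =
        lawGivenW (fun θ i k => H i k *ᵥ θ) (collective (additiveMechanism C))
          (jointPrivacyNoise fun i k => stdDensity (p i k)) w := fun w => by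
      funext θ
      simp only [lawGivenW, collective_additiveMechanism]
      exact (pi_pi_map_pi (fun i k => densityLaw (stdDensity (p i k)))
        (g := fun i k d => C i k *ᵥ (H i k *ᵥ θ + w i k) + d) fun i k => by fun_prop).symm
    have hgD := fun d : ∀ i k, Fin (p i k) → ℝ => IsGaussianShift.pi fun i =>
      IsGaussianShift.pi fun k => isGaussianShift_additive_givenD (H i k) (C i k) (μ i k)
        (hV i k).posSemidef (posDef_mul_mul_transpose (hC i k) (hV i k)) (d i k)
    have hgW := fun w : Fin N → Fin K → Fin m → ℝ => IsGaussianShift.pi fun i =>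
      IsGaussianShift.pi fun k => isGaussianShift_additive_givenW (H i k) (C i k) (w i k)
    simp only [hlawD] at hgD
    simp only [hlawW] at hgW
    refine scoresOrthogonal_of_isGaussianShift ?_ ?_ hgD hgW
      (gD := fun w => ∑ i, ∑ k, (C i k * H i k)ᵀ *ᵥ ((C i k * V i k * (C i k)ᵀ)⁻¹ *ᵥ
        (C i k *ᵥ (w i k - μ i k))))
      ?_ (gW := fun d => ∑ i, ∑ k, (C i k * H i k)ᵀ *ᵥ d i k) ?_
    rotate_left 2
    · intro θ w d
      simp only [collective_additiveMechanism, Matrix.sum_mulVec, ← Finset.sum_sub_distrib]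
      exact Finset.sum_congr rfl fun i _ => Finset.sum_congr rfl fun k _ =>
        additive_score_givenD (H i k) (C i k) (μ i k) θ (w i k) (d i k)
    · intro θ w d
      simp only [collective_additiveMechanism, Matrix.sum_mulVec, ← Finset.sum_sub_distrib]
      exact Finset.sum_congr rfl fun i _ => Finset.sum_congr rfl fun k _ =>
        additive_score_givenW (H i k) (C i k) θ (w i k) (d i k)
    · intro θ d
      simp only [collective_additiveMechanism]
      exact measurable_pi_lambda _ fun i => measurable_pi_lambda _ fun k => by
        simp only [Pi.add_apply]
        fun_prop
    · intro θ w
      simp only [collective_additiveMechanism]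
      fun_prop

/-- Separate additive Gaussian obfuscation is optimal for the whole system. -/
theorem isMultiPPFisher_obfuscatedInfo (H : Fin N → Fin K → Matrix (Fin m) (Fin n) ℝ)
    (μ : Fin N → Fin K → Fin m → ℝ) {V : Fin N → Fin K → Matrix (Fin m) (Fin m) ℝ}
    (hV : ∀ i k, (V i k).PosDef) {C : ∀ i k, Matrix (Fin (p i k)) (Fin m) ℝ}
    (hC : ∀ i k, (C i k * (C i k)ᵀ).PosDef) (θ : Fin n → ℝ) :
    IsMultiPPFisher H (fun i k => gaussianLaw (μ i k) (V i k)) (fun i k => (C i k)ᵀ * C i k) θ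
      (∑ i, ∑ k, (H i k)ᵀ * obfuscatedInfo (C i k) (V i k) * H i k) := by
  have hprob := fun i k => (isPC1Density_stdDensity (p i k)).isProbabilityMeasure
  have hout := IsGaussianShift.pi fun i => IsGaussianShift.pi fun k =>
    isGaussianShift_additive_output (H i k) (C i k) (μ i k) (hV i k).posSemidef
  have hlaw : outputLaw (fun θ' i k => H i k *ᵥ θ')
      (jointNoise fun i k => gaussianLaw (μ i k) (V i k)) (collective (additiveMechanism C))
      (jointPrivacyNoise fun i k => stdDensity (p i k)) = fun θ => Measure.pi fun i =>
        Measure.pi fun k => ((gaussianLaw (μ i k) (V i k)).prod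
          (densityLaw (stdDensity (p i k)))).map
            (fun x => C i k *ᵥ (H i k *ᵥ θ + x.1) + x.2) := by
    funext θ
    simp only [outputLaw, collective_additiveMechanism]
    exact map_prod_pi_pi_pi (fun i k => gaussianLaw (μ i k) (V i k))
      (fun i k => densityLaw (stdDensity (p i k)))
      (g := fun i k x => C i k *ᵥ (H i k *ᵥ θ + x.1) + x.2) fun i k => by fun_prop
  refine ⟨hout.symm, fun v => IsGreatest.isLUB ⟨⟨_, ⟨p, p, additiveMechanism C,
    fun i k => stdDensity (p i k), multiAdmissible_additiveMechanism H μ hV hC,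
    userPrivacyConstraint_additiveMechanism C, hlaw ▸ hout.hasFisherInfo θ⟩, rfl⟩, ?_⟩⟩
  rintro _ ⟨J, ⟨q, r, M, f, hadm, hpriv, hJ⟩, rfl⟩
  have hM : ∀ i k, Measurable (M i k) := fun i k => by
    have : OpensMeasurableSpace ((∀ t : {t : Fin K // t ≤ k}, Fin (q i t) → ℝ) ×
        (∀ (j : Fin N) (t : {t : Fin K // t < k}), Fin (r j t) → ℝ)) := Prod.opensMeasurableSpace
    have : OpensMeasurableSpace (({t : Fin K // t ≤ k} → Fin m → ℝ) ×
        (∀ t : {t : Fin K // t ≤ k}, Fin (q i t) → ℝ) ×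
        (∀ (j : Fin N) (t : {t : Fin K // t < k}), Fin (r j t) → ℝ)) := Prod.opensMeasurableSpace
    exact (hadm.1 i k).measurable
  refine (multi_fisher_le hV C hM hadm.2.1 hpriv hJ v).trans_eq ?_
  rw [Matrix.sum_mulVec, dotProduct_sum]
  refine Finset.sum_congr rfl fun i _ => ?_
  rw [Matrix.sum_mulVec, dotProduct_sum]
  refine Finset.sum_congr rfl fun k _ => ?_
  rw [Matrix.mul_assoc, ← Matrix.mulVec_mulVec, ← Matrix.mulVec_mulVec,
    Matrix.dotProduct_mulVec v, Matrix.vecMul_transpose]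

end Multi

end PrivacyFisher

end

theorem theorem6 {N K m n : ℕ}
    (H : Fin N → Fin K → Matrix (Fin m) (Fin n) ℝ)
    (μ : Fin N → Fin K → Fin m → ℝ)
    (V : Fin N → Fin K → Matrix (Fin m) (Fin m) ℝ) (hV : ∀ i k, (V i k).PosDef)
    (S : Fin N → Fin K → Matrix (Fin m) (Fin m) ℝ) (hS : ∀ i k, (S i k).PosSemidef)
    (hinv : IsUnit (∑ i, ∑ k, (H i k)ᵀ * S i k * H i k))
    (θ : Fin n → ℝ) :
    ∃ (A : Matrix (Fin n) (Fin n) ℝ) (B : Fin N → Fin K → Matrix (Fin n) (Fin n) ℝ),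
      PrivacyFisher.IsMultiPPFisher H (fun i k => PrivacyFisher.gaussianLaw (μ i k) (V i k)) S θ A ∧
      (∀ i k, PrivacyFisher.IsPPFisher (H i k)
        (PrivacyFisher.gaussianLaw (μ i k) (V i k)) (S i k) θ (B i k)) ∧
      A = ∑ i, ∑ k, B i k := by
  -- The same factor `C i k` serves for the single and the joint problem, so the two optimal values
  -- agree definitionally.
  choose r C hCS hC using fun i k => PrivacyFisher.exists_transpose_mul_self_eq (hS i k)
  obtain rfl : (fun i k => (C i k)ᵀ * C i k) = S := funext₂ hCS
  exact ⟨_, _, PrivacyFisher.isMultiPPFisher_obfuscatedInfo H μ hV hC θ,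
    fun i k => PrivacyFisher.isPPFisher_obfuscatedInfo (H i k) (μ i k) (hV i k) (hC i k) θ, rfl⟩
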